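/- Let $n,m\ge 0$. Let $\mathbb P^{n|m}$ be complex projective superspace, i.e. the complex manifold $\mathbb P^n$ with the sheaf of superalgebras $\mathcal O=\bigoplus_{j\ge 0}\bigwedge^j(\mathcal O_{\mathbb P^n}(-1)^{\oplus m})$, graded by the parity of $j$. Put $\mathcal O(d)=\mathcal O\otimes_{\mathcal O_{\mathbb P^n}}\mathcal O_{\mathbb P^n}(d)$; its local sections are the holomorphic functions, homogeneous of degree $d$, of the homogeneous coordinates $z_0,\dots,z_n$ (even) and $\theta_1,\dots,\theta_m$ (odd), all of degree one. Let $\mathcal T$ be the tangent sheaf, i.e. the sheaf of superderivations of $\mathcal O$, and $\mathcal T^*=\mathcal{H}om_{\mathcal O}(\mathcal T,\mathcal O)$. For a sheaf $M$ of $\mathcal O$-supermodules let $\Pi M=M\otimes\Pi\mathcal O$ be the parity change (the same left module with the opposite grading), $M^{\oplus p|q}=M^{\oplus p}\oplus(\Pi M)^{\oplus q}$, $M(d)=M\otimes_{\mathcal O}\mathcal O(d)$, and let $\mathrm{Sym}^kM$ be the supersymmetric power over $\mathcal O$ (in which $st=(-1)^{|s||t|}ts$), with $\mathrm{Sym}^0M=\mathcal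 O$. Exact sequences of sheaves of supermodules are understood with even $\mathcal O$-linear maps. Let $p:\mathcal O(-1)^{\oplus m|n+1}\to\Pi\mathcal O$ be the Euler map $p(g_1,\dots,g_m\,|\,f_0,\dots,f_n)=\sum_a g_a\theta_a+\sum_j f_jz_j$. Then there is an even map $i$ such that the parity-reversed dual Euler sequence $$0\to\Pi\mathcal T^*\xrightarrow{\ i\ }\mathcal O(-1)^{\oplus m|n+1}\xrightarrow{\ p\ }\Pi\mathcal O\to 0$$ is exact, and for every $k\ge 1$ there is a short exact sequence of sheaves of $\mathcal O$-supermodules $$0\to \mathrm{Sym}^k\,\Pi\mathcal T^*\xrightarrow{\ \alpha\ }\bigl(\mathrm{Sym}^k\,\mathcal O^{\oplus m|n+1}\bigr)(-k)\xrightarrow{\ \beta\ }\Pi\,\mathrm{Sym}^{k-1}\,\Pi\mathcal T^*\to 0$$ which is obtained from the first one as follows: * $\alpha=c\circ \mathrm{Sym}^k(i)$, where $c:\mathrm{Sym}^k(\mathcal O(-1)^{\oplus m|n+1})\to(\mathrm{Sym}^k\mathcal O^{\oplus m|n+1})(-k)$ is the canonical even isomorphism, $c(g_1e_{j_1}\cdots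 g_ke_{j_k})=(e_{j_1}\cdots e_{j_k})\otimes g_1\cdots g_k$ for even local sections $g_1,\dots,g_k$ of $\mathcal O(-1)$ and standard generators $e_j$; * $\beta\circ c$ is contraction with $p$: it sends $i(\omega_1)\cdots i(\omega_{k-1})\,f$ to $p(f)\,\omega_1\cdots\omega_{k-1}$ for local sections $\omega_1,\dots,\omega_{k-1}$ of $\Pi\mathcal T^*$ and odd local sections $f$ of $\mathcal O(-1)^{\oplus m|n+1}$. Consequently, for every $k\ge1$ there are connecting homomorphisms $\delta^q$ which give a long exact cohomology sequence $$0\to H^0(\mathrm{Sym}^k\Pi\mathcal T^*)\to\cdots\to H^q(\mathrm{Sym}^k\Pi\mathcal T^*)\xrightarrow{\alpha} H^q\bigl((\mathrm{Sym}^k\mathcal O^{\oplus m|n+1})(-k)\bigr)\xrightarrow{\beta} H^q(\Pi\,\mathrm{Sym}^{k-1}\Pi\mathcal T^*)\xrightarrow{\delta^q}H^{q+1}(\mathrm{Sym}^k\Pi\mathcal T^*)\to\cdots,$$ and the $\delta^q$ are natural for endomorphisms of the short exact sequence of abelian sheaves (so they commute with the parity involutions and with multiplication by complex numbers). As $\Pi\,\mathrm{Sym}^{k-1}\Pi\mathcal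 T^*$ has the cohomology of $\mathrm{Sym}^{k-1}\Pi\mathcal T^*$ with reversed parity, this relates the cohomology of the $k$-th power to that of the $(k-1)$-st, recursively in $k$. -/

import Mathlib

open CategoryTheory TopologicalSpace Opposite
open scoped TensorProduct

noncomputable section

namespace SuperProj

/-! ### Projective space and its cone -/

/-- Complex projective space `ℙⁿ` with the quotient topology from `ℂⁿ⁺¹ ∖ {0}`. -/
def projSpace (n : ℕ) : TopCat.{0} :=
  @TopCat.of (Projectivization ℂ (Fin (n + 1) → ℂ))
    (TopologicalSpace.coinduced
      (fun v : {v : Fin (n + 1) → ℂ // v ≠ 0} => Projectivization.mk ℂ v.1 v.2) inferInstance)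

/-- The point of `ℙⁿ` with homogeneous coordinates `v`. -/
def point {n : ℕ} (v : Fin (n + 1) → ℂ) (h : v ≠ 0) : projSpace n := Projectivization.mk ℂ v h

/-- The punctured cone over `U ⊆ ℙⁿ`: the nonzero vectors `v` with `[v] ∈ U`. -/
def coneSet {n : ℕ} (U : Opens (projSpace n)) : Set (Fin (n + 1) → ℂ) :=
  {v | ∃ h : v ≠ 0, point v h ∈ U}

/-- The punctured cone over `U`, as a type. -/
abbrev Cone {n : ℕ} (U : Opens (projSpace n)) : Type := coneSet U

theorem coneSet_mono {n : ℕ} {V U : Opens (projSpace n)} (h : V ≤ U) : coneSet V ⊆ coneSet U :=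
  fun _ hv => ⟨hv.1, h hv.2⟩

theorem smul_mem_coneSet {n : ℕ} {U : Opens (projSpace n)} {v : Fin (n + 1) → ℂ}
    (hv : v ∈ coneSet U) {c : ℂ} (hc : c ≠ 0) : c • v ∈ coneSet U := by
  obtain ⟨h, hU⟩ := hv
  refine ⟨smul_ne_zero hc h, ?_⟩
  have : point (c • v) (smul_ne_zero hc h) = point v h := by
    exact (Projectivization.mk_eq_mk_iff' ℂ _ _ _ _).2 ⟨c, rfl⟩
  rw [this]; exact hU

/-- Multiplication by a nonzero scalar on the cone. -/
def Cone.smul {n : ℕ} {U : Opens (projSpace n)} (c : ℂ) (hc : c ≠ 0) (v : Cone U) : Cone U :=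
  ⟨c • v.1, smul_mem_coneSet v.2 hc⟩

/-- Inclusion of cones. -/
def Cone.incl {n : ℕ} {V U : Opens (projSpace n)} (h : V ≤ U) (v : Cone V) : Cone U :=
  ⟨v.1, coneSet_mono h v.2⟩

/-! ### The exterior algebra in the odd coordinates -/

/-- The Grassmann algebra `Λ = ℂ[θ₁, …, θₘ]`. -/
abbrev Lam (m : ℕ) : Type := ExteriorAlgebra ℂ (Fin m → ℂ)

/-- The odd coordinate `θₐ`. -/
def theta {m : ℕ} (a : Fin m) : Lam m := ExteriorAlgebra.ι ℂ (Pi.single a 1)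

/-- The basis of monomials `θ_I`, `I ⊆ {1, …, m}`. -/
def thetaBasis (m : ℕ) : Module.Basis (Finset (Fin m)) ℂ (Lam m) :=
  (Pi.basisFun ℂ (Fin m)).ExteriorAlgebra

/-- The automorphism of `Λ` that multiplies every `θₐ` by `c`. -/
def scale {m : ℕ} (c : ℂ) : Lam m →ₐ[ℂ] Lam m :=
  ExteriorAlgebra.map (c • LinearMap.id)

/-- The parity involution of `Λ`: `+1` on even and `-1` on odd elements. -/
def inv {m : ℕ} : Lam m →ₐ[ℂ] Lam m := CliffordAlgebra.involute

theorem inv_inv {m : ℕ} (x : Lam m) : inv (inv x) = x := CliffordAlgebra.involute_involute x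

theorem inv_ι {m : ℕ} (w : Fin m → ℂ) :
    inv (ExteriorAlgebra.ι ℂ w) = -ExteriorAlgebra.ι ℂ w := CliffordAlgebra.involute_ι w

theorem inv_theta {m : ℕ} (a : Fin m) : inv (theta a) = -theta a := inv_ι _

theorem scale_ι {m : ℕ} (c : ℂ) (w : Fin m → ℂ) :
    scale c (ExteriorAlgebra.ι ℂ w) = c • ExteriorAlgebra.ι ℂ w := by
  simp [scale]

theorem scale_inv {m : ℕ} (c : ℂ) (x : Lam m) : scale c (inv x) = inv (scale c x) := by
  have : (scale c).comp inv = (inv (m := m)).comp (scale c) := by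
    apply ExteriorAlgebra.hom_ext
    ext w
    simp [scale_ι, inv_ι]
  exact DFunLike.congr_fun this x

/-- `Λ` is supercommutative. -/
theorem lam_comm {m : ℕ} (x : Lam m) : ∀ y : Lam m,
    (x + inv x) * y = y * (x + inv x) ∧ (x - inv x) * y = inv y * (x - inv x) := by
  induction x using ExteriorAlgebra.induction with
  | algebraMap r =>
    intro y
    have : inv (algebraMap ℂ (Lam m) r) = algebraMap ℂ (Lam m) r := AlgHom.commutes _ r
    rw [this]
    refine ⟨?_, by simp⟩
    rw [← map_add]; exact Algebra.commutes _ _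
  | ι w =>
    intro y
    rw [inv_ι]
    refine ⟨by simp, ?_⟩
    have key : ExteriorAlgebra.ι ℂ w * y = inv y * ExteriorAlgebra.ι ℂ w := by
      induction y using ExteriorAlgebra.induction with
      | algebraMap r =>
        have : inv (algebraMap ℂ (Lam m) r) = algebraMap ℂ (Lam m) r := AlgHom.commutes _ r
        rw [this]; exact (Algebra.commutes _ _).symm
      | ι u =>
        rw [inv_ι, neg_mul]
        exact eq_neg_of_add_eq_zero_left (by
          have := ExteriorAlgebra.ι_add_mul_swap (R := ℂ) w u
          exact this)
      | mul a b ha hb => rw [← mul_assoc, ha, mul_assoc, hb, map_mul, mul_assoc]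
      | add a b ha hb => rw [mul_add, ha, hb, map_add, add_mul]
    rw [sub_neg_eq_add, add_mul, mul_add, key]
  | mul a b ha hb =>
    intro y
    have e1 : (2 : ℂ) • (a * b + inv (a * b)) =
        (a + inv a) * (b + inv b) + (a - inv a) * (b - inv b) := by
      rw [map_mul, two_smul]; noncomm_ring
    have e2 : (2 : ℂ) • (a * b - inv (a * b)) =
        (a + inv a) * (b - inv b) + (a - inv a) * (b + inv b) := by
      rw [map_mul, two_smul]; noncomm_ring
    constructor
    · apply smul_right_injective _ (two_ne_zero : (2 : ℂ) ≠ 0)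
      simp only
      rw [← smul_mul_assoc, ← mul_smul_comm, e1]
      generalize a + inv a = p, b + inv b = q, a - inv a = r, b - inv b = s at *
      rw [add_mul, mul_add, mul_assoc p, (hb y).1, ← mul_assoc p, (ha y).1, mul_assoc y,
        mul_assoc r, (hb y).2, ← mul_assoc r, (ha _).2, inv_inv, mul_assoc y]
    · apply smul_right_injective _ (two_ne_zero : (2 : ℂ) ≠ 0)
      simp only
      rw [← smul_mul_assoc, ← mul_smul_comm, e2]
      generalize a + inv a = p, b + inv b = q, a - inv a = r, b - inv b = s at *
      rw [add_mul, mul_add, mul_assoc p, (hb y).2, ← mul_assoc p, (ha _).1, mul_assoc (inv y),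
        mul_assoc r, (hb y).1, ← mul_assoc r, (ha _).2, mul_assoc (inv y)]
  | add a b ha hb =>
    intro y
    rw [map_add]
    constructor
    · rw [show a + b + (inv a + inv b) = (a + inv a) + (b + inv b) by abel, add_mul, mul_add,
        (ha y).1, (hb y).1]
    · rw [show a + b - (inv a + inv b) = (a - inv a) + (b - inv b) by abel, add_mul, mul_add,
        (ha y).2, (hb y).2]

/-! ### Sections of the sheaves `𝒪(d)` on `ℙⁿ|ᵐ` -/

/-- A `Λ`-valued function on the cone over `U` is holomorphic if all its coefficients in the
monomials `θ_I` are holomorphic functions of the homogeneous coordinates. -/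
def IsHol {n m : ℕ} {U : Opens (projSpace n)} (f : Cone U → Lam m) : Prop :=
  ∀ I : Finset (Fin m), DifferentiableOn ℂ
    (Function.extend Subtype.val (fun v => (thetaBasis m).repr (f v) I) 0) (coneSet U)

/-- `f` is homogeneous of total degree `d`, where the coordinates `z` and the `θₐ` all have
degree one. For `f = ∑ f_I θ_I` this means that `f_I` is homogeneous of degree `d - |I|`,
that is, a section of `𝒪(d - |I|)` on `ℙⁿ`. -/
def IsHomog {n m : ℕ} {U : Opens (projSpace n)} (d : ℤ) (f : Cone U → Lam m) : Prop :=
  ∀ (c : ℂ) (hc : c ≠ 0) (v : Cone U), f (v.smul c hc) = c ^ d • scale c⁻¹ (f v)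

section hol
variable {n m : ℕ} {U V : Opens (projSpace n)}

theorem isHol_iff_exists (f : Cone U → Lam m) : IsHol f ↔ ∀ I, ∃ g : (Fin (n + 1) → ℂ) → ℂ,
    DifferentiableOn ℂ g (coneSet U) ∧ ∀ v : Cone U, (thetaBasis m).repr (f v) I = g v.1 := by
  refine forall_congr' fun I => ⟨fun h => ⟨_, h, fun v => ?_⟩, ?_⟩
  · exact (Subtype.val_injective.extend_apply
      (fun v : Cone U => (thetaBasis m).repr (f v) I) 0 v).symm
  · rintro ⟨g, hg, hgf⟩
    refine hg.congr fun v hv => ?_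
    rw [← hgf ⟨v, hv⟩]
    exact Subtype.val_injective.extend_apply
      (fun v : Cone U => (thetaBasis m).repr (f v) I) 0 ⟨v, hv⟩

theorem IsHol.linear {f : Cone U → Lam m} (hf : IsHol f) (L : Lam m →ₗ[ℂ] Lam m) :
    IsHol (fun v => L (f v)) := by
  rw [isHol_iff_exists] at hf ⊢
  choose g hg hgf using hf
  intro I
  refine ⟨fun v => ∑ J, g J v * (thetaBasis m).repr (L (thetaBasis m J)) I, ?_, fun v => ?_⟩
  · exact DifferentiableOn.fun_sum fun J _ => (hg J).mul_const _
  · conv_lhs => rw [← (thetaBasis m).sum_repr (f v)]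
    simp [map_sum, hgf]

theorem IsHol.add {f g : Cone U → Lam m} (hf : IsHol f) (hg : IsHol g) :
    IsHol (fun v => f v + g v) := by
  rw [isHol_iff_exists] at *
  intro I
  obtain ⟨a, ha, ha'⟩ := hf I
  obtain ⟨b, hb, hb'⟩ := hg I
  exact ⟨fun v => a v + b v, ha.add hb, fun v => by simp [ha', hb']⟩

theorem IsHol.const (x : Lam m) : IsHol (fun _ : Cone U => x) := by
  rw [isHol_iff_exists]
  exact fun I => ⟨fun _ => (thetaBasis m).repr x I, differentiableOn_const _, fun _ => rfl⟩

theorem IsHol.coord_smul {f : Cone U → Lam m} (hf : IsHol f) (j : Fin (n + 1)) :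
    IsHol (fun v => v.1 j • f v) := by
  rw [isHol_iff_exists] at *
  intro I
  obtain ⟨a, ha, ha'⟩ := hf I
  exact ⟨fun v => v j * a v, (differentiableOn_apply j _).mul ha, fun v => by simp [ha']⟩

theorem IsHol.mul {f g : Cone U → Lam m} (hf : IsHol f) (hg : IsHol g) :
    IsHol (fun v => f v * g v) := by
  rw [isHol_iff_exists] at *
  choose a ha ha' using hf
  choose b hb hb' using hg
  intro I
  refine ⟨fun v => ∑ J, ∑ K, a J v * (b K v *
    (thetaBasis m).repr (thetaBasis m J * thetaBasis m K) I), ?_, fun v => ?_⟩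
  · exact DifferentiableOn.fun_sum fun J _ => DifferentiableOn.fun_sum fun K _ =>
      (ha J).mul ((hb K).mul_const _)
  · conv_lhs => rw [← (thetaBasis m).sum_repr (f v), ← (thetaBasis m).sum_repr (g v)]
    simp [Finset.sum_mul_sum, ha', hb', mul_left_comm]

theorem IsHol.res {f : Cone U → Lam m} (hf : IsHol f) (h : V ≤ U) :
    IsHol (fun v : Cone V => f (v.incl h)) := by
  rw [isHol_iff_exists] at *
  intro I
  obtain ⟨a, ha, ha'⟩ := hf I
  exact ⟨a, ha.mono (coneSet_mono h), fun v => ha' _⟩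

theorem IsHomog.mul {d e : ℤ} {f g : Cone U → Lam m} (hf : IsHomog d f) (hg : IsHomog e g) :
    IsHomog (d + e) (fun v => f v * g v) := by
  intro c hc v
  simp only
  rw [hf, hg, zpow_add₀ hc, map_mul, smul_mul_smul_comm]

end hol

end SuperProj

namespace SuperProj

variable {n : ℕ}

/-- The sections over `U` of the structure sheaf of `ℙⁿ|ᵐ`: holomorphic `Λ`-valued functions on
the cone over `U` of total degree zero, i.e. the sections of `⨁ₖ ⋀ᵏ (𝒪(-1)^m)` over `U`. -/
def O (m : ℕ) (U : Opens (projSpace n)) : Subalgebra ℂ (Cone U → Lam m) where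
  carrier := {f | IsHol f ∧ IsHomog 0 f}
  mul_mem' ha hb := ⟨ha.1.mul hb.1, by
    have := ha.2.mul hb.2
    rw [add_zero] at this
    exact this⟩
  add_mem' ha hb := ⟨ha.1.add hb.1, fun c hc v => by simp [ha.2 c hc v, hb.2 c hc v]⟩
  algebraMap_mem' r := ⟨IsHol.const _, fun c hc v => by
    change algebraMap ℂ (Lam m) r = _ • scale _ (algebraMap ℂ (Lam m) r)
    simp⟩

/-- The sections over `U` of `𝒪(d)` on `ℙⁿ|ᵐ`, i.e. of `⨁ₖ ⋀ᵏ (𝒪(-1)^m) ⊗ 𝒪(d)`. -/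
def twistSec (m : ℕ) (d : ℤ) (U : Opens (projSpace n)) : Submodule ℂ (Cone U → Lam m) where
  carrier := {f | IsHol f ∧ IsHomog d f}
  add_mem' ha hb := ⟨ha.1.add hb.1, fun c hc v => by simp [ha.2 c hc v, hb.2 c hc v]⟩
  zero_mem' := ⟨IsHol.const 0, fun c hc v => by simp⟩
  smul_mem' r f hf := ⟨hf.1.linear (LinearMap.lsmul ℂ (Lam m) r), fun c hc v => by
    change r • f (v.smul c hc) = c ^ d • scale c⁻¹ (r • f v)
    rw [hf.2 c hc v, map_smul, smul_comm r]⟩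

variable {m : ℕ} {U V W : Opens (projSpace n)}

/-- The parity involution on `𝒪`. -/
def O.par : O m U →ₐ[ℂ] O m U where
  toFun f := ⟨fun v => inv (f.1 v), f.2.1.linear inv.toLinearMap, fun c hc v => by
    simp [f.2.2 c hc v, scale_inv]⟩
  map_one' := Subtype.ext (funext fun _ => map_one _)
  map_mul' _ _ := Subtype.ext (funext fun _ => map_mul _ _ _)
  map_zero' := Subtype.ext (funext fun _ => map_zero _)
  map_add' _ _ := Subtype.ext (funext fun _ => map_add _ _ _)
  commutes' r := Subtype.ext (funext fun _ => AlgHom.commutes _ r)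

/-- Restriction of sections of `𝒪`. -/
def O.res (h : V ≤ U) : O m U →ₐ[ℂ] O m V where
  toFun f := ⟨fun v => f.1 (v.incl h), f.2.1.res h, fun c hc v => f.2.2 c hc (v.incl h)⟩
  map_one' := rfl
  map_mul' _ _ := rfl
  map_zero' := rfl
  map_add' _ _ := rfl
  commutes' _ := rfl

theorem O.par_par (a : O m U) : O.par (O.par a) = a :=
  Subtype.ext (funext fun _ => inv_inv _)

theorem O.res_par (h : V ≤ U) (a : O m U) : O.res h (O.par a) = O.par (O.res h a) := rfl

theorem O.even_comm {a : O m U} (ha : O.par a = a) (b : O m U) : b * a = a * b := by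
  refine Subtype.ext (funext fun v => ?_)
  have h1 : inv (a.1 v) = a.1 v := congrFun (congrArg Subtype.val ha) v
  have := (lam_comm (a.1 v) (b.1 v)).1
  rw [h1, ← two_smul ℂ, smul_mul_assoc, mul_smul_comm] at this
  exact (smul_right_injective _ (two_ne_zero : (2 : ℂ) ≠ 0) this).symm

theorem O.odd_comm {a : O m U} (ha : O.par a = -a) (b : O m U) : b * a = a * O.par b := by
  refine Subtype.ext (funext fun v => ?_)
  have h1 : inv (a.1 v) = -a.1 v := congrFun (congrArg Subtype.val ha) v
  have := (lam_comm (a.1 v) (inv (b.1 v))).2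
  rw [h1, sub_neg_eq_add, ← two_smul ℂ, smul_mul_assoc, mul_smul_comm, inv_inv] at this
  exact (smul_right_injective _ (two_ne_zero : (2 : ℂ) ≠ 0) this).symm

instance twistModule (d : ℤ) : Module (O m U) (twistSec m d U) where
  smul a s := ⟨fun v => a.1 v * s.1 v, a.2.1.mul s.2.1, by
    have := a.2.2.mul s.2.2
    rw [zero_add] at this
    exact this⟩
  one_smul s := Subtype.ext (funext fun v => one_mul _)
  mul_smul a b s := Subtype.ext (funext fun v => mul_assoc _ _ _)
  smul_zero a := Subtype.ext (funext fun v => mul_zero _)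
  smul_add a s t := Subtype.ext (funext fun v => mul_add _ _ _)
  add_smul a b s := Subtype.ext (funext fun v => add_mul _ _ _)
  zero_smul s := Subtype.ext (funext fun v => zero_mul _)

instance twistTower (d : ℤ) : IsScalarTower ℂ (O m U) (twistSec m d U) where
  smul_assoc c a s := Subtype.ext (funext fun v => smul_mul_assoc c (a.1 v) (s.1 v))

variable (n m) in
/-- The presheaf of rings underlying the structure sheaf. -/
def presheafO : (Opens (projSpace n))ᵒᵖ ⥤ RingCat.{0} where
  obj U := RingCat.of (O m U.unop)
  map f := RingCat.ofHom (O.res (m := m) f.unop.le).toRingHom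
  map_id _ := rfl
  map_comp _ _ := rfl

variable (n m) in
theorem presheafO_isSheaf : TopCat.Presheaf.IsSheaf (presheafO n m) := by
  rw [TopCat.Presheaf.isSheaf_iff_isSheaf_comp (forget RingCat.{0})]
  apply TopCat.Presheaf.isSheaf_of_isSheafUniqueGluing_types
  intro ι Uι sf hsf
  have hcov : ∀ v : Cone (iSup Uι), ∃ i, v.1 ∈ coneSet (Uι i) := by
    rintro ⟨v, h, hv⟩
    obtain ⟨i, hi⟩ := Opens.mem_iSup.1 hv
    exact ⟨i, h, hi⟩
  have hcompat : ∀ i j (v : Fin (n + 1) → ℂ) (hi : v ∈ coneSet (Uι i)) (hj : v ∈ coneSet (Uι j)),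
      (sf i : O m (Uι i)).1 ⟨v, hi⟩ = (sf j : O m (Uι j)).1 ⟨v, hj⟩ := by
    intro i j v hi hj
    have h := hsf i j
    have h2 := congrFun (congrArg Subtype.val (show
      (O.res inf_le_left (sf i : O m (Uι i)) : O m (Uι i ⊓ Uι j)) =
        O.res inf_le_right (sf j : O m (Uι j)) from h)) ⟨v, hi.1, hi.2, hj.2⟩
    exact h2
  choose idx hidx using hcov
  let F : Cone (iSup Uι) → Lam m := fun v => (sf (idx v) : O m (Uι (idx v))).1 ⟨v.1, hidx v⟩
  have hF : ∀ i (v : Cone (Uι i)), F (v.incl (le_iSup Uι i)) = (sf i : O m (Uι i)).1 v :=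
    fun i v => hcompat _ _ _ _ _
  have hopen : ∀ i, IsOpen (coneSet (Uι i)) := by
    intro i
    have h1 : IsOpen {v : {v : Fin (n + 1) → ℂ // v ≠ 0} | point v.1 v.2 ∈ Uι i} := by
      have : Continuous (fun v : {v : Fin (n + 1) → ℂ // v ≠ 0} =>
          (point v.1 v.2 : projSpace n)) := continuous_coinduced_rng
      exact (Uι i).2.preimage this
    have h2 : IsOpen {v : Fin (n + 1) → ℂ | v ≠ 0} := isOpen_ne
    have := h2.isOpenMap_subtype_val _ h1
    convert this using 1
    ext v
    constructor
    · rintro ⟨h, hv⟩; exact ⟨⟨v, h⟩, hv, rfl⟩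
    · rintro ⟨⟨w, h⟩, hv, rfl⟩; exact ⟨h, hv⟩
  have hol : IsHol F := by
    intro I v hv
    let i := idx ⟨v, hv⟩
    have hvi : v ∈ coneSet (Uι i) := hidx ⟨v, hv⟩
    obtain ⟨g, hg, hgf⟩ := (isHol_iff_exists _).1 (sf i : O m (Uι i)).2.1 I
    have hat : DifferentiableAt ℂ g v := (hg v hvi).differentiableAt ((hopen i).mem_nhds hvi)
    refine DifferentiableAt.differentiableWithinAt (hat.congr_of_eventuallyEq ?_)
    filter_upwards [(hopen i).mem_nhds hvi] with w hw
    have := Subtype.val_injective.extend_apply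
      (fun v : Cone (iSup Uι) => (thetaBasis m).repr (F v) I) 0
      ⟨w, coneSet_mono (le_iSup Uι i) hw⟩
    refine this.trans ?_
    rw [← hgf ⟨w, hw⟩, ← hF i ⟨w, hw⟩]
    rfl
  have hom : IsHomog 0 F := by
    intro c hc v
    have h1 := (sf (idx v) : O m (Uι (idx v))).2.2 c hc ⟨v.1, hidx v⟩
    refine Eq.trans ?_ h1
    exact hcompat _ _ _ _ _
  refine ⟨(⟨F, hol, hom⟩ : O m (iSup Uι)), fun i => ?_, fun G hG => ?_⟩
  · exact Subtype.ext (funext fun v => hF i v)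
  · refine Subtype.ext (funext fun v => ?_)
    have := congrFun (congrArg Subtype.val (show
      (O.res (le_iSup Uι (idx v)) (G : O m (iSup Uι)) : O m (Uι (idx v))) = sf (idx v)
        from hG (idx v))) ⟨v.1, hidx v⟩
    exact this

variable (n m) in
/-- The structure sheaf of `ℙⁿ|ᵐ` as a sheaf of rings on `ℙⁿ`. -/
def sheafO : Sheaf (Opens.grothendieckTopology (projSpace n)) RingCat.{0} :=
  ⟨presheafO n m, presheafO_isSheaf n m⟩

end SuperProj

namespace SuperProj

/-! ### Presheaves of supermodules over `𝒪` -/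

/-- A presheaf of (left) `𝒪`-supermodules on `ℙⁿ|ᵐ`. The `ℤ/2`-grading is encoded by its parity
involution `par`: the even and odd sections are those with `par s = s` and `par s = -s`.
Since `2` is invertible, every section is uniquely the sum of an even and an odd one, and
`par_smul` says that `𝒪_p · M_q ⊆ M_{p+q}`. -/
structure SuperPresheaf (n m : ℕ) where
  obj : Opens (projSpace n) → Type
  [grp : ∀ U, AddCommGroup (obj U)]
  [modC : ∀ U, Module ℂ (obj U)]
  [modO : ∀ U, Module (O m U) (obj U)]
  [tower : ∀ U, IsScalarTower ℂ (O m U) (obj U)]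
  par : ∀ {U}, obj U →ₗ[ℂ] obj U
  par_par : ∀ {U} (s : obj U), par (par s) = s
  par_smul : ∀ {U} (a : O m U) (s : obj U), par (a • s) = O.par a • par s
  res : ∀ {V U}, V ≤ U → (obj U →ₗ[ℂ] obj V)
  res_self : ∀ {U} (s : obj U), res le_rfl s = s
  res_res : ∀ {W V U} (h : W ≤ V) (h' : V ≤ U) (s : obj U), res h (res h' s) = res (h.trans h') s
  res_smul : ∀ {V U} (h : V ≤ U) (a : O m U) (s : obj U), res h (a • s) = O.res h a • res h s
  res_par : ∀ {V U} (h : V ≤ U) (s : obj U), res h (par s) = par (res h s)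

attribute [instance] SuperPresheaf.grp SuperPresheaf.modC SuperPresheaf.modO SuperPresheaf.tower

namespace SuperPresheaf

variable {n m : ℕ} {U V : Opens (projSpace n)}

/-- Sections of parity `p` (`p` counts modulo two). -/
def IsHomogeneous (M : SuperPresheaf n m) (p : ℕ) (s : M.obj U) : Prop :=
  M.par s = (-1 : ℂ) ^ p • s

/-- Even morphisms of presheaves of supermodules: `𝒪`-linear, parity preserving. -/
structure Hom (M N : SuperPresheaf n m) where
  app : ∀ {U}, M.obj U →ₗ[O m U] N.obj U
  app_par : ∀ {U} (s : M.obj U), app (M.par s) = N.par (app s)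
  app_res : ∀ {V U} (h : V ≤ U) (s : M.obj U), app (M.res h s) = N.res h (app s)

theorem smul_commC (M : SuperPresheaf n m) (c : ℂ) (a : O m U) (s : M.obj U) :
    a • c • s = c • a • s := by
  have h : c • s = (algebraMap ℂ (O m U) c) • s := by
    rw [Algebra.algebraMap_eq_smul_one, smul_assoc, one_smul]
  rw [h, ← mul_smul, ← Algebra.commutes, mul_smul, Algebra.algebraMap_eq_smul_one, smul_assoc,
    one_smul]

theorem Hom.app_smulC {M N : SuperPresheaf n m} (f : M.Hom N) (c : ℂ) (s : M.obj U) :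
    f.app (c • s) = c • f.app s := by
  rw [← one_smul (O m U) s, ← smul_assoc, map_smul, map_smul, smul_assoc]

/-- The structure sheaf as a module over itself. -/
def unit (n m : ℕ) : SuperPresheaf n m where
  obj U := O m U
  par := O.par.toLinearMap
  par_par := O.par_par
  par_smul a b := map_mul O.par a b
  res h := (O.res h).toLinearMap
  res_self _ := rfl
  res_res _ _ _ := rfl
  res_smul h a b := map_mul (O.res h) a b
  res_par _ _ := rfl

/-- The sheaf `𝒪(d)`. -/
def twist (n m : ℕ) (d : ℤ) : SuperPresheaf n m where
  obj U := twistSec m d U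
  par :=
    { toFun := fun f => ⟨fun v => inv (f.1 v), f.2.1.linear inv.toLinearMap, fun c hc v => by
        simp [f.2.2 c hc v, scale_inv]⟩
      map_add' := fun _ _ => Subtype.ext (funext fun _ => map_add _ _ _)
      map_smul' := fun c f => Subtype.ext (funext fun v => map_smul inv c (f.1 v)) }
  par_par _ := Subtype.ext (funext fun _ => inv_inv _)
  par_smul _ _ := Subtype.ext (funext fun _ => map_mul _ _ _)
  res h :=
    { toFun := fun f => ⟨fun v => f.1 (v.incl h), f.2.1.res h,
        fun c hc v => f.2.2 c hc (v.incl h)⟩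
      map_add' := fun _ _ => rfl
      map_smul' := fun _ _ => rfl }
  res_self _ := rfl
  res_res _ _ _ := rfl
  res_smul _ _ _ := rfl
  res_par _ _ := rfl

/-- The parity change `Π M = M ⊗ Π𝒪`: the same left module with the opposite grading. -/
def parityChange (M : SuperPresheaf n m) : SuperPresheaf n m where
  obj := M.obj
  par := -M.par
  par_par s := by simp [M.par_par]
  par_smul a s := by simp [M.par_smul]
  res := M.res
  res_self := M.res_self
  res_res := M.res_res
  res_smul := M.res_smul
  res_par h s := by simp [M.res_par]

/-- The direct sum `M^{⊕ p|q} = M^{⊕ p} ⊕ (Π M)^{⊕ q}`. -/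
def copies (M : SuperPresheaf n m) (p q : ℕ) : SuperPresheaf n m where
  obj U := Fin p ⊕ Fin q → M.obj U
  par :=
    { toFun := fun s => Sum.elim (fun i => M.par (s (Sum.inl i))) (fun j => -M.par (s (Sum.inr j)))
      map_add' := fun s t => by
        funext i; rcases i with i | i <;> simp [add_comm]
      map_smul' := fun c s => by
        funext i; rcases i with i | i <;> simp }
  par_par s := by funext i; rcases i with i | i <;> simp [M.par_par]
  par_smul a s := by funext i; rcases i with i | i <;> simp [M.par_smul]
  res h := LinearMap.pi fun i => (M.res h).comp (LinearMap.proj i)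
  res_self s := by funext i; simp [M.res_self]
  res_res h h' s := by funext i; simp [M.res_res]
  res_smul h a s := by funext i; simp [M.res_smul]
  res_par h s := by funext i; rcases i with i | i <;> simp [M.res_par]

/-- The sub-presheaf of sections satisfying a condition that is stable under all operations. -/
def sub (M : SuperPresheaf n m) (p : ∀ {U}, M.obj U → Prop)
    (zero : ∀ {U}, p (0 : M.obj U))
    (add : ∀ {U} {s t : M.obj U}, p s → p t → p (s + t))
    (smul : ∀ {U} (a : O m U) {s : M.obj U}, p s → p (a • s))
    (par : ∀ {U} {s : M.obj U}, p s → p (M.par s))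
    (res : ∀ {V U} (h : V ≤ U) {s : M.obj U}, p s → p (M.res h s)) : SuperPresheaf n m where
  obj U := ({ carrier := {s | p s}, zero_mem' := zero, add_mem' := add,
              smul_mem' := fun a _ => smul a } : Submodule (O m U) (M.obj U))
  par :=
    { toFun := fun s => ⟨M.par s.1, par s.2⟩
      map_add' := fun _ _ => Subtype.ext (map_add _ _ _)
      map_smul' := fun _ _ => Subtype.ext (map_smul _ _ _) }
  par_par _ := Subtype.ext (M.par_par _)
  par_smul _ _ := Subtype.ext (M.par_smul _ _)
  res h :=
    { toFun := fun s => ⟨M.res h s.1, res h s.2⟩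
      map_add' := fun _ _ => Subtype.ext (map_add _ _ _)
      map_smul' := fun _ _ => Subtype.ext (map_smul _ _ _) }
  res_self _ := Subtype.ext (M.res_self _)
  res_res _ _ _ := Subtype.ext (M.res_res _ _ _)
  res_smul _ _ _ := Subtype.ext (M.res_smul _ _ _)
  res_par _ _ := Subtype.ext (M.res_par _ _)

/-- Sections over `U` of the sheaf of all `ℂ`-linear sheaf maps `M → N`: families of linear maps
`M(V) → N(V)`, `V ⊆ U`, that commute with restriction. -/
def FamHom (M N : SuperPresheaf n m) (U : Opens (projSpace n)) :
    Submodule ℂ (∀ V : Set.Iic U, M.obj V.1 →ₗ[ℂ] N.obj V.1) where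
  carrier := {D | ∀ (V W : Set.Iic U) (h : V.1 ≤ W.1) (s : M.obj W.1),
    D V (M.res h s) = N.res h (D W s)}
  zero_mem' _ _ _ _ := by simp
  add_mem' ha hb V W h s := by simp [ha V W h s, hb V W h s]
  smul_mem' c _ ha V W h s := by simp [ha V W h s]

instance (M N : SuperPresheaf n m) (U : Opens (projSpace n)) : Module (O m U) (FamHom M N U) where
  smul a D := ⟨fun V =>
    { toFun := fun s => O.res V.2 a • D.1 V s
      map_add' := fun s t => by rw [map_add, smul_add]
      map_smul' := fun c s => by
        rw [map_smul, RingHom.id_apply]; exact N.smul_commC _ _ _ },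
    fun V W h s => by
      change O.res V.2 a • D.1 V (M.res h s) = N.res h (O.res W.2 a • D.1 W s)
      rw [D.2 V W h s, N.res_smul]; rfl⟩
  one_smul D := Subtype.ext (funext fun V => LinearMap.ext fun s => by
    change O.res V.2 (1 : O m U) • D.1 V s = D.1 V s
    rw [map_one, one_smul])
  mul_smul a b D := Subtype.ext (funext fun V => LinearMap.ext fun s => by
    change O.res V.2 (a * b) • D.1 V s = O.res V.2 a • O.res V.2 b • D.1 V s
    rw [map_mul, mul_smul])
  smul_zero a := Subtype.ext (funext fun V => LinearMap.ext fun s => smul_zero (O.res V.2 a))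
  smul_add a D E := Subtype.ext (funext fun V => LinearMap.ext fun s =>
    smul_add (O.res V.2 a) (D.1 V s) (E.1 V s))
  add_smul a b D := Subtype.ext (funext fun V => LinearMap.ext fun s => by
    change O.res V.2 (a + b) • D.1 V s = O.res V.2 a • D.1 V s + O.res V.2 b • D.1 V s
    rw [map_add, add_smul])
  zero_smul D := Subtype.ext (funext fun V => LinearMap.ext fun s => by
    change O.res V.2 (0 : O m U) • D.1 V s = (0 : N.obj V.1)
    rw [map_zero, zero_smul])

theorem FamHom.smul_apply {M N : SuperPresheaf n m} (a : O m U) (D : FamHom M N U)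
    (V : Set.Iic U) (s : M.obj V.1) : (a • D).1 V s = O.res V.2 a • D.1 V s := rfl

instance (M N : SuperPresheaf n m) (U : Opens (projSpace n)) :
    IsScalarTower ℂ (O m U) (FamHom M N U) where
  smul_assoc c a D := Subtype.ext (funext fun V => LinearMap.ext fun s => by
    change O.res V.2 (c • a) • D.1 V s = c • O.res V.2 a • D.1 V s
    rw [map_smul, smul_assoc])

/-- The sheaf of all `ℂ`-linear maps `M → N` (the parity of `D` is that of a map between
super vector spaces: `D` is even or odd as it preserves or reverses parity, and the left
`𝒪`-module structure is `(a D)(s) = a D(s)`). -/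
def linHom (M N : SuperPresheaf n m) : SuperPresheaf n m where
  obj U := FamHom M N U
  par {U} :=
    { toFun := fun D => ⟨fun V => N.par.comp ((D.1 V).comp M.par), fun V W h s => by
        simp [M.res_par, N.res_par, ← D.2 V W h]⟩
      map_add' := fun D E => Subtype.ext (funext fun V => LinearMap.ext fun s =>
        map_add N.par (D.1 V (M.par s)) (E.1 V (M.par s)))
      map_smul' := fun c D => Subtype.ext (funext fun V => LinearMap.ext fun s =>
        map_smul N.par c (D.1 V (M.par s))) }
  par_par D := Subtype.ext (funext fun V => LinearMap.ext fun s => by simp [M.par_par, N.par_par])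
  par_smul a D := Subtype.ext (funext fun V => LinearMap.ext fun s => by
    change N.par (O.res V.2 a • D.1 V (M.par s)) = O.res V.2 (O.par a) • N.par (D.1 V (M.par s))
    rw [N.par_smul]; rfl)
  res {V U} h :=
    { toFun := fun D => ⟨fun W => D.1 ⟨W.1, W.2.trans h⟩, fun W W' h' s => D.2 ⟨W.1, W.2.trans h⟩ ⟨W'.1, W'.2.trans h⟩ h' s⟩
      map_add' := fun _ _ => rfl
      map_smul' := fun _ _ => rfl }
  res_self _ := rfl
  res_res _ _ _ := rfl
  res_smul _ _ _ := rfl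
  res_par _ _ := rfl

theorem neg_aux {R : Type} [Ring R] (a b x y : R) : -(x * b + -a * y) = -x * b + a * y := by
  noncomm_ring

/-- The component over `V` of a `ℂ`-linear endomorphism of `𝒪`. -/
def onO (D : FamHom (unit n m) (unit n m) U) (V : Set.Iic U) : O m V.1 →ₗ[ℂ] O m V.1 := D.1 V

/-- The graded Leibniz rule `D(ab) = D(a) b + (-1)^{|D||a|} a D(b)`, written for a sum `D` of an
even and an odd map with the help of the parity conjugate `b ↦ par (D (par b))` of `D`, which is
`(-1)^{|D|} D` for homogeneous `D`. -/
def IsSuperDerivation (D : FamHom (unit n m) (unit n m) U) : Prop :=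
  ∀ (V : Set.Iic U) (a b : O m V.1),
    (O.par a = a → onO D V (a * b) = onO D V a * b + a * onO D V b) ∧
    (O.par a = -a → onO D V (a * b) = onO D V a * b + a * O.par (onO D V (O.par b)))

/-- `𝒪`-linearity in the super sense, `ω(a s) = (-1)^{|ω||a|} a ω(s)` for homogeneous `ω` and `a`,
written for a sum `ω` of an even and an odd map with the help of its parity conjugate
`s ↦ par (ω (par s))`, which is `(-1)^{|ω|} ω` for homogeneous `ω`. -/
def IsSuperLinear {M N : SuperPresheaf n m} (ω : FamHom M N U) : Prop :=
  ∀ (V : Set.Iic U) (a : O m V.1) (s : M.obj V.1),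
    (O.par a = a → ω.1 V (a • s) = a • ω.1 V s) ∧
    (O.par a = -a → ω.1 V (a • s) = a • N.par (ω.1 V (M.par s)))

/-- The tangent sheaf `𝒯` of `ℙⁿ|ᵐ`: superderivations of the structure sheaf. -/
def tangent (n m : ℕ) : SuperPresheaf n m :=
  (linHom (unit n m) (unit n m)).sub
    (fun {U} (D : FamHom (unit n m) (unit n m) U) => IsSuperDerivation D)
    (fun {U} V a b => by
      constructor <;> intro _
      · change (0 : O m V.1) = 0 * b + a * 0
        simp
      · change (0 : O m V.1) = 0 * b + a * O.par 0
        simp)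
    (fun {U} {D E : FamHom (unit n m) (unit n m) U} hD hE V a b => by
      constructor <;> intro ha
      · change onO D V (a * b) + onO E V (a * b) =
          (onO D V a + onO E V a) * b + a * (onO D V b + onO E V b)
        rw [(hD V a b).1 ha, (hE V a b).1 ha, add_mul, mul_add]
        abel
      · change onO D V (a * b) + onO E V (a * b) =
          (onO D V a + onO E V a) * b + a * O.par (onO D V (O.par b) + onO E V (O.par b))
        rw [(hD V a b).2 ha, (hE V a b).2 ha, add_mul, map_add, mul_add]
        abel)
    (fun {U} c {D : FamHom (unit n m) (unit n m) U} hD V a b => by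
      constructor <;> intro ha
      · change O.res V.2 c * onO D V (a * b) =
          (O.res V.2 c * onO D V a) * b + a * (O.res V.2 c * onO D V b)
        rw [(hD V a b).1 ha, mul_add, mul_assoc, ← mul_assoc a, ← O.even_comm ha (O.res V.2 c), mul_assoc]
      · change O.res V.2 c * onO D V (a * b) =
          (O.res V.2 c * onO D V a) * b + a * O.par (O.res V.2 c * onO D V (O.par b))
        rw [(hD V a b).2 ha, mul_add, mul_assoc, map_mul, ← mul_assoc a,
          ← O.odd_comm ha (O.res V.2 c),
          mul_assoc])
    (fun {U} {D : FamHom (unit n m) (unit n m) U} hD V a b => by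
      constructor <;> intro ha
      · change O.par (onO D V (O.par (a * b))) =
          O.par (onO D V (O.par a)) * b + a * O.par (onO D V (O.par b))
        rw [map_mul, ha, (hD V a (O.par b)).1 ha, map_add, map_mul, map_mul, O.par_par, ha]
      · change O.par (onO D V (O.par (a * b))) =
          O.par (onO D V (O.par a)) * b + a * O.par (O.par (onO D V (O.par (O.par b))))
        rw [map_mul, ha, neg_mul a (O.par b), map_neg, map_neg, (hD V a (O.par b)).2 ha]
        simp only [map_add, map_mul, map_neg, O.par_par, ha]
        exact neg_aux _ _ _ _)
    (fun {V U} h {D : FamHom (unit n m) (unit n m) U} hD W a b => hD ⟨W.1, W.2.trans h⟩ a b)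

/-- The sheaf `ℋom_𝒪(M, N)` of `𝒪`-linear maps `M → N` of both parities. -/
def superHom (M N : SuperPresheaf n m) : SuperPresheaf n m :=
  (linHom M N).sub
    (fun {U} (ω : FamHom M N U) => IsSuperLinear ω)
    (fun {U} V a s => by
      constructor <;> intro _
      · change (0 : N.obj V.1) = a • (0 : N.obj V.1)
        simp
      · change (0 : N.obj V.1) = a • N.par (0 : N.obj V.1)
        simp)
    (fun {U} {D E : FamHom M N U} hD hE V a s => by
      constructor <;> intro ha
      · change D.1 V (a • s) + E.1 V (a • s) = a • (D.1 V s + E.1 V s)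
        rw [(hD V a s).1 ha, (hE V a s).1 ha, smul_add]
      · change D.1 V (a • s) + E.1 V (a • s) = a • N.par (D.1 V (M.par s) + E.1 V (M.par s))
        rw [(hD V a s).2 ha, (hE V a s).2 ha, map_add, smul_add])
    (fun {U} c {D : FamHom M N U} hD V a s => by
      constructor <;> intro ha
      · change O.res V.2 c • D.1 V (a • s) = a • O.res V.2 c • D.1 V s
        rw [(hD V a s).1 ha, ← mul_smul, ← mul_smul, O.even_comm ha]
      · change O.res V.2 c • D.1 V (a • s) = a • N.par (O.res V.2 c • D.1 V (M.par s))
        rw [(hD V a s).2 ha, N.par_smul, ← mul_smul, ← mul_smul, O.odd_comm ha])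
    (fun {U} {D : FamHom M N U} hD V a s => by
      constructor <;> intro ha
      · change N.par (D.1 V (M.par (a • s))) = a • N.par (D.1 V (M.par s))
        rw [M.par_smul, ha, (hD V a _).1 ha, N.par_smul, ha]
      · change N.par (D.1 V (M.par (a • s))) = a • N.par (N.par (D.1 V (M.par (M.par s))))
        rw [M.par_smul, ha, neg_smul, map_neg, (hD V a _).2 ha, map_neg, N.par_smul, ha, neg_smul,
          neg_neg])
    (fun {V U} h {D : FamHom M N U} hD W a s => hD ⟨W.1, W.2.trans h⟩ a s)

/-- The cotangent sheaf `𝒯* = ℋom_𝒪(𝒯, 𝒪)`. -/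
def cotangent (n m : ℕ) : SuperPresheaf n m := superHom (tangent n m) (unit n m)

/-- The sheaf of one-forms `Π𝒯*`. -/
def piCotangent (n m : ℕ) : SuperPresheaf n m := (cotangent n m).parityChange

end SuperPresheaf
end SuperProj

namespace SuperProj

/-! ### Supersymmetric powers and tensor products of supermodules -/

section algebra

variable {A M : Type} [Ring A] [Algebra ℂ A] [AddCommGroup M] [Module ℂ M] [Module A M]
variable {B N : Type} [Ring B] [Algebra ℂ B] [AddCommGroup N] [Module ℂ N] [Module B N]

/-- The relations of the supersymmetric algebra of a left supermodule `M` over a supercommutative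
algebra `A` (with parity involutions `P` and `σ`): the products and the scalar action of `A` are
kept, and homogeneous elements of `A` and `M` commute up to the sign `(-1)^{pq}`. -/
inductive SymRel (σ : A →ₐ[ℂ] A) (P : M →ₗ[ℂ] M) :
    TensorAlgebra ℂ (A × M) → TensorAlgebra ℂ (A × M) → Prop
  | one : SymRel σ P (TensorAlgebra.ι ℂ (1, 0)) 1
  | mul (a b : A) : SymRel σ P (TensorAlgebra.ι ℂ (a * b, 0))
      (TensorAlgebra.ι ℂ (a, 0) * TensorAlgebra.ι ℂ (b, 0))
  | smul (a : A) (s : M) : SymRel σ P (TensorAlgebra.ι ℂ (0, a • s))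
      (TensorAlgebra.ι ℂ (a, 0) * TensorAlgebra.ι ℂ (0, s))
  | comm_scalar (p q : ℕ) (a : A) (s : M) (ha : σ a = (-1 : ℂ) ^ p • a)
      (hs : P s = (-1 : ℂ) ^ q • s) :
      SymRel σ P (TensorAlgebra.ι ℂ (0, s) * TensorAlgebra.ι ℂ (a, 0))
        ((-1 : ℂ) ^ (p * q) • (TensorAlgebra.ι ℂ (a, 0) * TensorAlgebra.ι ℂ (0, s)))
  | comm (p q : ℕ) (s t : M) (hs : P s = (-1 : ℂ) ^ p • s) (ht : P t = (-1 : ℂ) ^ q • t) :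
      SymRel σ P (TensorAlgebra.ι ℂ (0, s) * TensorAlgebra.ι ℂ (0, t))
        ((-1 : ℂ) ^ (p * q) • (TensorAlgebra.ι ℂ (0, t) * TensorAlgebra.ι ℂ (0, s)))

/-- The supersymmetric algebra `Sym_A(M)`. -/
def SymAlg (σ : A →ₐ[ℂ] A) (P : M →ₗ[ℂ] M) : Type := RingQuot (SymRel σ P)

namespace SymAlg

variable (σ : A →ₐ[ℂ] A) (P : M →ₗ[ℂ] M) (τ : B →ₐ[ℂ] B) (Q : N →ₗ[ℂ] N)

instance : Ring (SymAlg σ P) := inferInstanceAs (Ring (RingQuot (SymRel σ P)))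
instance : Algebra ℂ (SymAlg σ P) := inferInstanceAs (Algebra ℂ (RingQuot (SymRel σ P)))

/-- The quotient map. -/
def mk : TensorAlgebra ℂ (A × M) →ₐ[ℂ] SymAlg σ P := RingQuot.mkAlgHom ℂ (SymRel σ P)

variable {σ P} in
theorem mk_rel {x y : TensorAlgebra ℂ (A × M)} (h : SymRel σ P x y) : mk σ P x = mk σ P y :=
  RingQuot.mkAlgHom_rel ℂ h

/-- The inclusion of the scalars `A = Sym⁰`. -/
def coeff : A →ₐ[ℂ] SymAlg σ P :=
  AlgHom.ofLinearMap
    ((mk σ P).toLinearMap.comp ((TensorAlgebra.ι ℂ).comp (LinearMap.inl ℂ A M)))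
    (by
      change mk σ P (TensorAlgebra.ι ℂ (1, 0)) = 1
      rw [mk_rel SymRel.one, map_one])
    (fun a b => by
      change mk σ P (TensorAlgebra.ι ℂ (a * b, 0)) =
        mk σ P (TensorAlgebra.ι ℂ (a, 0)) * mk σ P (TensorAlgebra.ι ℂ (b, 0))
      rw [mk_rel (SymRel.mul a b), map_mul])

/-- The inclusion of the generators `M`. -/
def gen : M →ₗ[ℂ] SymAlg σ P :=
  (mk σ P).toLinearMap.comp ((TensorAlgebra.ι ℂ).comp (LinearMap.inr ℂ A M))

/-- The left `A`-module structure. -/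
instance : Module A (SymAlg σ P) := Module.compHom _ (coeff σ P).toRingHom

theorem smul_def (a : A) (x : SymAlg σ P) : a • x = coeff σ P a * x := rfl

instance : IsScalarTower ℂ A (SymAlg σ P) where
  smul_assoc c a x := by rw [smul_def, smul_def, map_smul, smul_mul_assoc]

theorem gen_smul (a : A) (s : M) : gen σ P (a • s) = a • gen σ P s := by
  change mk σ P (TensorAlgebra.ι ℂ (0, a • s)) =
    mk σ P (TensorAlgebra.ι ℂ (a, 0)) * mk σ P (TensorAlgebra.ι ℂ (0, s))
  rw [mk_rel (SymRel.smul a s), map_mul]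

theorem gen_coeff {p q : ℕ} {a : A} {s : M} (ha : σ a = (-1 : ℂ) ^ p • a)
    (hs : P s = (-1 : ℂ) ^ q • s) :
    gen σ P s * coeff σ P a = (-1 : ℂ) ^ (p * q) • (coeff σ P a * gen σ P s) := by
  have := mk_rel (SymRel.comm_scalar p q a s ha hs)
  rw [map_smul, map_mul, map_mul] at this
  exact this

theorem gen_gen {p q : ℕ} {s t : M} (hs : P s = (-1 : ℂ) ^ p • s)
    (ht : P t = (-1 : ℂ) ^ q • t) :
    gen σ P s * gen σ P t = (-1 : ℂ) ^ (p * q) • (gen σ P t * gen σ P s) := by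
  have := mk_rel (SymRel.comm (σ := σ) p q s t hs ht)
  rw [map_smul, map_mul, map_mul] at this
  exact this

variable {σ P τ Q} in
/-- Functoriality along a parity preserving map `f`, semilinear over `φ`. -/
def map (φ : A →ₐ[ℂ] B) (f : M →ₗ[ℂ] N) (hφ : ∀ a, φ (σ a) = τ (φ a))
    (hf : ∀ s, f (P s) = Q (f s)) (hs : ∀ (a : A) (s : M), f (a • s) = φ a • f s) :
    SymAlg σ P →ₐ[ℂ] SymAlg τ Q :=
  RingQuot.liftAlgHom ℂ ⟨TensorAlgebra.lift ℂ
    (((coeff τ Q).toLinearMap.comp φ.toLinearMap).coprod ((gen τ Q).comp f)), by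
      have hA : ∀ a : A, TensorAlgebra.lift ℂ
          (((coeff τ Q).toLinearMap.comp φ.toLinearMap).coprod ((gen τ Q).comp f))
          (TensorAlgebra.ι ℂ (a, 0)) = coeff τ Q (φ a) := fun a => by simp
      have hM : ∀ s : M, TensorAlgebra.lift ℂ
          (((coeff τ Q).toLinearMap.comp φ.toLinearMap).coprod ((gen τ Q).comp f))
          (TensorAlgebra.ι ℂ (0, s)) = gen τ Q (f s) := fun s => by simp
      intro x y h
      induction h with
      | one => rw [hA, map_one, map_one, map_one]
      | mul a b => rw [map_mul, hA, hA, hA, map_mul, map_mul]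
      | smul a s => rw [map_mul, hA, hM, hM, hs, gen_smul, smul_def]
      | comm_scalar p q a s ha hs =>
        rw [map_smul, map_mul, map_mul, hA, hM]
        exact gen_coeff τ Q (by rw [← hφ, ha, map_smul]) (by rw [← hf, hs, map_smul])
      | comm p q s t hs ht =>
        rw [map_smul, map_mul, map_mul, hM, hM]
        exact gen_gen τ Q (by rw [← hf, hs, map_smul]) (by rw [← hf, ht, map_smul])⟩

section map
variable {σ P τ Q}
variable (φ : A →ₐ[ℂ] B) (f : M →ₗ[ℂ] N) (hφ : ∀ a, φ (σ a) = τ (φ a))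
    (hf : ∀ s, f (P s) = Q (f s)) (hs : ∀ (a : A) (s : M), f (a • s) = φ a • f s)

theorem map_mk (x : TensorAlgebra ℂ (A × M)) : map φ f hφ hf hs (mk σ P x) =
    TensorAlgebra.lift ℂ
    (((coeff τ Q).toLinearMap.comp φ.toLinearMap).coprod ((gen τ Q).comp f)) x :=
  RingQuot.liftAlgHom_mkAlgHom_apply _ _ _ _

theorem map_coeff (a : A) : map φ f hφ hf hs (coeff σ P a) = coeff τ Q (φ a) :=
  (map_mk φ f hφ hf hs (TensorAlgebra.ι ℂ (a, 0))).trans (by simp)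

theorem map_gen (s : M) : map φ f hφ hf hs (gen σ P s) = gen τ Q (f s) :=
  (map_mk φ f hφ hf hs (TensorAlgebra.ι ℂ (0, s))).trans (by simp)

theorem map_asmul (a : A) (x : SymAlg σ P) :
    map φ f hφ hf hs (a • x) = φ a • map φ f hφ hf hs x := by
  rw [smul_def, smul_def, map_mul, map_coeff]

end map

/-- Algebra maps out of `Sym_A(M)` agree if they agree on `A` and `M`. -/
theorem hom_ext {S : Type} [Semiring S] [Algebra ℂ S] {f g : SymAlg σ P →ₐ[ℂ] S}
    (h0 : ∀ a, f (coeff σ P a) = g (coeff σ P a)) (h1 : ∀ s, f (gen σ P s) = g (gen σ P s)) :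
    f = g := by
  refine RingQuot.ringQuot_ext' ℂ _ _ (TensorAlgebra.hom_ext (LinearMap.ext fun x => ?_))
  obtain ⟨a, s⟩ := x
  have : ((a, s) : A × M) = (a, 0) + (0, s) := by simp
  rw [this, map_add, map_add]
  exact congrArg₂ (· + ·) (h0 a) (h1 s)

/-- The monomial `v₁ ⊙ ⋯ ⊙ v_k`. -/
def mon {k : ℕ} (v : Fin k → M) : SymAlg σ P := (List.ofFn fun j => gen σ P (v j)).prod

theorem map_mon {σ : A →ₐ[ℂ] A} {P : M →ₗ[ℂ] M} {τ : B →ₐ[ℂ] B} {Q : N →ₗ[ℂ] N}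
    (φ : A →ₐ[ℂ] B) (f : M →ₗ[ℂ] N) (hφ : ∀ a, φ (σ a) = τ (φ a))
    (hf : ∀ s, f (P s) = Q (f s)) (hs : ∀ (a : A) (s : M), f (a • s) = φ a • f s)
    {k : ℕ} (v : Fin k → M) :
    map φ f hφ hf hs (mon σ P v) = mon τ Q (fun j => f (v j)) := by
  unfold mon
  rw [map_list_prod, List.map_ofFn]
  congr 2
  funext j
  exact map_gen φ f hφ hf hs (v j)

/-- The `k`-th supersymmetric power `Sym^k_A(M)`: the `A`-span of the monomials of length `k`. -/
def pow (k : ℕ) : Submodule A (SymAlg σ P) :=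
  Submodule.span A (Set.range fun v : Fin k → M => mon σ P v)

theorem map_mem {σ : A →ₐ[ℂ] A} {P : M →ₗ[ℂ] M} {τ : B →ₐ[ℂ] B} {Q : N →ₗ[ℂ] N}
    (φ : A →ₐ[ℂ] B) (f : M →ₗ[ℂ] N) (hφ : ∀ a, φ (σ a) = τ (φ a))
    (hf : ∀ s, f (P s) = Q (f s)) (hs : ∀ (a : A) (s : M), f (a • s) = φ a • f s)
    {k : ℕ} {x : SymAlg σ P} (hx : x ∈ pow σ P k) : map φ f hφ hf hs x ∈ pow τ Q k := by
  induction hx using Submodule.span_induction with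
  | mem x h =>
    obtain ⟨v, rfl⟩ := h
    simp only [map_mon]
    exact Submodule.subset_span ⟨_, rfl⟩
  | zero => rw [map_zero]; exact zero_mem _
  | add x y _ _ hx hy => rw [map_add]; exact add_mem hx hy
  | smul a x _ hx => rw [map_asmul]; exact Submodule.smul_mem _ _ hx

end SymAlg

/-- The `k`-th supersymmetric power `Sym^k_A(M)`, as a type. -/
def SymPow (σ : A →ₐ[ℂ] A) (P : M →ₗ[ℂ] M) (k : ℕ) : Type := SymAlg.pow σ P k

namespace SymPow

variable (σ : A →ₐ[ℂ] A) (P : M →ₗ[ℂ] M) (k : ℕ)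

instance : AddCommGroup (SymPow σ P k) := inferInstanceAs (AddCommGroup (SymAlg.pow σ P k))
instance : Module A (SymPow σ P k) := inferInstanceAs (Module A (SymAlg.pow σ P k))
instance : Module ℂ (SymPow σ P k) := inferInstanceAs (Module ℂ (SymAlg.pow σ P k))
instance : IsScalarTower ℂ A (SymPow σ P k) :=
  inferInstanceAs (IsScalarTower ℂ A (SymAlg.pow σ P k))

/-- The monomial `v₁ ⊙ ⋯ ⊙ v_k` in `Sym^k_A(M)`. -/
def mon {k : ℕ} (v : Fin k → M) : SymPow σ P k :=
  ⟨SymAlg.mon σ P v, Submodule.subset_span ⟨v, rfl⟩⟩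

variable {σ P}
variable {τ : B →ₐ[ℂ] B} {Q : N →ₗ[ℂ] N}

/-- Functoriality along a parity preserving map `f`, semilinear over `φ`. -/
def map (k : ℕ) (φ : A →ₐ[ℂ] B) (f : M →ₗ[ℂ] N) (hφ : ∀ a, φ (σ a) = τ (φ a))
    (hf : ∀ s, f (P s) = Q (f s)) (hs : ∀ (a : A) (s : M), f (a • s) = φ a • f s) :
    SymPow σ P k →ₗ[ℂ] SymPow τ Q k where
  toFun x := ⟨SymAlg.map φ f hφ hf hs x.1, SymAlg.map_mem φ f hφ hf hs x.2⟩
  map_add' x y := Subtype.ext (map_add (SymAlg.map φ f hφ hf hs) x.1 y.1)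
  map_smul' c x := Subtype.ext (map_smul (SymAlg.map φ f hφ hf hs) c x.1)

section
variable {k}
variable (φ : A →ₐ[ℂ] B) (f : M →ₗ[ℂ] N) (hφ : ∀ a, φ (σ a) = τ (φ a))
    (hf : ∀ s, f (P s) = Q (f s)) (hs : ∀ (a : A) (s : M), f (a • s) = φ a • f s)

theorem map_asmul (a : A) (x : SymPow σ P k) :
    map k φ f hφ hf hs (a • x) = φ a • map k φ f hφ hf hs x :=
  Subtype.ext (SymAlg.map_asmul φ f hφ hf hs a x.1)

theorem map_mon (v : Fin k → M) :
    map k φ f hφ hf hs (mon σ P v) = mon τ Q (fun j => f (v j)) :=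
  Subtype.ext (SymAlg.map_mon φ f hφ hf hs v)

theorem map_eq_self (φ : A →ₐ[ℂ] A) (f : M →ₗ[ℂ] M) (hφ : ∀ a, φ (σ a) = σ (φ a))
    (hf : ∀ s, f (P s) = P (f s)) (hs : ∀ (a : A) (s : M), f (a • s) = φ a • f s)
    (h1 : ∀ a, φ a = a) (h2 : ∀ s, f s = s) (x : SymPow σ P k) :
    map k φ f hφ hf hs x = x := by
  have : SymAlg.map φ f hφ hf hs = AlgHom.id ℂ _ := SymAlg.hom_ext _ _
    (fun a => by rw [SymAlg.map_coeff, h1]; rfl) (fun s => by rw [SymAlg.map_gen, h2]; rfl)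
  exact Subtype.ext (DFunLike.congr_fun this x.1)

theorem map_map_eq {C L : Type} [Ring C] [Algebra ℂ C] [AddCommGroup L] [Module ℂ L] [Module C L]
    {υ : C →ₐ[ℂ] C} {R : L →ₗ[ℂ] L}
    (φ' : B →ₐ[ℂ] C) (f' : N →ₗ[ℂ] L) (hφ' : ∀ a, φ' (τ a) = υ (φ' a))
    (hf' : ∀ s, f' (Q s) = R (f' s)) (hs' : ∀ (a : B) (s : N), f' (a • s) = φ' a • f' s)
    (φ'' : A →ₐ[ℂ] C) (f'' : M →ₗ[ℂ] L) (hφ'' : ∀ a, φ'' (σ a) = υ (φ'' a))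
    (hf'' : ∀ s, f'' (P s) = R (f'' s)) (hs'' : ∀ (a : A) (s : M), f'' (a • s) = φ'' a • f'' s)
    (h1 : ∀ a, φ' (φ a) = φ'' a) (h2 : ∀ s, f' (f s) = f'' s) (x : SymPow σ P k) :
    map k φ' f' hφ' hf' hs' (map k φ f hφ hf hs x) = map k φ'' f'' hφ'' hf'' hs'' x := by
  have : (SymAlg.map φ' f' hφ' hf' hs').comp (SymAlg.map φ f hφ hf hs) =
      SymAlg.map φ'' f'' hφ'' hf'' hs'' := SymAlg.hom_ext _ _
    (fun a => by rw [AlgHom.comp_apply, SymAlg.map_coeff, SymAlg.map_coeff, SymAlg.map_coeff, h1])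
    (fun s => by rw [AlgHom.comp_apply, SymAlg.map_gen, SymAlg.map_gen, SymAlg.map_gen, h2])
  exact Subtype.ext (DFunLike.congr_fun this x.1)

end

end SymPow

variable {M' N' : Type} [AddCommGroup M'] [Module ℂ M'] [Module A M']
  [AddCommGroup N'] [Module ℂ N'] [Module B N']
  [IsScalarTower ℂ A M] [IsScalarTower ℂ B N]

variable (M') in
/-- The relations `(s a) ⊗ t = s ⊗ (a t)` of the tensor product over `A`, where `M` carries the
right action `s a = (-1)^{|s||a|} a s`. -/
def tensorRel (σ : A →ₐ[ℂ] A) (P : M →ₗ[ℂ] M) : Submodule A (M ⊗[ℂ] M') :=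
  Submodule.span A {x | ∃ (p q : ℕ) (a : A) (s : M) (t : M'), σ a = (-1 : ℂ) ^ p • a ∧
    P s = (-1 : ℂ) ^ q • s ∧ x = ((-1 : ℂ) ^ (p * q) • a • s) ⊗ₜ[ℂ] t - s ⊗ₜ[ℂ] (a • t)}

variable (M') in
/-- The tensor product `M ⊗_A M'` of supermodules. -/
def SuperTensor (σ : A →ₐ[ℂ] A) (P : M →ₗ[ℂ] M) : Type := (M ⊗[ℂ] M') ⧸ tensorRel M' σ P

section
variable (σ : A →ₐ[ℂ] A) (P : M →ₗ[ℂ] M)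
instance : AddCommGroup (SuperTensor M' σ P) :=
  inferInstanceAs (AddCommGroup ((M ⊗[ℂ] M') ⧸ tensorRel M' σ P))
instance : Module A (SuperTensor M' σ P) :=
  inferInstanceAs (Module A ((M ⊗[ℂ] M') ⧸ tensorRel M' σ P))
instance : Module ℂ (SuperTensor M' σ P) :=
  inferInstanceAs (Module ℂ ((M ⊗[ℂ] M') ⧸ tensorRel M' σ P))
instance : IsScalarTower ℂ A (SuperTensor M' σ P) :=
  inferInstanceAs (IsScalarTower ℂ A ((M ⊗[ℂ] M') ⧸ tensorRel M' σ P))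

/-- The quotient map. -/
def SuperTensor.mk (x : M ⊗[ℂ] M') : SuperTensor M' σ P := (tensorRel M' σ P).mkQ x

variable {σ P} in
theorem SuperTensor.mk_surjective (x : SuperTensor M' σ P) :
    ∃ y : M ⊗[ℂ] M', SuperTensor.mk σ P y = x := Submodule.mkQ_surjective _ x

end

section
variable {σ : A →ₐ[ℂ] A} {P : M →ₗ[ℂ] M} {τ : B →ₐ[ℂ] B} {Q : N →ₗ[ℂ] N}
variable (φ : A →ₐ[ℂ] B) (f : M →ₗ[ℂ] N) (g : M' →ₗ[ℂ] N')
    (hs : ∀ (a : A) (s : M), f (a • s) = φ a • f s)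

/-- The tensor product of two `φ`-semilinear maps, before passing to the quotient. -/
def preTensorMap : (M ⊗[ℂ] M') →ₛₗ[(φ : A →+* B)] (N ⊗[ℂ] N') where
  toFun := TensorProduct.map f g
  map_add' := map_add _
  map_smul' a x := by
    induction x using TensorProduct.induction_on with
    | zero => simp
    | tmul s t =>
      rw [TensorProduct.smul_tmul', TensorProduct.map_tmul, TensorProduct.map_tmul,
        TensorProduct.smul_tmul', hs]
      rfl
    | add x y hx hy => rw [smul_add, map_add, hx, hy, map_add, smul_add]

theorem tensorRel_le (hφ : ∀ a, φ (σ a) = τ (φ a)) (hf : ∀ s, f (P s) = Q (f s))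
    (hs' : ∀ (a : A) (s : M'), g (a • s) = φ a • g s) :
    tensorRel M' σ P ≤ (tensorRel N' τ Q).comap (preTensorMap φ f g hs) := by
  rw [tensorRel, Submodule.span_le]
  rintro _ ⟨p, q, a, s, t, ha, hsp, rfl⟩
  refine Submodule.subset_span ⟨p, q, φ a, f s, g t, ?_, ?_, ?_⟩
  · rw [← hφ, ha, map_smul]
  · rw [← hf, hsp, map_smul]
  · change TensorProduct.map f g _ = _
    rw [map_sub, TensorProduct.map_tmul, TensorProduct.map_tmul, map_smul, hs, hs']

variable (hφ : ∀ a, φ (σ a) = τ (φ a)) (hf : ∀ s, f (P s) = Q (f s))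
    (hs' : ∀ (a : A) (s : M'), g (a • s) = φ a • g s)

/-- The tensor product of two parity preserving `φ`-semilinear maps. -/
def tensorMap : SuperTensor M' σ P →ₗ[ℂ] SuperTensor N' τ Q where
  toFun := Submodule.mapQ (tensorRel M' σ P) (tensorRel N' τ Q) (preTensorMap φ f g hs)
    (tensorRel_le φ f g hs hφ hf hs')
  map_add' := map_add _
  map_smul' c x := by
    obtain ⟨x, rfl⟩ := SuperTensor.mk_surjective x
    change SuperTensor.mk τ Q (TensorProduct.map f g (c • x)) =
      c • SuperTensor.mk τ Q (TensorProduct.map f g x)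
    rw [map_smul]; rfl

theorem tensorMap_mk (x : M ⊗[ℂ] M') : tensorMap φ f g hs hφ hf hs' (SuperTensor.mk σ P x) =
    SuperTensor.mk τ Q (TensorProduct.map f g x) := rfl

theorem tensorMap_smul (a : A) (x : SuperTensor M' σ P) :
    tensorMap φ f g hs hφ hf hs' (a • x) = φ a • tensorMap φ f g hs hφ hf hs' x :=
  LinearMap.map_smulₛₗ (Submodule.mapQ (tensorRel M' σ P) (tensorRel N' τ Q)
    (preTensorMap φ f g hs) (tensorRel_le φ f g hs hφ hf hs')) a x

end

end algebra

end SuperProj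

namespace SuperProj

namespace SuperPresheaf

variable {n m : ℕ} {U V : Opens (projSpace n)}

/-- `Sym^k_{𝒪(U)}(M(U))`. -/
abbrev SymSec (M : SuperPresheaf n m) (k : ℕ) (U : Opens (projSpace n)) : Type :=
  SymPow (A := O m U) (M := M.obj U) O.par M.par k

/-- The parity involution of `Sym^k_{𝒪(U)}(M(U))`. -/
def symPar (M : SuperPresheaf n m) (k : ℕ) (U : Opens (projSpace n)) :
    M.SymSec k U →ₗ[ℂ] M.SymSec k U :=
  SymPow.map (A := O m U) (M := M.obj U) (B := O m U) (N := M.obj U) (σ := O.par) (P := M.par)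
    (τ := O.par) (Q := M.par) k O.par M.par (fun _ => rfl) (fun _ => rfl) M.par_smul

/-- Restriction from `Sym^k_{𝒪(U)}(M(U))` to `Sym^k_{𝒪(V)}(M(V))`. -/
def symRes (M : SuperPresheaf n m) (k : ℕ) (h : V ≤ U) : M.SymSec k U →ₗ[ℂ] M.SymSec k V :=
  SymPow.map (A := O m U) (M := M.obj U) (B := O m V) (N := M.obj V) (σ := O.par) (P := M.par)
    (τ := O.par) (Q := M.par) k (O.res h) (M.res h) (O.res_par h) (M.res_par h) (M.res_smul h)

theorem symPar_symPar (M : SuperPresheaf n m) (k : ℕ) (x : M.SymSec k U) :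
    M.symPar k U (M.symPar k U x) = x := by
  let σ : O m U →ₐ[ℂ] O m U := O.par
  let P : M.obj U →ₗ[ℂ] M.obj U := M.par
  have h1 : ∀ a, σ (σ a) = σ (σ a) := fun _ => rfl
  have h2 : ∀ s, P (P s) = P (P s) := fun _ => rfl
  have e1 := SymPow.map_map_eq (k := k) (σ := σ) (P := P) (τ := σ) (Q := P) (υ := σ) (R := P)
    σ P h1 h2 M.par_smul σ P h1 h2 M.par_smul
    (AlgHom.id ℂ (O m U)) LinearMap.id (fun _ => rfl) (fun _ => rfl)
    (fun _ _ => rfl) O.par_par M.par_par x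
  have e2 := SymPow.map_eq_self (σ := σ) (P := P) (k := k)
    (AlgHom.id ℂ (O m U)) LinearMap.id (fun _ => rfl) (fun _ => rfl)
    (fun _ _ => rfl) (fun _ => rfl) (fun _ => rfl) x
  exact e1.trans e2

theorem symRes_symPar (M : SuperPresheaf n m) (k : ℕ) (h : V ≤ U) (x : M.SymSec k U) :
    M.symRes k h (M.symPar k U x) = M.symPar k V (M.symRes k h x) := by
  let σ : O m U →ₐ[ℂ] O m U := O.par
  let P : M.obj U →ₗ[ℂ] M.obj U := M.par
  let τ : O m V →ₐ[ℂ] O m V := O.par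
  let Q : M.obj V →ₗ[ℂ] M.obj V := M.par
  have h1 : ∀ a, σ (σ a) = σ (σ a) := fun _ => rfl
  have h2 : ∀ s, P (P s) = P (P s) := fun _ => rfl
  have h3 : ∀ a, τ (τ a) = τ (τ a) := fun _ => rfl
  have h4 : ∀ s, Q (Q s) = Q (Q s) := fun _ => rfl
  have h5 : ∀ (a : O m U) (s : M.obj U),
      ((M.res h).comp P) (a • s) = ((O.res h).comp σ) a • ((M.res h).comp P) s :=
    fun a s => (congrArg (M.res h) (M.par_smul a s)).trans (M.res_smul h _ _)
  have e1 := SymPow.map_map_eq (k := k) (σ := σ) (P := P) (τ := σ) (Q := P) (υ := τ) (R := Q)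
    σ P h1 h2 M.par_smul (O.res h) (M.res h) (O.res_par h) (M.res_par h) (M.res_smul h)
    ((O.res h).comp σ) ((M.res h).comp P) (fun a => O.res_par h (σ a))
    (fun s => M.res_par h (P s)) h5 (fun _ => rfl) (fun _ => rfl) x
  have e2 := SymPow.map_map_eq (k := k) (σ := σ) (P := P) (τ := τ) (Q := Q) (υ := τ) (R := Q)
    (O.res h) (M.res h) (O.res_par h) (M.res_par h) (M.res_smul h) τ Q h3 h4 M.par_smul
    ((O.res h).comp σ) ((M.res h).comp P) (fun a => O.res_par h (σ a))
    (fun s => M.res_par h (P s)) h5 (fun _ => rfl) (fun s => (M.res_par h s).symm) x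
  exact e1.trans e2.symm

/-- The presheaf `U ↦ Sym^k_{𝒪(U)}(M(U))`. -/
def symPow (M : SuperPresheaf n m) (k : ℕ) : SuperPresheaf n m where
  obj U := M.SymSec k U
  par {U} := M.symPar k U
  par_par x := M.symPar_symPar k x
  par_smul {U} a x := SymPow.map_asmul (A := O m U) (M := M.obj U) (σ := O.par) (P := M.par)
    (τ := O.par) (Q := M.par) O.par M.par (fun _ => rfl) (fun _ => rfl) M.par_smul a x
  res h := M.symRes k h
  res_self {U} x := SymPow.map_eq_self (A := O m U) (M := M.obj U) (σ := O.par) (P := M.par)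
    (O.res le_rfl) (M.res le_rfl) (O.res_par _) (M.res_par _) (M.res_smul _)
    (fun _ => rfl) M.res_self x
  res_res {W V U} h h' x := SymPow.map_map_eq (A := O m U) (M := M.obj U) (B := O m V)
    (N := M.obj V) (C := O m W) (L := M.obj W) (σ := O.par) (P := M.par)
    (τ := O.par) (Q := M.par) (υ := O.par) (R := M.par)
    (O.res h') (M.res h') (O.res_par h') (M.res_par h') (M.res_smul h')
    (O.res h) (M.res h) (O.res_par h) (M.res_par h) (M.res_smul h)
    (O.res (h.trans h')) (M.res (h.trans h')) (O.res_par _) (M.res_par _) (M.res_smul _)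
    (fun _ => rfl) (M.res_res h h') x
  res_smul {V U} h a x := SymPow.map_asmul (A := O m U) (M := M.obj U) (σ := O.par) (P := M.par)
    (τ := O.par) (Q := M.par) (O.res h) (M.res h) (O.res_par h) (M.res_par h) (M.res_smul h) a x
  res_par h x := M.symRes_symPar k h x

/-- The section `s₁ ⊙ ⋯ ⊙ s_k` of `Sym^k M`. -/
def mon (M : SuperPresheaf n m) {k : ℕ} (s : Fin k → M.obj U) : (M.symPow k).obj U :=
  SymPow.mon (A := O m U) (M := M.obj U) O.par M.par s

/-- An even morphism as a `ℂ`-linear map. -/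
def Hom.appC {M N : SuperPresheaf n m} (f : M.Hom N) (U : Opens (projSpace n)) :
    M.obj U →ₗ[ℂ] N.obj U :=
  { toFun := f.app, map_add' := map_add _, map_smul' := f.app_smulC }

/-- The map `Sym^k f` on sections. -/
def Hom.symMap {M N : SuperPresheaf n m} (f : M.Hom N) (k : ℕ) (U : Opens (projSpace n)) :
    M.SymSec k U →ₗ[ℂ] N.SymSec k U :=
  SymPow.map (A := O m U) (M := M.obj U) (B := O m U) (N := N.obj U) (σ := O.par) (P := M.par)
    (τ := O.par) (Q := N.par) k (AlgHom.id ℂ (O m U)) (f.appC U) (fun _ => rfl) f.app_par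
    (fun a s => map_smul f.app a s)

theorem Hom.symMap_symPar {M N : SuperPresheaf n m} (f : M.Hom N) (k : ℕ) (x : M.SymSec k U) :
    f.symMap k U (M.symPar k U x) = N.symPar k U (f.symMap k U x) := by
  let σ : O m U →ₐ[ℂ] O m U := O.par
  let P : M.obj U →ₗ[ℂ] M.obj U := M.par
  let Q : N.obj U →ₗ[ℂ] N.obj U := N.par
  let I := AlgHom.id ℂ (O m U)
  let F := f.appC U
  have h1 : ∀ a, σ (σ a) = σ (σ a) := fun _ => rfl
  have h2 : ∀ s, P (P s) = P (P s) := fun _ => rfl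
  have h4 : ∀ s, Q (Q s) = Q (Q s) := fun _ => rfl
  have h3 : ∀ a, I (σ a) = σ (I a) := fun _ => rfl
  have h6 : ∀ (a : O m U) (s : M.obj U), F (a • s) = I a • F s := fun a s => map_smul f.app a s
  have h5 : ∀ (a : O m U) (s : M.obj U), (Q.comp F) (a • s) = σ a • (Q.comp F) s :=
    fun a s => (congrArg N.par (map_smul f.app a s)).trans (N.par_smul a (f.app s))
  have h7 : ∀ s, (Q.comp F) (P s) = Q ((Q.comp F) s) := fun s => congrArg N.par (f.app_par s)
  have e1 := SymPow.map_map_eq (k := k) (σ := σ) (P := P) (τ := σ) (Q := P) (υ := σ) (R := Q)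
    σ P h1 h2 M.par_smul I F h3 f.app_par h6 σ (Q.comp F) h1 h7 h5 (fun _ => rfl) f.app_par x
  have e2 := SymPow.map_map_eq (k := k) (σ := σ) (P := P) (τ := σ) (Q := Q) (υ := σ) (R := Q)
    I F h3 f.app_par h6 σ Q h1 h4 N.par_smul σ (Q.comp F) h1 h7 h5
    (fun _ => rfl) (fun _ => rfl) x
  exact e1.trans e2.symm

theorem Hom.symMap_symRes {M N : SuperPresheaf n m} (f : M.Hom N) (k : ℕ) (h : V ≤ U)
    (x : M.SymSec k U) : f.symMap k V (M.symRes k h x) = N.symRes k h (f.symMap k U x) := by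
  let σ : O m U →ₐ[ℂ] O m U := O.par
  let P : M.obj U →ₗ[ℂ] M.obj U := M.par
  let τ : O m V →ₐ[ℂ] O m V := O.par
  let Q : N.obj V →ₗ[ℂ] N.obj V := N.par
  let I := AlgHom.id ℂ (O m U)
  let F := f.appC U
  let I' := AlgHom.id ℂ (O m V)
  let F' := f.appC V
  have h3 : ∀ a, I (σ a) = σ (I a) := fun _ => rfl
  have h3' : ∀ a, I' (τ a) = τ (I' a) := fun _ => rfl
  have h6 : ∀ (a : O m U) (s : M.obj U), F (a • s) = I a • F s := fun a s => map_smul f.app a s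
  have h6' : ∀ (a : O m V) (s : M.obj V), F' (a • s) = I' a • F' s :=
    fun a s => map_smul f.app a s
  have h5 : ∀ (a : O m U) (s : M.obj U),
      ((N.res h).comp F) (a • s) = O.res h a • ((N.res h).comp F) s :=
    fun a s => (congrArg (N.res h) (map_smul f.app a s)).trans (N.res_smul h a (f.app s))
  have h7 : ∀ s, ((N.res h).comp F) (P s) = Q (((N.res h).comp F) s) :=
    fun s => (congrArg (N.res h) (f.app_par s)).trans (N.res_par h _)
  have e1 := SymPow.map_map_eq (k := k) (σ := σ) (P := P) (τ := τ) (Q := M.par) (υ := τ) (R := Q)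
    (O.res h) (M.res h) (O.res_par h) (M.res_par h) (M.res_smul h) I' F' h3' f.app_par h6'
    (O.res h) ((N.res h).comp F) (O.res_par h) h7 h5 (fun _ => rfl) (f.app_res h) x
  have e2 := SymPow.map_map_eq (k := k) (σ := σ) (P := P) (τ := σ) (Q := N.par) (υ := τ) (R := Q)
    I F h3 f.app_par h6 (O.res h) (N.res h) (O.res_par h) (N.res_par h) (N.res_smul h)
    (O.res h) ((N.res h).comp F) (O.res_par h) h7 h5 (fun _ => rfl) (fun _ => rfl) x
  exact e1.trans e2.symm

/-- The map `Sym^k f : Sym^k M → Sym^k N` induced by an even morphism `f`; it sends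
`s₁ ⊙ ⋯ ⊙ s_k` to `f(s₁) ⊙ ⋯ ⊙ f(s_k)`. -/
def Hom.symPow {M N : SuperPresheaf n m} (f : M.Hom N) (k : ℕ) :
    (M.symPow k).Hom (N.symPow k) where
  app {U} :=
    { toFun := f.symMap k U
      map_add' := map_add _
      map_smul' := SymPow.map_asmul (A := O m U) (M := M.obj U) (σ := O.par) (P := M.par)
        (τ := O.par) (Q := N.par) (AlgHom.id ℂ (O m U)) (f.appC U) (fun _ => rfl) f.app_par
        (fun a s => map_smul f.app a s) }
  app_par {U} x := f.symMap_symPar k x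
  app_res h x := f.symMap_symRes k h x

/-- The presheaf tensor product `U ↦ M(U) ⊗_{𝒪(U)} N(U)`. -/
def tensor (M N : SuperPresheaf n m) : SuperPresheaf n m where
  obj U := SuperTensor (A := O m U) (M := M.obj U) (N.obj U) O.par M.par
  par := tensorMap O.par M.par N.par M.par_smul (fun _ => rfl) (fun _ => rfl) N.par_smul
  par_par x := by
    obtain ⟨x, rfl⟩ := SuperTensor.mk_surjective x
    rw [tensorMap_mk, tensorMap_mk]
    congr 1
    induction x using TensorProduct.induction_on with
    | zero => simp
    | tmul s t => simp [M.par_par, N.par_par]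
    | add x y hx hy => rw [map_add, map_add, hx, hy]
  par_smul a x := tensorMap_smul _ _ _ _ _ _ _ a x
  res h := tensorMap (O.res h) (M.res h) (N.res h) (M.res_smul h) (O.res_par h) (M.res_par h)
    (N.res_smul h)
  res_self x := by
    obtain ⟨x, rfl⟩ := SuperTensor.mk_surjective x
    rw [tensorMap_mk]
    congr 1
    induction x using TensorProduct.induction_on with
    | zero => simp
    | tmul s t => simp [M.res_self, N.res_self]
    | add x y hx hy => rw [map_add, hx, hy]
  res_res h h' x := by
    obtain ⟨x, rfl⟩ := SuperTensor.mk_surjective x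
    rw [tensorMap_mk, tensorMap_mk, tensorMap_mk]
    congr 1
    induction x using TensorProduct.induction_on with
    | zero => simp
    | tmul s t => simp [M.res_res, N.res_res]
    | add x y hx hy => rw [map_add, map_add, map_add, hx, hy]
  res_smul h a x := tensorMap_smul _ _ _ _ _ _ _ a x
  res_par h x := by
    obtain ⟨x, rfl⟩ := SuperTensor.mk_surjective x
    rw [tensorMap_mk, tensorMap_mk, tensorMap_mk, tensorMap_mk]
    congr 1
    induction x using TensorProduct.induction_on with
    | zero => simp
    | tmul s t => simp [M.res_par, N.res_par]
    | add x y hx hy => simp only [map_add, hx, hy]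

/-- The section `s ⊗ t` of `M ⊗ N`. -/
def tmul {M N : SuperPresheaf n m} (s : M.obj U) (t : N.obj U) : (M.tensor N).obj U :=
  SuperTensor.mk (A := O m U) (M := M.obj U) O.par M.par (s ⊗ₜ[ℂ] t)

/-- The twist `M(d) = M ⊗ 𝒪(d)`. -/
def serreTwist (M : SuperPresheaf n m) (d : ℤ) : SuperPresheaf n m := M.tensor (twist n m d)

theorem isHol_sum {ι : Type} [Fintype ι] {f : ι → Cone U → Lam m} (hf : ∀ i, IsHol (f i)) :
    IsHol (fun v => ∑ i, f i v) := by
  classical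
  refine Finset.induction_on (motive := fun t => IsHol (fun v => ∑ i ∈ t, f i v)) Finset.univ
    ?_ fun i t hi ih => ?_
  · simpa using IsHol.const (U := U) (0 : Lam m)
  · simp only [Finset.sum_insert hi]
    exact (hf i).add ih

theorem euler_isHomog (s : Fin m ⊕ Fin (n + 1) → twistSec m (-1) U) :
    IsHomog 0 (fun v : Cone U => ∑ a, (s (Sum.inl a)).1 v * theta a +
      ∑ j, v.1 j • (s (Sum.inr j)).1 v) := by
  intro c hc v
  have h (i) : (s i).1 (v.smul c hc) = c⁻¹ • scale c⁻¹ ((s i).1 v) := by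
    rw [(s i).2.2 c hc v, zpow_neg_one]
  have h' (j) : (v.smul c hc).1 j = c * v.1 j := rfl
  have h'' (a : Fin m) : scale c⁻¹ (theta a) = c⁻¹ • theta a := scale_ι _ _
  simp only [h, h', zpow_zero, one_smul, map_add, map_sum, map_mul, map_smul, h'',
    smul_mul_assoc, mul_smul_comm, smul_smul]
  congr 1
  refine Finset.sum_congr rfl fun j _ => ?_
  rw [mul_comm c, mul_assoc, mul_inv_cancel₀ hc, mul_one]

/-- The Euler map `𝒪(-1)^{⊕ m|n+1} → Π𝒪`. Writing a section as `∑ gₐ (π dθₐ) + ∑ fⱼ (π dzⱼ)`, it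
is the contraction with the Euler vector field, `(g, f) ↦ ∑ gₐ θₐ + ∑ fⱼ zⱼ`. -/
def euler (n m : ℕ) : ((twist n m (-1)).copies m (n + 1)).Hom (unit n m).parityChange where
  app {U} :=
    { toFun := fun (s : Fin m ⊕ Fin (n + 1) → twistSec m (-1) U) =>
        (⟨fun v => ∑ a, (s (Sum.inl a)).1 v * theta a + ∑ j, v.1 j • (s (Sum.inr j)).1 v,
          IsHol.add (isHol_sum fun a => (s (Sum.inl a)).2.1.mul (IsHol.const _))
            (isHol_sum fun j => (s (Sum.inr j)).2.1.coord_smul j), euler_isHomog s⟩ : O m U)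
      map_add' := fun s t => Subtype.ext (funext fun v => by
        change ∑ a, ((s (Sum.inl a)).1 v + (t (Sum.inl a)).1 v) * theta a +
            ∑ j, v.1 j • ((s (Sum.inr j)).1 v + (t (Sum.inr j)).1 v) =
          (∑ a, (s (Sum.inl a)).1 v * theta a + ∑ j, v.1 j • (s (Sum.inr j)).1 v) +
          (∑ a, (t (Sum.inl a)).1 v * theta a + ∑ j, v.1 j • (t (Sum.inr j)).1 v)
        simp only [add_mul, smul_add, Finset.sum_add_distrib]
        abel)
      map_smul' := fun b s => Subtype.ext (funext fun v => by
        change ∑ a, (b.1 v * (s (Sum.inl a)).1 v) * theta a +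
            ∑ j, v.1 j • (b.1 v * (s (Sum.inr j)).1 v) =
          b.1 v * (∑ a, (s (Sum.inl a)).1 v * theta a + ∑ j, v.1 j • (s (Sum.inr j)).1 v)
        simp only [mul_add, Finset.mul_sum, mul_assoc, mul_smul_comm]) }
  app_par {U} s := Subtype.ext (funext fun v => by
    let s' : Fin m ⊕ Fin (n + 1) → twistSec m (-1) U := s
    change ∑ a, inv ((s' (Sum.inl a)).1 v) * theta a +
        ∑ j, v.1 j • (-inv ((s' (Sum.inr j)).1 v)) =
      -inv (∑ a, (s' (Sum.inl a)).1 v * theta a + ∑ j, v.1 j • (s' (Sum.inr j)).1 v)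
    simp [map_sum, inv_theta, Finset.sum_neg_distrib]
    abel)
  app_res h s := rfl

/-! ### Associated sheaves -/

/-- The underlying presheaf of abelian groups. -/
def presheafAb (M : SuperPresheaf n m) : (Opens (projSpace n))ᵒᵖ ⥤ AddCommGrpCat.{0} where
  obj U := AddCommGrpCat.of (M.obj U.unop)
  map f := AddCommGrpCat.ofHom (M.res f.unop.le).toAddMonoidHom
  map_id U := by
    ext s; exact M.res_self s
  map_comp f g := by
    ext s; exact (M.res_res _ _ s).symm

instance (M : SuperPresheaf n m) (X : (Opens (projSpace n))ᵒᵖ) :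
    Module ((sheafO n m).obj.obj X) (M.presheafAb.obj X) :=
  inferInstanceAs (Module (O m X.unop) (M.obj X.unop))

/-- The underlying presheaf of `𝒪`-modules. -/
def presheafMod (M : SuperPresheaf n m) : PresheafOfModules.{0} (sheafO n m).obj :=
  PresheafOfModules.ofPresheaf M.presheafAb fun _ _ f a s => M.res_smul f.unop.le a s

/-- The parity involution on the underlying presheaf of abelian groups. -/
def presheafPar (M : SuperPresheaf n m) : M.presheafAb ⟶ M.presheafAb where
  app U := AddCommGrpCat.ofHom (M.par (U := U.unop)).toAddMonoidHom
  naturality X Y f := by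
    ext s; exact (M.res_par f.unop.le s).symm

/-- The morphism of presheaves of `𝒪`-modules underlying an even morphism. -/
def Hom.presheafMap {M N : SuperPresheaf n m} (f : M.Hom N) : M.presheafMod ⟶ N.presheafMod :=
  PresheafOfModules.homMk
    { app := fun U => AddCommGrpCat.ofHom (f.app (U := U.unop)).toAddMonoidHom
      naturality := fun X Y g => by
        ext s; exact f.app_res g.unop.le s }
    (fun U (a : O m U.unop) (s : M.obj U.unop) => map_smul (f.app (U := U.unop)) a s)

/-- The sheaf of `𝒪`-modules associated with a presheaf of supermodules. -/
def sheaf (M : SuperPresheaf n m) : SheafOfModules.{0} (sheafO n m) :=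
  (PresheafOfModules.sheafification (𝟙 (sheafO n m).obj)).obj M.presheafMod

/-- The underlying abelian sheaf. -/
abbrev sheafAb (M : SuperPresheaf n m) :
    Sheaf (Opens.grothendieckTopology (projSpace n)) AddCommGrpCat.{0} :=
  (SheafOfModules.toSheaf (sheafO n m)).obj M.sheaf

/-- The parity involution, i.e. the `ℤ/2`-grading, of the associated sheaf. -/
def sheafPar (M : SuperPresheaf n m) : M.sheafAb ⟶ M.sheafAb :=
  (presheafToSheaf (Opens.grothendieckTopology (projSpace n)) AddCommGrpCat.{0}).map M.presheafPar

/-- The morphism of associated sheaves. -/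
def Hom.sheafMap {M N : SuperPresheaf n m} (f : M.Hom N) : M.sheaf ⟶ N.sheaf :=
  (PresheafOfModules.sheafification (𝟙 (sheafO n m).obj)).map f.presheafMap

/-- The section of the associated sheaf defined by a section of the presheaf. -/
def sec (M : SuperPresheaf n m) (s : M.obj U) : M.sheaf.val.obj (op U) :=
  (toSheafify (Opens.grothendieckTopology (projSpace n)) M.presheafAb).app (op U) s

/-- The effect of a morphism of associated sheaves on sections over `U`. -/
def onSections {M N : SuperPresheaf n m} (f : M.sheaf ⟶ N.sheaf) (U : Opens (projSpace n)) :
    M.sheaf.val.obj (op U) → N.sheaf.val.obj (op U) := fun s => f.val.app (op U) s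

/-- A morphism of associated sheaves of `𝒪`-modules is even if it preserves the parity. -/
def IsEven {M N : SuperPresheaf n m} (f : M.sheaf ⟶ N.sheaf) : Prop :=
  M.sheafPar ≫ (SheafOfModules.toSheaf (sheafO n m)).map f =
    (SheafOfModules.toSheaf (sheafO n m)).map f ≫ N.sheafPar

/-- `0 → M → N → P → 0` is a short exact sequence of sheaves of `𝒪`-supermodules. -/
def IsSuperShortExact {M N P : SuperPresheaf n m} (f : M.sheaf ⟶ N.sheaf)
    (g : N.sheaf ⟶ P.sheaf) : Prop :=
  IsEven f ∧ IsEven g ∧ ∃ w : f ≫ g = 0, (ShortComplex.mk f g w).ShortExact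

theorem parityChange_sheaf (M : SuperPresheaf n m) : M.parityChange.sheaf = M.sheaf := rfl

/-- Sheaf cohomology `Hᵠ(ℙⁿ|ᵐ, M)`. -/
abbrev H (q : ℕ) (M : SuperPresheaf n m) : Type := Sheaf.H M.sheafAb q

/-- The map induced on cohomology by a morphism of abelian sheaves. -/
def mapHAb (q : ℕ) {M N : SuperPresheaf n m} (f : M.sheafAb ⟶ N.sheafAb) : H q M →+ H q N :=
  Sheaf.H.map f q

/-- The morphism of abelian sheaves underlying a morphism of sheaves of `𝒪`-modules. -/
abbrev toAb {M N : SuperPresheaf n m} (f : M.sheaf ⟶ N.sheaf) : M.sheafAb ⟶ N.sheafAb :=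
  (SheafOfModules.toSheaf (sheafO n m)).map f

/-- The map induced on cohomology by a morphism of sheaves of `𝒪`-modules. -/
def mapH (q : ℕ) {M N : SuperPresheaf n m} (f : M.sheaf ⟶ N.sheaf) : H q M →+ H q N :=
  mapHAb q (toAb f)

/-- `δ` makes `0 → H⁰(M) → H⁰(N) → H⁰(P) → H¹(M) → ⋯` into a long exact sequence, and is natural
for endomorphisms of the sequence `M → N → P` of abelian sheaves; in particular `δ` commutes with
the parity involutions and with multiplication by complex numbers. -/
def IsLongExact {M N P : SuperPresheaf n m} (f : M.sheaf ⟶ N.sheaf) (g : N.sheaf ⟶ P.sheaf)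
    (δ : ∀ q : ℕ, H q P →+ H (q + 1) M) : Prop :=
  Function.Injective (mapH 0 f) ∧
  (∀ q, Function.Exact (mapH q f) (mapH q g)) ∧
  (∀ q, Function.Exact (mapH q g) (δ q)) ∧
  (∀ q, Function.Exact (δ q) (mapH (q + 1) f)) ∧
  ∀ (u : M.sheafAb ⟶ M.sheafAb) (v : N.sheafAb ⟶ N.sheafAb) (w : P.sheafAb ⟶ P.sheafAb),
    u ≫ toAb f = toAb f ≫ v → v ≫ toAb g = toAb g ≫ w →
    ∀ (q : ℕ) (x : H q P), δ q (mapHAb q w x) = mapHAb (q + 1) u (δ q x)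

/-! ### The sheaves in the sequence -/

/-- `𝒪(-1)^{⊕ m|n+1}`. -/
def eulerMiddle (n m : ℕ) : SuperPresheaf n m := (twist n m (-1)).copies m (n + 1)

/-- `𝒪^{⊕ m|n+1}`. -/
def trivialMiddle (n m : ℕ) : SuperPresheaf n m := (unit n m).copies m (n + 1)

/-- `(Sym^k 𝒪^{⊕ m|n+1})(-k)`. -/
def symMiddle (n m k : ℕ) : SuperPresheaf n m :=
  ((trivialMiddle n m).symPow k).serreTwist (-(k : ℤ))

/-- The section of `𝒪(-1)^{⊕ m|n+1}` with the single entry `g` in place `j`. -/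
def single (j : Fin m ⊕ Fin (n + 1)) (g : twistSec m (-1) U) : (eulerMiddle n m).obj U :=
  Pi.single (M := fun _ : Fin m ⊕ Fin (n + 1) => twistSec m (-1) U) j g

/-- The standard generator `e_j` of `𝒪^{⊕ m|n+1}`. -/
def basisVec (U : Opens (projSpace n)) (j : Fin m ⊕ Fin (n + 1)) : (trivialMiddle n m).obj U :=
  Pi.single (M := fun _ : Fin m ⊕ Fin (n + 1) => O m U) j 1

/-- The function `∑ gₐ θₐ + ∑ fⱼ zⱼ` to which the Euler map sends the section `(g, f)`. -/
def contraction (f : (eulerMiddle n m).obj U) : O m U := (euler n m).app f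

/-- A map `c : Sym^k (𝒪(-1)^{⊕ m|n+1}) → (Sym^k 𝒪^{⊕ m|n+1})(-k)` is the canonical one if
`c(g₁ e_{j₁} ⊙ ⋯ ⊙ g_k e_{j_k}) = (e_{j₁} ⊙ ⋯ ⊙ e_{j_k}) ⊗ g₁ ⋯ g_k`
for all local even sections `g₁, …, g_k` of `𝒪(-1)`. -/
def IsCanonical {k : ℕ} (c : ((eulerMiddle n m).symPow k).sheaf ⟶ (symMiddle n m k).sheaf) :
    Prop :=
  ∀ (U : Opens (projSpace n)) (j : Fin k → Fin m ⊕ Fin (n + 1)) (g : Fin k → twistSec m (-1) U)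
    (h : twistSec m (-(k : ℤ)) U),
    (∀ l, (twist n m (-1)).IsHomogeneous 0 (g l)) →
    h.1 = (List.ofFn fun l => (g l).1).prod →
    onSections c U (sec ((eulerMiddle n m).symPow k)
        ((eulerMiddle n m).mon fun l => single (j l) (g l))) =
      sec (symMiddle n m k) (tmul ((trivialMiddle n m).mon fun l => basisVec U (j l)) h)

/-- A map `Sym^{k+1} (𝒪(-1)^{⊕ m|n+1}) → Π Sym^k Π𝒯*` is contraction with the Euler map if it sends
`i(ω₁) ⊙ ⋯ ⊙ i(ω_k) ⊙ f` to `p(f) · ω₁ ⊙ ⋯ ⊙ ω_k` for all local one-forms `ω₁, …, ω_k` and all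
odd local sections `f` of `𝒪(-1)^{⊕ m|n+1}`, where `p` is the Euler map. -/
def IsContraction {k : ℕ} (i : (piCotangent n m).Hom (eulerMiddle n m))
    (b : ((eulerMiddle n m).symPow (k + 1)).sheaf ⟶
      ((piCotangent n m).symPow k).parityChange.sheaf) : Prop :=
  ∀ (U : Opens (projSpace n)) (ω : Fin k → (piCotangent n m).obj U)
    (f : (eulerMiddle n m).obj U), (eulerMiddle n m).IsHomogeneous 1 f →
    onSections b U (sec ((eulerMiddle n m).symPow (k + 1))
        ((eulerMiddle n m).mon
          (Fin.snoc (α := fun _ => (eulerMiddle n m).obj U) (fun l => i.app (ω l)) f))) =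
      sec ((piCotangent n m).symPow k).parityChange (contraction f • (piCotangent n m).mon ω)

end SuperPresheaf
end SuperProj

end

open SuperProj SuperProj.SuperPresheaf

/-! ### Affine charts of projective space and open cones. -/

noncomputable section
namespace SuperProj

/-! Exactness is local, and inside one affine chart `z_l ≠ 0` the two sequences split, so that they
are exact already on sections. A presheaf and its restriction to such open sets (extended by zero)
have the same associated sheaf (`smallIncl`), and sheafification is exact. Hence it suffices to give
maps on small open sets and to check exactness there (`LocalHom.ShortExact.shortExact_sheaf`).

The dual Euler sequence. Let `J` run over all homogeneous coordinates, odd and even, and let `x_J`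
be the `J`-th coordinate divided by `z_l`. On the chart the vector fields `z_l ∂_J` generate the
tangent sheaf (`eq_sum_field`) and satisfy `∑ x_J z_l ∂_J = 0` (`euler_field`). Generation rests on
the fact that a superderivation is determined by its values on the `x_J` (`tangent_eq_zero`): by
Hadamard's lemma a function near a given point is a polynomial in the `θ_a / z_l` plus a sum of
terms `(z_j / z_l - c_j) h_j`, where `c_j` is the value of `z_j / z_l` at the point. A derivation
that kills the affine coordinates kills the polynomial, and it sends the rest to something that
vanishes at the point. So a one-form `ω` is the same as a family `X_J = ω(z_l ∂_J)` with `∑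
(-1)^{|J|} X_J x_J = 0` (`form_ext_field`, `pair_formOf`). The entries `(-1)^{|J|} X_J / z_l` do not
depend on `l` and form a section of `𝒪(-1)^{⊕ m|n+1}`; the relation says that the Euler map `p`
kills it. Surjectivity of `p` is seen on `e = dz_l / z_l`, for which `p(e) = 1`.

The sequence of symmetric powers is a Koszul sequence. The map `p` extends to a right
superderivation `d` of the supersymmetric algebra that vanishes on scalars; it exists because `x ↦
[[x, d x], [0, x̄]]`, with `x̄` the parity conjugate, is to be an algebra map, which can be defined
on generators (`contractHom`). One has `d ∘ d = 0`. On a chart let `r(s)` be the one-form with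
`i(r(s)) = s - p(s) e`. Since `e` is odd, `e² = 0`, and multiplicativity gives `x =
Sym(i)(Sym(r)(x)) + d(x) e` for all `x` (`IsContractible.eq_map_add_contract`). Therefore the kernel
of `d` is the image of `Sym(i)`, the values of `d` lie in this image too, and `d(z e) = z` for every
`z` in it. As `Sym(i)` is injective, `d` becomes a surjection onto `Sym^k Π𝒯*`.

The canonical isomorphism `c` is multiplication of the entries by `z_l`, tensored with `z_l^{-k}`;
another chart changes the two factors by inverse powers of the even unit `z_l / z_{l'}`
(`canonicalOn_eq`). The map `β` is the inverse of `c` followed by the contraction. The connecting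
homomorphisms are products with the extension class in `Ext¹`, and their naturality is that of the
class (`exists_isLongExact`). -/

/-- `U` lies in one of the standard affine charts of `ℙⁿ`. -/
def IsSmall {n : ℕ} (U : Opens (projSpace n)) : Prop := ∃ l : Fin (n + 1), ∀ v ∈ coneSet U, v l ≠ 0

theorem IsSmall.mono {n : ℕ} {U V : Opens (projSpace n)} (hU : IsSmall U) (h : V ≤ U) :
    IsSmall V := by
  obtain ⟨l, hl⟩ := hU
  exact ⟨l, fun v hv => hl v (coneSet_mono h hv)⟩

theorem exists_rep {n : ℕ} (x : projSpace n) :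
    ∃ (v : Fin (n + 1) → ℂ) (h : v ≠ 0), point v h = x := by
  induction x using Projectivization.ind with
  | h v hv => exact ⟨v, hv, rfl⟩

theorem continuous_point (n : ℕ) : Continuous (fun v : {v : Fin (n + 1) → ℂ // v ≠ 0} =>
    (point v.1 v.2 : projSpace n)) := continuous_coinduced_rng

/-- The open set of points of `ℙⁿ` given by an open cone. -/
def ofCone {n : ℕ} (S : Set (Fin (n + 1) → ℂ)) (hS : IsOpen S)
    (hc : ∀ v ∈ S, ∀ c : ℂ, c ≠ 0 → c • v ∈ S) : Opens (projSpace n) where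
  carrier := {x | ∃ (v : Fin (n + 1) → ℂ) (h : v ≠ 0), v ∈ S ∧ point v h = x}
  is_open' := by
    refine isOpen_coinduced.2 ?_
    -- In the quotient topology openness is tested on the preimage, which is the trace of `S`
    -- because `S` is stable under nonzero scalars.
    have : (fun v : {v : Fin (n + 1) → ℂ // v ≠ 0} => Projectivization.mk ℂ v.1 v.2) ⁻¹'
        {x | ∃ (v : Fin (n + 1) → ℂ) (h : v ≠ 0), v ∈ S ∧ point v h = x} =
        Subtype.val ⁻¹' S := by
      ext w
      constructor
      · rintro ⟨v, h, hv, e⟩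
        obtain ⟨c, hc'⟩ := (Projectivization.mk_eq_mk_iff ℂ _ _ h w.2).1 e
        have h2 := hc v hv (c⁻¹ : ℂˣ) (Units.ne_zero _)
        rw [← hc'] at h2
        change w.1 ∈ S
        convert h2 using 1
        change w.1 = ((c⁻¹ : ℂˣ) : ℂ) • ((c : ℂ) • w.1)
        rw [smul_smul, Units.inv_mul, one_smul]
      · intro hw; exact ⟨w.1, w.2, hw, rfl⟩
    exact this ▸ hS.preimage continuous_subtype_val

theorem mem_coneSet_ofCone {n : ℕ} {S : Set (Fin (n + 1) → ℂ)} {hS : IsOpen S}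
    {hc : ∀ v ∈ S, ∀ c : ℂ, c ≠ 0 → c • v ∈ S} {v : Fin (n + 1) → ℂ} :
    v ∈ coneSet (ofCone S hS hc) ↔ v ≠ 0 ∧ v ∈ S := by
  constructor
  · rintro ⟨h, w, hw, hwS, e⟩
    refine ⟨h, ?_⟩
    obtain ⟨c, hc'⟩ := (Projectivization.mk_eq_mk_iff ℂ _ _ hw h).1 e
    have h2 := hc w hwS (c⁻¹ : ℂˣ) (Units.ne_zero _)
    rw [← hc'] at h2
    convert h2 using 1
    change v = ((c⁻¹ : ℂˣ) : ℂ) • ((c : ℂ) • v)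
    rw [smul_smul, Units.inv_mul, one_smul]
  · rintro ⟨h, hv⟩; exact ⟨h, v, h, hv, rfl⟩

/-- The affine chart `z_l ≠ 0`. -/
def chart {n : ℕ} (l : Fin (n + 1)) : Opens (projSpace n) :=
  ofCone {v | v l ≠ 0} (isOpen_ne_fun (continuous_apply l) continuous_const)
    fun _ hv _ hc => mul_ne_zero hc hv

theorem chart_ne {n : ℕ} {l : Fin (n + 1)} {U : Opens (projSpace n)} (h : U ≤ chart l) :
    ∀ v ∈ coneSet U, v l ≠ 0 :=
  fun _ hv => (mem_coneSet_ofCone.1 (coneSet_mono h hv)).2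

theorem exists_mem_chart {n : ℕ} (x : projSpace n) : ∃ l, x ∈ chart l := by
  obtain ⟨v, hv, rfl⟩ := exists_rep x
  obtain ⟨l, hl⟩ := Function.ne_iff.1 hv
  exact ⟨l, v, hv, hl, rfl⟩

theorem isSmall_inf_chart {n : ℕ} (U : Opens (projSpace n)) (l : Fin (n + 1)) :
    IsSmall (U ⊓ chart l) := ⟨l, chart_ne inf_le_right⟩

theorem isOpen_coneSet {n : ℕ} (U : Opens (projSpace n)) : IsOpen (coneSet U) := by
  have h1 : IsOpen {v : {v : Fin (n + 1) → ℂ // v ≠ 0} | point v.1 v.2 ∈ U} :=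
    U.2.preimage (continuous_point n)
  have h2 : IsOpen {v : Fin (n + 1) → ℂ | v ≠ 0} := isOpen_ne
  have := h2.isOpenMap_subtype_val _ h1
  convert this using 1
  ext v
  constructor
  · rintro ⟨h, hv⟩; exact ⟨⟨v, h⟩, hv, rfl⟩
  · rintro ⟨⟨w, h⟩, hv, rfl⟩; exact ⟨h, hv⟩

namespace SuperPresheaf
variable {n m : ℕ} {U V : Opens (projSpace n)}

/-! ### Sections of associated sheaves -/

theorem onSections_sec {M N : SuperPresheaf n m} (f : M.Hom N) (s : M.obj U) :
    onSections f.sheafMap U (sec M s) = sec N (f.app s) := by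
  have := toSheafify_naturality (Opens.grothendieckTopology (projSpace n))
    ((PresheafOfModules.toPresheaf _).map f.presheafMap)
  have h2 := congrArg (fun φ => φ.app (op U)) this
  exact (ConcreteCategory.congr_hom h2 s).symm

theorem onSections_comp {M N P : SuperPresheaf n m} (f : M.sheaf ⟶ N.sheaf)
    (g : N.sheaf ⟶ P.sheaf) (s : M.sheaf.val.obj (op U)) :
    onSections (f ≫ g) U s = onSections g U (onSections f U s) := rfl

theorem onSections_id {M : SuperPresheaf n m} (s : M.sheaf.val.obj (op U)) :
    onSections (𝟙 M.sheaf) U s = s := rfl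

/-- Restriction of sections of the associated sheaf. -/
def sheafRes (M : SuperPresheaf n m) (h : V ≤ U) (s : M.sheaf.val.obj (op U)) :
    M.sheaf.val.obj (op V) := M.sheafAb.obj.map (homOfLE h).op s

theorem sheafRes_sec (M : SuperPresheaf n m) (h : V ≤ U) (s : M.obj U) :
    sheafRes M h (sec M s) = sec M (M.res h s) := by
  have := (toSheafify (Opens.grothendieckTopology (projSpace n)) M.presheafAb).naturality
    (homOfLE h).op
  exact (ConcreteCategory.congr_hom this s).symm

theorem sheafRes_onSections {M N : SuperPresheaf n m} (f : M.sheaf ⟶ N.sheaf) (h : V ≤ U)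
    (s : M.sheaf.val.obj (op U)) :
    sheafRes N h (onSections f U s) = onSections f V (sheafRes M h s) := by
  have := ((toAb f).hom).naturality (homOfLE h).op
  exact (ConcreteCategory.congr_hom this s).symm

/-- The charts cover `ℙⁿ` and the associated sheaf is separated, so it suffices to compare on the
intersections of `U` with the charts. -/
theorem eq_of_small {N : SuperPresheaf n m} {s t : N.sheaf.val.obj (op U)}
    (h : ∀ V (hV : V ≤ U), IsSmall V → sheafRes N hV s = sheafRes N hV t) : s = t := by
  refine TopCat.Sheaf.eq_of_locally_eq' (X := projSpace n) (C := AddCommGrpCat.{0}) N.sheafAb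
    (fun l : Fin (n + 1) => U ⊓ chart l) U (fun l => homOfLE inf_le_left) ?_ s t ?_
  · intro x hx
    obtain ⟨l, hl⟩ := exists_mem_chart x
    exact Opens.mem_iSup.2 ⟨l, hx, hl⟩
  · intro l
    exact h _ inf_le_left (isSmall_inf_chart U l)

/-- The adjunction turns `f` and `g` into morphisms out of the presheaf, and these are determined by
the underlying maps of abelian presheaves. -/
theorem sheafification_hom_ext {P : PresheafOfModules.{0} (sheafO n m).obj}
    {F : SheafOfModules.{0} (sheafO n m)}
    {f g : (PresheafOfModules.sheafification (𝟙 (sheafO n m).obj)).obj P ⟶ F}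
    (h : toSheafify (Opens.grothendieckTopology (projSpace n)) P.presheaf ≫
        (PresheafOfModules.toPresheaf _).map f.val =
      toSheafify (Opens.grothendieckTopology (projSpace n)) P.presheaf ≫
        (PresheafOfModules.toPresheaf _).map g.val) : f = g := by
  apply (PresheafOfModules.sheafificationHomEquiv (𝟙 (sheafO n m).obj)).injective
  apply (PresheafOfModules.toPresheaf _).map_injective
  rw [PresheafOfModules.toPresheaf_map_sheafificationHomEquiv_def,
    PresheafOfModules.toPresheaf_map_sheafificationHomEquiv_def, h]

theorem sheaf_hom_ext {M : SuperPresheaf n m} {F : SheafOfModules.{0} (sheafO n m)}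
    {f g : M.sheaf ⟶ F}
    (h : ∀ (U : Opens (projSpace n)) (s : M.obj U),
      f.val.app (op U) (sec M s) = g.val.app (op U) (sec M s)) : f = g :=
  sheafification_hom_ext (by ext U s; exact h U.unop s)

/-! ### Restriction to small open sets -/

/-- The sub-presheaf that is `M` on open subsets of the charts, and zero elsewhere. -/
def small (M : SuperPresheaf n m) : SuperPresheaf n m :=
  M.sub (fun {U} s => IsSmall U ∨ s = 0) (Or.inr rfl)
    (fun {U s t} (hs : IsSmall U ∨ s = 0) (ht : IsSmall U ∨ t = 0) => by
      rcases hs with hs | rfl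
      · exact Or.inl hs
      · rwa [zero_add])
    (fun {U} a {s} (hs : IsSmall U ∨ s = 0) => hs.imp_right fun h => by rw [h, smul_zero])
    (fun {U s} (hs : IsSmall U ∨ s = 0) => hs.imp_right fun h => by rw [h, map_zero])
    (fun {V U} h {s} (hs : IsSmall U ∨ s = 0) =>
      hs.imp (fun hU => hU.mono h) fun h => by rw [h, map_zero])

/-- The inclusion of `M.small`. -/
def smallIncl (M : SuperPresheaf n m) : M.small.Hom M where
  app := Submodule.subtype _
  app_par _ := rfl
  app_res _ _ := rfl

/-- The inclusion is injective on sections, and it is locally surjective because every point lies in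
a chart. Sheafification inverts such maps. -/
instance (M : SuperPresheaf n m) : IsIso M.smallIncl.sheafMap := by
  let φ := (PresheafOfModules.toPresheaf (sheafO n m).obj).map M.smallIncl.presheafMap
  have hinj : ∀ U, Function.Injective (φ.app U) := fun U => Subtype.val_injective
  have h1 : Presheaf.IsLocallyInjective (Opens.grothendieckTopology (projSpace n)) φ :=
    Presheaf.isLocallyInjective_of_injective _ φ hinj
  have h2 : Presheaf.IsLocallySurjective (Opens.grothendieckTopology (projSpace n)) φ := by
    constructor
    intro U s x hx
    obtain ⟨l, hl⟩ := exists_mem_chart x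
    refine ⟨U ⊓ chart l, homOfLE inf_le_left, ⟨⟨M.res inf_le_left s,
      Or.inl (isSmall_inf_chart U l)⟩, rfl⟩, hx, hl⟩
  have hW : (Opens.grothendieckTopology (projSpace n)).W φ :=
    GrothendieckTopology.W_of_isLocallyBijective _ φ
  have h3 : IsIso ((presheafToSheaf (Opens.grothendieckTopology (projSpace n))
    AddCommGrpCat.{0}).map φ) := (GrothendieckTopology.W_iff _ φ).1 hW
  -- The abelian sheaf underlying the sheafification of modules is by definition the sheafification
  -- of the underlying abelian presheaf.
  have h4 : IsIso ((SheafOfModules.toSheaf (sheafO n m)).map M.smallIncl.sheafMap) := h3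
  exact isIso_of_reflects_iso _ (SheafOfModules.toSheaf (sheafO n m))

/-- Sections over small open sets determine morphisms of associated sheaves. -/
theorem hom_ext_of_small {M N : SuperPresheaf n m} {f g : M.sheaf ⟶ N.sheaf}
    (h : ∀ U, IsSmall U → ∀ s : M.obj U, onSections f U (sec M s) = onSections g U (sec M s)) :
    f = g := by
  refine sheaf_hom_ext fun U s => eq_of_small fun V hV hs => ?_
  refine (sheafRes_onSections f hV _).trans (Eq.trans ?_ (sheafRes_onSections g hV _).symm)
  rw [sheafRes_sec]
  exact h V hs _

/-- Even `𝒪`-linear maps that are only given on small open sets. -/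
structure LocalHom (M N : SuperPresheaf n m) where
  app : ∀ {U}, IsSmall U → M.obj U →ₗ[O m U] N.obj U
  app_par : ∀ {U} (hU : IsSmall U) (s : M.obj U), app hU (M.par s) = N.par (app hU s)
  app_res : ∀ {V U} (h : V ≤ U) (hU : IsSmall U) (s : M.obj U),
    app (hU.mono h) (M.res h s) = N.res h (app hU s)

/-- A morphism, given on small open sets. -/
def Hom.toLocal {M N : SuperPresheaf n m} (f : M.Hom N) : M.LocalHom N where
  app _ := f.app
  app_par _ := f.app_par
  app_res h _ := f.app_res h

/-- A local morphism as a morphism of the presheaves of sections over small open sets. -/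
def LocalHom.small {M N : SuperPresheaf n m} (f : M.LocalHom N) : M.small.Hom N.small where
  app {U} := by
    classical exact
    { toFun := fun s => if h : IsSmall U then ⟨f.app h s.1, Or.inl h⟩ else 0
      map_add' := fun s t => by
        by_cases h : IsSmall U
        · refine (dif_pos h).trans (Eq.trans (Subtype.ext ?_)
            (congrArg₂ (· + ·) (dif_pos h) (dif_pos h)).symm)
          exact map_add (f.app h) s.1 t.1
        · refine (dif_neg h).trans (Eq.trans ?_
            (congrArg₂ (· + ·) (dif_neg h) (dif_neg h)).symm)
          exact (add_zero 0).symm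
      map_smul' := fun a s => by
        by_cases h : IsSmall U
        · refine (dif_pos h).trans (Eq.trans (Subtype.ext ?_)
            (congrArg (a • ·) (dif_pos h)).symm)
          exact map_smul (f.app h) a s.1
        · refine (dif_neg h).trans (Eq.trans ?_ (congrArg (a • ·) (dif_neg h)).symm)
          exact (smul_zero a).symm }
  app_par {U} s := by
    by_cases h : IsSmall U
    · refine (dif_pos h).trans (Eq.trans (Subtype.ext ?_) (congrArg N.small.par (dif_pos h).symm))
      exact f.app_par h s.1
    · refine (dif_neg h).trans (Eq.trans ?_ (congrArg N.small.par (dif_neg h).symm))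
      exact (map_zero N.small.par).symm
  app_res {V U} hVU s := by
    by_cases h : IsSmall U
    · refine (dif_pos (h.mono hVU)).trans
        (Eq.trans (Subtype.ext ?_) (congrArg (N.small.res hVU) (dif_pos h).symm))
      exact f.app_res hVU h s.1
    -- Although `V` may be small, a section of `M.small` over a set `U` that is not small is zero,
    -- so both sides vanish.
    · have h0 : s = 0 := Subtype.ext (s.2.resolve_left h)
      subst h0
      rw [map_zero, LinearMap.map_zero, LinearMap.map_zero, map_zero]

theorem LocalHom.small_app {M N : SuperPresheaf n m} (f : M.LocalHom N) (hU : IsSmall U)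
    (s : M.small.obj U) : (f.small.app s : N.small.obj U).1 = f.app hU s.1 :=
  congrArg Subtype.val (dif_pos hU)

/-- The morphism of associated sheaves defined by a local morphism. -/
def LocalHom.sheafMap {M N : SuperPresheaf n m} (f : M.LocalHom N) : M.sheaf ⟶ N.sheaf :=
  CategoryTheory.inv M.smallIncl.sheafMap ≫ f.small.sheafMap ≫ N.smallIncl.sheafMap

theorem LocalHom.smallIncl_sheafMap {M N : SuperPresheaf n m} (f : M.LocalHom N) :
    M.smallIncl.sheafMap ≫ f.sheafMap = f.small.sheafMap ≫ N.smallIncl.sheafMap := by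
  rw [LocalHom.sheafMap, IsIso.hom_inv_id_assoc]

/-- Over a small open set a section of `M` is already one of `M.small`; so the inverse that occurs
in `LocalHom.sheafMap` cancels and need not be computed. -/
theorem LocalHom.onSections_sec {M N : SuperPresheaf n m} (f : M.LocalHom N) (hU : IsSmall U)
    (s : M.obj U) : onSections f.sheafMap U (sec M s) = sec N (f.app hU s) := by
  let s' : M.small.obj U := ⟨s, Or.inl hU⟩
  have h1 : sec M s = onSections M.smallIncl.sheafMap U (sec M.small s') :=
    (SuperPresheaf.onSections_sec M.smallIncl s').symm
  rw [h1, ← onSections_comp, f.smallIncl_sheafMap, onSections_comp,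
    SuperPresheaf.onSections_sec, SuperPresheaf.onSections_sec]
  exact congrArg (sec N) (f.small_app hU s')

theorem Hom.toLocal_sheafMap {M N : SuperPresheaf n m} (f : M.Hom N) :
    f.toLocal.sheafMap = f.sheafMap :=
  hom_ext_of_small fun U hU s => by
    rw [f.toLocal.onSections_sec hU, SuperPresheaf.onSections_sec]; rfl

/-! ### Parity -/

theorem IsEven.comp {M N P : SuperPresheaf n m} {f : M.sheaf ⟶ N.sheaf} {g : N.sheaf ⟶ P.sheaf}
    (hf : IsEven f) (hg : IsEven g) : IsEven (M := M) (N := P) (f ≫ g) := by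
  unfold IsEven at *
  rw [Functor.map_comp, ← Category.assoc, hf, Category.assoc, hg, Category.assoc]

theorem IsEven.inv {M N : SuperPresheaf n m} {f : M.sheaf ⟶ N.sheaf} [IsIso f]
    (hf : IsEven f) : IsEven (M := N) (N := M) (CategoryTheory.inv f) := by
  unfold IsEven at *
  rw [Functor.map_inv, IsIso.comp_inv_eq, Category.assoc, IsIso.eq_inv_comp]
  exact hf.symm

/-- The morphism of presheaves of abelian groups underlying an even morphism. -/
def Hom.abMap {M N : SuperPresheaf n m} (f : M.Hom N) : M.presheafAb ⟶ N.presheafAb :=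
  (PresheafOfModules.toPresheaf (sheafO n m).obj).map f.presheafMap

theorem Hom.isEven {M N : SuperPresheaf n m} (f : M.Hom N) : IsEven f.sheafMap := by
  have h : M.presheafPar ≫ f.abMap = f.abMap ≫ N.presheafPar := by
    ext U s; exact f.app_par s
  have h2 := congrArg (presheafToSheaf (Opens.grothendieckTopology (projSpace n))
    AddCommGrpCat.{0}).map h
  rw [Functor.map_comp, Functor.map_comp] at h2
  exact h2

theorem LocalHom.isEven {M N : SuperPresheaf n m} (f : M.LocalHom N) : IsEven f.sheafMap :=
  IsEven.comp M.smallIncl.isEven.inv (IsEven.comp f.small.isEven N.smallIncl.isEven)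

/-! ### Exactness -/

/-- `f` and `g` form a short exact sequence over every small open set. -/
structure LocalHom.ShortExact {M N P : SuperPresheaf n m} (f : M.LocalHom N) (g : N.LocalHom P) :
    Prop where
  injective : ∀ {U} (hU : IsSmall U), Function.Injective (f.app hU)
  exact : ∀ {U} (hU : IsSmall U), Function.Exact (f.app hU) (g.app hU)
  surjective : ∀ {U} (hU : IsSmall U), Function.Surjective (g.app hU)

/-- Exactness in the middle means that the map into the kernel is an epimorphism. Since the kernel
inclusion is injective on sections, this reduces to lifting sections that are killed by `S.g`. -/
theorem _root_.PresheafOfModules.shortExact_of_sections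
    {S : ShortComplex (PresheafOfModules.{0} (sheafO n m).obj)}
    (hf : ∀ X, Function.Injective (S.f.app X)) (hg : ∀ X, Function.Surjective (S.g.app X))
    (h : ∀ X y, S.g.app X y = 0 → ∃ x, S.f.app X x = y) : S.ShortExact := by
  have : Mono S.f := PresheafOfModules.mono_of_injective fun X => hf X
  have : Epi S.g := PresheafOfModules.epi_of_surjective fun X => hg X
  refine ShortComplex.ShortExact.mk ?_
  rw [ShortComplex.exact_iff_epi_kernel_lift]
  refine PresheafOfModules.epi_of_surjective fun X y => ?_
  have hk : S.g.app X ((Limits.kernel.ι S.g).app X y) = 0 :=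
    ConcreteCategory.congr_hom (congrArg (fun φ => φ.app X) (Limits.kernel.condition S.g)) y
  obtain ⟨x, hx⟩ := h X _ hk
  refine ⟨x, PresheafOfModules.injective_of_mono (Limits.kernel.ι S.g) X ?_⟩
  refine Eq.trans ?_ hx
  exact ConcreteCategory.congr_hom (congrArg (fun φ => φ.app X)
    (Limits.kernel.lift_ι S.g S.f S.zero)) x

/-- Over open sets that are not small all three presheaves vanish, so nothing has to be checked
there. -/
theorem LocalHom.ShortExact.shortExact_presheaf {M N P : SuperPresheaf n m} {f : M.LocalHom N}
    {g : N.LocalHom P} (h : f.ShortExact g) :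
    ∃ w, (ShortComplex.mk f.small.presheafMap g.small.presheafMap w).ShortExact := by
  have hzero : ∀ {Q : SuperPresheaf n m} {U : Opens (projSpace n)}, ¬ IsSmall U →
      ∀ s t : Q.small.obj U, s = t := fun hU s t =>
    Subtype.ext ((s.2.resolve_left hU).trans (t.2.resolve_left hU).symm)
  have w : f.small.presheafMap ≫ g.small.presheafMap = 0 := by
    ext U s
    let s' : M.small.obj U.unop := s
    change (g.small.app (f.small.app s') : P.small.obj U.unop) = 0
    by_cases hU : IsSmall U.unop
    · refine Subtype.ext ?_
      rw [g.small_app hU, f.small_app hU]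
      exact (h.exact hU).apply_apply_eq_zero _
    · exact hzero hU _ _
  refine ⟨w, PresheafOfModules.shortExact_of_sections ?_ ?_ ?_⟩
  · intro X (s : M.small.obj X.unop) (t : M.small.obj X.unop) hst
    by_cases hU : IsSmall X.unop
    · refine Subtype.ext (h.injective hU ?_)
      rw [← f.small_app hU, ← f.small_app hU]
      exact congrArg Subtype.val hst
    · exact hzero hU _ _
  · intro X (s : P.small.obj X.unop)
    by_cases hU : IsSmall X.unop
    · obtain ⟨t, ht⟩ := h.surjective hU s.1
      exact ⟨(⟨t, Or.inl hU⟩ : N.small.obj X.unop), Subtype.ext ((g.small_app hU _).trans ht)⟩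
    · exact ⟨(0 : N.small.obj X.unop), hzero hU _ _⟩
  · intro X (s : N.small.obj X.unop) hs
    by_cases hU : IsSmall X.unop
    · have h0 : g.app hU s.1 = 0 := (g.small_app hU s).symm.trans (congrArg Subtype.val hs)
      obtain ⟨t, ht⟩ := (h.exact hU s.1).1 h0
      exact ⟨(⟨t, Or.inl hU⟩ : M.small.obj X.unop), Subtype.ext ((f.small_app hU _).trans ht)⟩
    · exact ⟨(0 : M.small.obj X.unop), hzero hU _ _⟩

/-- Sheafification is exact, and the isomorphisms `smallIncl` carry the result to the original
sheaves. The isomorphism `e` allows the middle term to be exchanged; the version for abelian sheaves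
is the one that cohomology uses. -/
theorem LocalHom.ShortExact.shortExact_sheaf {M N P : SuperPresheaf n m} {f : M.LocalHom N}
    {g : N.LocalHom P} (h : f.ShortExact g) {N' : SuperPresheaf n m} (e : N.sheaf ≅ N'.sheaf) :
    ∃ w, (ShortComplex.mk (f.sheafMap ≫ e.hom) (e.inv ≫ g.sheafMap) w).ShortExact ∧
      ((ShortComplex.mk (f.sheafMap ≫ e.hom) (e.inv ≫ g.sheafMap) w).map
        (SheafOfModules.toSheaf (sheafO n m))).ShortExact := by
  obtain ⟨w, hw⟩ := h.shortExact_presheaf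
  let G := PresheafOfModules.sheafification (𝟙 (sheafO n m).obj)
  let T := SheafOfModules.toSheaf (sheafO n m)
  have h1 : ((ShortComplex.mk _ _ w).map G).ShortExact := hw.map_of_exact G
  have h2 : f.small.sheafMap ≫ g.small.sheafMap = 0 := ((ShortComplex.mk _ _ w).map G).zero
  have h3 : (ShortComplex.mk f.small.sheafMap g.small.sheafMap h2).ShortExact := h1
  -- For abelian sheaves the order of the functors is changed: the module structure is forgotten on
  -- presheaves and the abelian sheafification is applied afterwards, both being exact.
  have h4 : ((ShortComplex.mk f.small.sheafMap g.small.sheafMap h2).map T).ShortExact := by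
    have : ((ShortComplex.mk _ _ w).map (PresheafOfModules.toPresheaf _ ⋙
      presheafToSheaf (Opens.grothendieckTopology (projSpace n)) AddCommGrpCat.{0})).ShortExact :=
      hw.map_of_exact _
    exact this
  have w' : (f.sheafMap ≫ e.hom) ≫ (e.inv ≫ g.sheafMap) = 0 := by
    rw [Category.assoc, e.hom_inv_id_assoc, ← cancel_epi M.smallIncl.sheafMap,
      ← Category.assoc, f.smallIncl_sheafMap, Category.assoc, g.smallIncl_sheafMap,
      ← Category.assoc, h2, Limits.zero_comp, Limits.comp_zero]
  let iso : ShortComplex.mk f.small.sheafMap g.small.sheafMap h2 ≅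
      ShortComplex.mk (f.sheafMap ≫ e.hom) (e.inv ≫ g.sheafMap) w' :=
    ShortComplex.isoMk (asIso M.smallIncl.sheafMap) (asIso N.smallIncl.sheafMap ≪≫ e)
      (asIso P.smallIncl.sheafMap)
      (by
        change M.smallIncl.sheafMap ≫ f.sheafMap ≫ e.hom =
          f.small.sheafMap ≫ N.smallIncl.sheafMap ≫ e.hom
        rw [← Category.assoc, f.smallIncl_sheafMap, Category.assoc])
      (by
        change (N.smallIncl.sheafMap ≫ e.hom) ≫ e.inv ≫ g.sheafMap =
          g.small.sheafMap ≫ P.smallIncl.sheafMap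
        rw [Category.assoc, e.hom_inv_id_assoc, g.smallIncl_sheafMap])
  exact ⟨w', ShortComplex.shortExact_of_iso iso h3,
    ShortComplex.shortExact_of_iso (T.mapShortComplex.mapIso iso) h4⟩

/-- The long exact cohomology sequence. -/
theorem exists_isLongExact {M N P : SuperPresheaf n m} {f : M.sheaf ⟶ N.sheaf}
    {g : N.sheaf ⟶ P.sheaf} {w : f ≫ g = 0}
    (h : ((ShortComplex.mk f g w).map (SheafOfModules.toSheaf (sheafO n m))).ShortExact) :
    ∃ δ : ∀ q : ℕ, H q P →+ H (q + 1) M, IsLongExact f g δ := by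
  have hf : Mono (toAb f) := h.mono_f
  let X := (constantSheaf (Opens.grothendieckTopology (projSpace n)) AddCommGrpCat.{0}).obj
    (AddCommGrpCat.of (ULift ℤ))
  -- Cohomology is `Ext` out of the constant sheaf `X`, and `δ` is the product with the extension
  -- class `E`. The listed properties are all that is used of `E`: its products with the two maps
  -- vanish, the sequence is exact on both sides of `δ`, and the class is natural.
  obtain ⟨E, hgE, hEf, hE1, hE3, hEn⟩ : ∃ E : Abelian.Ext P.sheafAb M.sheafAb 1,
      (Abelian.Ext.mk₀ (toAb g)).comp E (zero_add 1) = 0 ∧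
      E.comp (Abelian.Ext.mk₀ (toAb f)) (add_zero 1) = 0 ∧
      (∀ (q : ℕ) (x : Abelian.Ext X M.sheafAb (q + 1)),
        x.comp (Abelian.Ext.mk₀ (toAb f)) (add_zero _) = 0 →
          ∃ y : Abelian.Ext X P.sheafAb q, y.comp E rfl = x) ∧
      (∀ (q : ℕ) (x : Abelian.Ext X P.sheafAb q), x.comp E rfl = 0 →
        ∃ y : Abelian.Ext X N.sheafAb q, y.comp (Abelian.Ext.mk₀ (toAb g)) (add_zero _) = x) ∧
      ∀ (u : M.sheafAb ⟶ M.sheafAb) (v : N.sheafAb ⟶ N.sheafAb) (w : P.sheafAb ⟶ P.sheafAb),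
        u ≫ toAb f = toAb f ≫ v → v ≫ toAb g = toAb g ≫ w →
        E.comp (Abelian.Ext.mk₀ u) (add_zero 1) = (Abelian.Ext.mk₀ w).comp E (zero_add 1) :=
    ⟨h.extClass, h.comp_extClass, h.extClass_comp,
      fun _ x hx => Abelian.Ext.covariant_sequence_exact₁ X h x hx rfl,
      fun _ x hx => Abelian.Ext.covariant_sequence_exact₃ X h x rfl hx,
      fun u v w huv hvw => h.extClass_naturality h ⟨u, v, w, huv, hvw⟩⟩
  refine ⟨fun q => E.postcomp _ rfl,
    Abelian.Ext.postcomp_mk₀_injective_of_mono _ (toAb f), fun q x => ⟨?_, ?_⟩,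
    fun q x => ⟨hE3 q x, ?_⟩, fun q x => ⟨hE1 q x, ?_⟩, fun u v w' huv hvw q x => ?_⟩
  · exact fun hx => Abelian.Ext.covariant_sequence_exact₂ _ h x hx
  · rintro ⟨y, rfl⟩
    change (Abelian.Ext.comp y (Abelian.Ext.mk₀ (toAb f)) (add_zero q)).comp
      (Abelian.Ext.mk₀ (toAb g)) (add_zero q) = 0
    rw [Abelian.Ext.comp_assoc_of_third_deg_zero, Abelian.Ext.mk₀_comp_mk₀,
      ← Functor.map_comp, w, Functor.map_zero, Abelian.Ext.mk₀_zero, Abelian.Ext.comp_zero]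
  · rintro ⟨y, rfl⟩
    change (Abelian.Ext.comp y (Abelian.Ext.mk₀ (toAb g)) (add_zero q)).comp E rfl = 0
    rw [Abelian.Ext.comp_assoc_of_second_deg_zero, hgE, Abelian.Ext.comp_zero]
  · rintro ⟨y, rfl⟩
    change (Abelian.Ext.comp y E rfl).comp (Abelian.Ext.mk₀ (toAb f)) (add_zero _) = 0
    rw [Abelian.Ext.comp_assoc_of_third_deg_zero, hEf, Abelian.Ext.comp_zero]
  · change (Abelian.Ext.comp x (Abelian.Ext.mk₀ w') (add_zero q)).comp E rfl =
      (Abelian.Ext.comp x E rfl).comp (Abelian.Ext.mk₀ u) (add_zero _)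
    rw [Abelian.Ext.comp_assoc_of_second_deg_zero, Abelian.Ext.comp_assoc_of_third_deg_zero,
      hEn u v w' huv hvw]

/-- A bijective local morphism is an isomorphism of associated sheaves. -/
theorem LocalHom.isIso_sheafMap {M N : SuperPresheaf n m} (f : M.LocalHom N)
    (hf : ∀ {U} (hU : IsSmall U), Function.Bijective (f.app hU)) : IsIso f.sheafMap := by
  let e {U} (hU : IsSmall U) := LinearEquiv.ofBijective (f.app hU) (hf hU)
  let g : N.LocalHom M :=
    { app := fun hU => (e hU).symm.toLinearMap
      app_par := fun hU s => by
        apply (e hU).injective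
        change e hU ((e hU).symm _) = f.app hU (M.par _)
        rw [LinearEquiv.apply_symm_apply, f.app_par]
        exact congrArg N.par ((e hU).apply_symm_apply s).symm
      app_res := fun h hU s => by
        apply (e (hU.mono h)).injective
        change e (hU.mono h) ((e (hU.mono h)).symm _) = f.app (hU.mono h) (M.res h _)
        rw [LinearEquiv.apply_symm_apply, f.app_res h hU]
        exact congrArg (N.res h) ((e hU).apply_symm_apply s).symm }
  refine ⟨g.sheafMap, hom_ext_of_small fun U hU s => ?_, hom_ext_of_small fun U hU s => ?_⟩
  · rw [onSections_comp, f.onSections_sec hU, g.onSections_sec hU, onSections_id]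
    exact congrArg (sec M) ((e hU).symm_apply_apply s)
  · rw [onSections_comp, g.onSections_sec hU, f.onSections_sec hU, onSections_id]
    exact congrArg (sec N) ((e hU).apply_symm_apply s)

end SuperPresheaf
end SuperProj
end

noncomputable section
namespace SuperProj

/-! ### Contraction of supersymmetric powers -/

section contraction

variable {A M : Type} [Ring A] [Algebra ℂ A] [AddCommGroup M] [Module ℂ M] [Module A M]
  {σ : A →ₐ[ℂ] A} {P : M →ₗ[ℂ] M}

/-- The exponents differ by `2p`. This sign appears when `p s`, of parity `q + 1`, passes the parity
conjugate of a scalar. -/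
theorem neg_one_pow_add_mul (p q : ℕ) :
    (-1 : ℂ) ^ p * (-1 : ℂ) ^ ((q + 1) * p) = (-1) ^ (p * q) := by
  have h : p + (q + 1) * p = p * q + 2 * p := by ring
  rw [← pow_add, h, pow_add, pow_mul _ 2, neg_one_sq, one_pow, mul_one]

namespace SymAlg

theorem induction {C : SymAlg σ P → Prop} (hcoeff : ∀ a, C (coeff σ P a))
    (hgen : ∀ s, C (gen σ P s)) (hadd : ∀ x y, C x → C y → C (x + y))
    (hmul : ∀ x y, C x → C y → C (x * y)) (x : SymAlg σ P) : C x := by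
  obtain ⟨x, rfl⟩ : ∃ y, mk σ P y = x := RingQuot.mkAlgHom_surjective ℂ _ x
  induction x using TensorAlgebra.induction with
  | algebraMap r =>
    have h := hcoeff (algebraMap ℂ A r)
    rw [AlgHom.commutes] at h
    rw [AlgHom.commutes]
    exact h
  | ι x =>
    have hx : x = (x.1, 0) + (0, x.2) := by simp
    rw [hx, map_add, map_add]
    exact hadd _ _ (hcoeff _) (hgen _)
  | mul x y hx hy => rw [map_mul]; exact hmul _ _ hx hy
  | add x y hx hy => rw [map_add]; exact hadd _ _ hx hy

end SymAlg

variable (σ P) in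
/-- `M` is a supermodule over the supercommutative algebra `A`. -/
structure IsSuperModule : Prop where
  comm : ∀ (i j : ℕ) (a b : A), σ a = (-1 : ℂ) ^ i • a → σ b = (-1 : ℂ) ^ j • b →
    a * b = (-1 : ℂ) ^ (i * j) • (b * a)
  par_coeff : ∀ a, σ (σ a) = a
  par_par : ∀ s, P (P s) = s
  par_smul : ∀ (a : A) (s : M), P (a • s) = σ a • P s

variable (σ P) in
/-- `p : M → ΠA` is an even linear map on a supermodule over the supercommutative algebra `A`. -/
structure IsContractible (p : M →ₗ[ℂ] A) : Prop extends IsSuperModule σ P where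
  map_smul : ∀ (a : A) (s : M), p (a • s) = a * p s
  map_par : ∀ s, p (P s) = -σ (p s)

/-- The zero contraction makes the commutation rules proved for contractible maps available on any
supermodule. -/
theorem IsSuperModule.contractible_zero (h : IsSuperModule σ P) : IsContractible σ P 0 :=
  ⟨h, fun _ _ => by simp, fun _ => by simp⟩

variable {p : M →ₗ[ℂ] A}

/-- The map is even with values in `ΠA`, hence reverses the parity when the values are regarded in
`A`. -/
theorem IsContractible.parity (h : IsContractible σ P p) {q : ℕ} {s : M}
    (hs : P s = (-1 : ℂ) ^ q • s) : σ (p s) = (-1 : ℂ) ^ (q + 1) • p s := by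
  rw [pow_succ, mul_neg_one, neg_smul, ← _root_.map_smul, ← hs, h.map_par, neg_neg]

/-- The value of the contraction on generators, as a matrix. -/
def contractMatrix (σ : A →ₐ[ℂ] A) (P : M →ₗ[ℂ] M) (p : M →ₗ[ℂ] A) :
    A × M →ₗ[ℂ] Matrix (Fin 2) (Fin 2) (SymAlg σ P) where
  toFun x := !![SymAlg.coeff σ P x.1 + SymAlg.gen σ P x.2, SymAlg.coeff σ P (p x.2);
    0, SymAlg.coeff σ P (σ x.1) + SymAlg.gen σ P (P x.2)]
  map_add' x y := by
    ext i j; fin_cases i <;> fin_cases j <;> simp [add_add_add_comm]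
  map_smul' c x := by
    ext i j; fin_cases i <;> fin_cases j <;> simp

theorem contractMatrix_coeff (a : A) : contractMatrix σ P p (a, 0) =
    !![SymAlg.coeff σ P a, 0; 0, SymAlg.coeff σ P (σ a)] := by
  simp [contractMatrix]

theorem contractMatrix_gen (s : M) : contractMatrix σ P p (0, s) =
    !![SymAlg.gen σ P s, SymAlg.coeff σ P (p s); 0, SymAlg.gen σ P (P s)] := by
  simp [contractMatrix]

/-- On the diagonal stand the identity and the parity involution, which respect the relations. The
corner entry is where the sign rule for a right superderivation is checked. -/
theorem contractMatrix_rel (h : IsContractible σ P p) {x y : TensorAlgebra ℂ (A × M)}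
    (hxy : SymRel σ P x y) : TensorAlgebra.lift ℂ (contractMatrix σ P p) x =
      TensorAlgebra.lift ℂ (contractMatrix σ P p) y := by
  induction hxy with
  | one =>
    rw [TensorAlgebra.lift_ι_apply, contractMatrix_coeff]
    simp [Matrix.one_fin_two]
  | mul a b =>
    rw [map_mul]
    simp only [TensorAlgebra.lift_ι_apply, contractMatrix_coeff]
    simp
  | smul a s =>
    rw [map_mul]
    simp only [TensorAlgebra.lift_ι_apply, contractMatrix_coeff, contractMatrix_gen]
    simp [h.map_smul, h.par_smul, SymAlg.gen_smul, SymAlg.smul_def]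
  | comm_scalar i q a s ha hs =>
    rw [map_smul, map_mul, map_mul]
    simp only [TensorAlgebra.lift_ι_apply, contractMatrix_coeff, contractMatrix_gen]
    have h1 := SymAlg.gen_coeff σ P ha hs
    have h2 : SymAlg.coeff σ P (p s) * SymAlg.coeff σ P (σ a) =
        (-1 : ℂ) ^ (i * q) • (SymAlg.coeff σ P a * SymAlg.coeff σ P (p s)) := by
      rw [ha, map_smul, mul_smul_comm, ← map_mul, ← map_mul,
        h.comm _ _ _ _ (h.parity hs) ha, map_smul, smul_smul, neg_one_pow_add_mul]
    have h3 := SymAlg.gen_coeff σ P (a := σ a) (s := P s) (by rw [ha, map_smul, ha])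
      (by rw [hs, map_smul, hs])
    simp only [Matrix.mul_fin_two, mul_zero, zero_mul, add_zero, zero_add, h1, h2, h3]
    ext u v; fin_cases u <;> fin_cases v <;> simp
  | comm i q s t hs ht =>
    rw [map_smul, map_mul, map_mul]
    simp only [TensorAlgebra.lift_ι_apply, contractMatrix_gen]
    have h1 := SymAlg.gen_gen σ P hs ht
    -- The corner of a product of two generators is a sum of two terms. Interchanging the generators
    -- swaps these terms, each with the sign `(-1)^{iq}`, as `h2` and `h3` show.
    have h2 : SymAlg.gen σ P s * SymAlg.coeff σ P (p t) =
        (-1 : ℂ) ^ (i * q) • (SymAlg.coeff σ P (p t) * SymAlg.gen σ P (P s)) := by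
      rw [SymAlg.gen_coeff σ P (h.parity ht) hs, hs, map_smul, mul_smul_comm, smul_smul]
      congr 1
      rw [← pow_add, show (q + 1) * i = i * q + i by ring]
    have h3 : SymAlg.coeff σ P (p s) * SymAlg.gen σ P (P t) =
        (-1 : ℂ) ^ (i * q) • (SymAlg.gen σ P t * SymAlg.coeff σ P (p s)) := by
      rw [SymAlg.gen_coeff σ P (h.parity hs) ht, ht, map_smul, mul_smul_comm, smul_smul]
      congr 1
      rw [← pow_add, show i * q + (i + 1) * q = q + 2 * (i * q) by ring, pow_add _ q,
        pow_mul _ 2, neg_one_sq, one_pow, mul_one]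
    have h4 := SymAlg.gen_gen σ P (s := P s) (t := P t) (by rw [hs, map_smul, hs])
      (by rw [ht, map_smul, ht])
    simp only [Matrix.mul_fin_two, mul_zero, zero_mul, add_zero, zero_add, h1, h2, h3, h4]
    ext u v; fin_cases u <;> fin_cases v <;> simp [add_comm]

/-- The algebra map `x ↦ [[x, d x], [0, x̄]]` that encodes the contraction `d`. -/
def contractHom (h : IsContractible σ P p) :
    SymAlg σ P →ₐ[ℂ] Matrix (Fin 2) (Fin 2) (SymAlg σ P) :=
  RingQuot.liftAlgHom ℂ ⟨TensorAlgebra.lift ℂ (contractMatrix σ P p),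
    fun _ _ hxy => contractMatrix_rel h hxy⟩

theorem contractHom_coeff (h : IsContractible σ P p) (a : A) :
    contractHom h (SymAlg.coeff σ P a) =
      !![SymAlg.coeff σ P a, 0; 0, SymAlg.coeff σ P (σ a)] := by
  refine (RingQuot.liftAlgHom_mkAlgHom_apply _ _ _ _).trans ?_
  rw [← contractMatrix_coeff (p := p)]
  exact TensorAlgebra.lift_ι_apply _ _

theorem contractHom_gen (h : IsContractible σ P p) (s : M) :
    contractHom h (SymAlg.gen σ P s) =
      !![SymAlg.gen σ P s, SymAlg.coeff σ P (p s); 0, SymAlg.gen σ P (P s)] := by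
  refine (RingQuot.liftAlgHom_mkAlgHom_apply _ _ _ _).trans ?_
  rw [← contractMatrix_gen]
  exact TensorAlgebra.lift_ι_apply _ _

/-- The parity involution of the supersymmetric algebra. -/
def IsContractible.inv (h : IsContractible σ P p) : SymAlg σ P →ₐ[ℂ] SymAlg σ P :=
  SymAlg.map σ P (fun _ => rfl) (fun _ => rfl) h.par_smul

namespace IsContractible

variable (h : IsContractible σ P p)

theorem inv_coeff (a : A) : h.inv (SymAlg.coeff σ P a) = SymAlg.coeff σ P (σ a) :=
  SymAlg.map_coeff _ _ _ _ _ a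

theorem inv_gen (s : M) : h.inv (SymAlg.gen σ P s) = SymAlg.gen σ P (P s) :=
  SymAlg.map_gen _ _ _ _ _ s

theorem inv_inv (x : SymAlg σ P) : h.inv (h.inv x) = x := by
  induction x using SymAlg.induction with
  | hcoeff a => rw [inv_coeff, inv_coeff, h.par_coeff]
  | hgen s => rw [inv_gen, inv_gen, h.par_par]
  | hadd x y hx hy => rw [map_add, map_add, hx, hy]
  | hmul x y hx hy => rw [map_mul, map_mul, hx, hy]

/-- For triangular matrices the diagonal entries are multiplicative, so it is enough to look at
scalars and generators. -/
theorem contractHom_eq (x : SymAlg σ P) : contractHom h x 0 0 = x ∧ contractHom h x 1 0 = 0 ∧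
    contractHom h x 1 1 = h.inv x := by
  induction x using SymAlg.induction with
  | hcoeff a => simp [contractHom_coeff, inv_coeff]
  | hgen s => simp [contractHom_gen, inv_gen]
  | hadd x y hx hy => simp [hx, hy]
  | hmul x y hx hy => simp [Matrix.mul_apply, hx, hy]

/-- The contraction of the supersymmetric algebra with `p`: the right superderivation that is zero
on `A` and `p` on `M`. -/
def contract : SymAlg σ P →ₗ[ℂ] SymAlg σ P where
  toFun x := contractHom h x 0 1
  map_add' x y := by simp
  map_smul' c x := by simp

/-- This is the corner entry of a product of two triangular matrices. -/
theorem contract_mul (x y : SymAlg σ P) :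
    h.contract (x * y) = x * h.contract y + h.contract x * h.inv y := by
  change contractHom h (x * y) 0 1 = _
  rw [map_mul, Matrix.mul_apply, Fin.sum_univ_two, (h.contractHom_eq x).1,
    (h.contractHom_eq y).2.2]
  rfl

theorem contract_coeff (a : A) : h.contract (SymAlg.coeff σ P a) = 0 := by
  change contractHom h _ 0 1 = 0
  rw [contractHom_coeff]; rfl

theorem contract_gen (s : M) : h.contract (SymAlg.gen σ P s) = SymAlg.coeff σ P (p s) := by
  change contractHom h _ 0 1 = _
  rw [contractHom_gen]; rfl

theorem contract_one : h.contract 1 = 0 := by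
  rw [← map_one (SymAlg.coeff σ P), contract_coeff]

theorem contract_mon_eq_zero {k : ℕ} (v : Fin k → M) (hv : ∀ j, p (v j) = 0) :
    h.contract (SymAlg.mon σ P v) = 0 := by
  induction k with
  | zero => exact h.contract_one
  | succ k ih =>
    have : SymAlg.mon σ P v = SymAlg.gen σ P (v 0) * SymAlg.mon σ P (fun j => v j.succ) := by
      simp [SymAlg.mon, List.ofFn_succ]
    rw [this, h.contract_mul, h.contract_gen, hv, map_zero, zero_mul, add_zero,
      ih _ fun j => hv j.succ, mul_zero]

theorem contract_smul (a : A) (x : SymAlg σ P) : h.contract (a • x) = a • h.contract x := by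
  rw [SymAlg.smul_def, contract_mul, contract_coeff, zero_mul, add_zero, SymAlg.smul_def]

/-- The contraction is odd because `p`, as a map into `A`, is odd. -/
theorem contract_inv (x : SymAlg σ P) : h.contract (h.inv x) = -h.inv (h.contract x) := by
  induction x using SymAlg.induction with
  | hcoeff a => rw [inv_coeff, contract_coeff, contract_coeff, map_zero, neg_zero]
  | hgen s => rw [inv_gen, contract_gen, contract_gen, inv_coeff, h.map_par, map_neg]
  | hadd x y hx hy => simp only [map_add, hx, hy, neg_add]
  | hmul x y hx hy =>
    rw [map_mul, contract_mul, contract_mul, hx, hy, map_add, map_mul, map_mul, mul_neg, neg_mul,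
      neg_add]

/-- On generators the contraction is a scalar, which is killed next. In a product the two mixed
terms cancel since the contraction anticommutes with the parity involution. -/
theorem contract_contract (x : SymAlg σ P) : h.contract (h.contract x) = 0 := by
  induction x using SymAlg.induction with
  | hcoeff a => rw [contract_coeff, map_zero]
  | hgen s => rw [contract_gen, contract_coeff]
  | hadd x y hx hy => rw [map_add, map_add, hx, hy, add_zero]
  | hmul x y hx hy =>
    rw [contract_mul, map_add, contract_mul, contract_mul, hx, hy, contract_inv]
    simp

-- The commutation relations are imposed on homogeneous elements only; this form for arbitrary ones
-- results from splitting `a` and `s` into even and odd parts.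
include h in
theorem gen_mul_coeff (a : A) (s : M) : SymAlg.gen σ P s * SymAlg.coeff σ P a =
    (2 : ℂ)⁻¹ • ((a + σ a) • SymAlg.gen σ P s + (a - σ a) • SymAlg.gen σ P (P s)) := by
  have e0 : σ (a + σ a) = (-1 : ℂ) ^ 0 • (a + σ a) := by
    rw [map_add, h.par_coeff, pow_zero, one_smul, add_comm]
  have e1 : σ (a - σ a) = (-1 : ℂ) ^ 1 • (a - σ a) := by
    rw [map_sub, h.par_coeff, pow_one, neg_one_smul, neg_sub]
  have f0 : P (s + P s) = (-1 : ℂ) ^ 0 • (s + P s) := by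
    rw [map_add, h.par_par, pow_zero, one_smul, add_comm]
  have f1 : P (s - P s) = (-1 : ℂ) ^ 1 • (s - P s) := by
    rw [map_sub, h.par_par, pow_one, neg_one_smul, neg_sub]
  have g00 := SymAlg.gen_coeff σ P e0 f0
  have g01 := SymAlg.gen_coeff σ P e0 f1
  have g10 := SymAlg.gen_coeff σ P e1 f0
  have g11 := SymAlg.gen_coeff σ P e1 f1
  simp only [mul_zero, mul_one, pow_zero, pow_one, one_smul, neg_one_smul, map_add,
    map_sub] at g00 g01 g10 g11
  simp only [SymAlg.smul_def, map_add, map_sub]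
  clear e0 e1 f0 f1
  generalize SymAlg.gen σ P s = s0 at *
  generalize SymAlg.gen σ P (P s) = s1 at *
  generalize SymAlg.coeff σ P a = a0 at *
  generalize SymAlg.coeff σ P (σ a) = a1 at *
  have key : (4 : ℂ) • (s0 * a0) = (2 : ℂ) • ((a0 + a1) * s0 + (a0 - a1) * s1) := by
    have e1 : (4 : ℂ) • (s0 * a0) = (s0 + s1) * (a0 + a1) + (s0 - s1) * (a0 + a1) +
        (s0 + s1) * (a0 - a1) + (s0 - s1) * (a0 - a1) := by
      rw [show (4 : ℂ) = 2 + 2 by norm_num, add_smul, two_smul]; noncomm_ring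
    rw [e1, g00, g01, g10, g11, two_smul]; noncomm_ring
  refine smul_right_injective _ (by norm_num : (4 : ℂ) ≠ 0) ?_
  simp only
  rw [key, smul_smul]; norm_num

theorem one_mem : (1 : SymAlg σ P) ∈ SymAlg.pow σ P 0 := Submodule.subset_span ⟨Fin.elim0, rfl⟩

-- `SymAlg.pow` is a left span, so a generator multiplied from the left has to be carried past the
-- scalars. This may turn `s` into `P s`, which is why the statement is proved for all `s` at once.
include h in
theorem gen_mul_mem {k : ℕ} {x : SymAlg σ P} (hx : x ∈ SymAlg.pow σ P k) :
    ∀ s, SymAlg.gen σ P s * x ∈ SymAlg.pow σ P (k + 1) := by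
  induction hx using Submodule.span_induction with
  | mem x hx =>
    obtain ⟨v, rfl⟩ := hx
    intro s
    refine Submodule.subset_span ⟨Fin.cons s v, ?_⟩
    simp [SymAlg.mon, List.ofFn_succ]
  | zero => intro s; rw [mul_zero]; exact zero_mem _
  | add x y _ _ hx hy => intro s; rw [mul_add]; exact add_mem (hx s) (hy s)
  | smul a x _ hx =>
    intro s
    rw [SymAlg.smul_def, ← mul_assoc, h.gen_mul_coeff, smul_mul_assoc, add_mul]
    simp only [SymAlg.smul_def, mul_assoc]
    have e : ∀ b y, SymAlg.coeff σ P b * y = b • y := fun _ _ => rfl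
    have e2 : ∀ (c : ℂ) (y : SymAlg σ P), c • y = (algebraMap ℂ A c) • y := fun c y => by
      rw [Algebra.algebraMap_eq_smul_one, smul_assoc, one_smul]
    rw [e, e, e2]
    exact Submodule.smul_mem _ _ (add_mem (Submodule.smul_mem _ _ (hx _))
      (Submodule.smul_mem _ _ (hx _)))

theorem inv_mem {k : ℕ} {x : SymAlg σ P} (hx : x ∈ SymAlg.pow σ P k) :
    h.inv x ∈ SymAlg.pow σ P k := SymAlg.map_mem _ _ _ _ _ hx

theorem contract_mem {k : ℕ} {x : SymAlg σ P} (hx : x ∈ SymAlg.pow σ P (k + 1)) :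
    h.contract x ∈ SymAlg.pow σ P k := by
  have key : ∀ (k : ℕ) (v : Fin (k + 1) → M), h.contract (SymAlg.mon σ P v) ∈ SymAlg.pow σ P k := by
    intro k
    induction k with
    | zero =>
      intro v
      have : SymAlg.mon σ P v = SymAlg.gen σ P (v 0) := by simp [SymAlg.mon]
      rw [this, contract_gen, ← mul_one (SymAlg.coeff σ P _)]
      exact Submodule.smul_mem _ _ one_mem
    | succ k ih =>
      intro v
      have : SymAlg.mon σ P v = SymAlg.gen σ P (v 0) * SymAlg.mon σ P (fun j => v j.succ) := by
        simp [SymAlg.mon, List.ofFn_succ]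
      rw [this, contract_mul, contract_gen]
      refine add_mem (h.gen_mul_mem (ih _) _) (Submodule.smul_mem _ _ (h.inv_mem ?_))
      exact Submodule.subset_span ⟨_, rfl⟩
  induction hx using Submodule.span_induction with
  | mem x hx => obtain ⟨v, rfl⟩ := hx; exact key k v
  | zero => rw [map_zero]; exact zero_mem _
  | add x y _ _ hx hy => rw [map_add]; exact add_mem hx hy
  | smul a x _ hx => rw [contract_smul]; exact Submodule.smul_mem _ _ hx

/-- On even elements `e` commutes and on odd ones it anticommutes, and both rules are compatible
with products. -/
theorem gen_odd_comm {e : M} (he : P e = -e) (x : SymAlg σ P) :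
    SymAlg.gen σ P e * x = h.inv x * SymAlg.gen σ P e := by
  have he1 : P e = (-1 : ℂ) ^ 1 • e := by rw [he, pow_one, neg_one_smul]
  induction x using SymAlg.induction with
  | hcoeff a =>
    rw [h.gen_mul_coeff, inv_coeff, he, map_neg, smul_neg, ← sub_eq_add_neg, ← sub_smul]
    rw [show a + σ a - (a - σ a) = (2 : ℂ) • σ a by rw [two_smul]; abel, smul_assoc, smul_smul,
      inv_mul_cancel₀ two_ne_zero, one_smul]
    rfl
  | hgen s =>
    rw [inv_gen]
    have f0 : P (s + P s) = (-1 : ℂ) ^ 0 • (s + P s) := by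
      rw [map_add, h.par_par, pow_zero, one_smul, add_comm]
    have f1 : P (s - P s) = (-1 : ℂ) ^ 1 • (s - P s) := by
      rw [map_sub, h.par_par, pow_one, neg_one_smul, neg_sub]
    have g0 := SymAlg.gen_gen σ P he1 f0
    have g1 := SymAlg.gen_gen σ P he1 f1
    simp only [mul_zero, mul_one, pow_zero, pow_one, one_smul, neg_one_smul, map_add, map_sub]
      at g0 g1
    have key := congrArg₂ (· + ·) g0 g1
    refine smul_right_injective _ (two_ne_zero : (2 : ℂ) ≠ 0) ?_
    simp only [two_smul]
    calc _ = _ := ?_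
      _ = _ := key
      _ = _ := ?_
    · noncomm_ring
    · noncomm_ring
  | hadd x y hx hy => rw [mul_add, hx, hy, map_add, add_mul]
  | hmul x y hx hy => rw [← mul_assoc, hx, mul_assoc, hy, map_mul, mul_assoc]

-- An odd element anticommutes with itself, and `2` is invertible.
include h in
theorem gen_odd_sq {e : M} (he : P e = -e) : SymAlg.gen σ P e * SymAlg.gen σ P e = 0 := by
  have h1 := h.gen_odd_comm he (SymAlg.gen σ P e)
  rw [inv_gen, he, map_neg, neg_mul] at h1
  refine smul_right_injective _ (two_ne_zero : (2 : ℂ) ≠ 0) ?_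
  simp only [two_smul, smul_zero]
  exact eq_neg_iff_add_eq_zero.1 h1

/-- The contraction `Sym^{k+1} M → Sym^k M`. -/
def contractPow (k : ℕ) : SymPow σ P (k + 1) →ₗ[A] SymPow σ P k where
  toFun x := ⟨h.contract x.1, h.contract_mem x.2⟩
  map_add' x y := Subtype.ext (map_add h.contract x.1 y.1)
  map_smul' a x := Subtype.ext (h.contract_smul a x.1)

/-- Both sides obey the same product rule and agree on generators. The case of a restriction map
makes the contraction a map of presheaves. -/
theorem contract_map {B N : Type} [Ring B] [Algebra ℂ B] [AddCommGroup N] [Module ℂ N]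
    [Module B N] {τ : B →ₐ[ℂ] B} {Q : N →ₗ[ℂ] N} {q : N →ₗ[ℂ] B} (h' : IsContractible τ Q q)
    (φ : A →ₐ[ℂ] B) (f : M →ₗ[ℂ] N) (hφ : ∀ a, φ (σ a) = τ (φ a))
    (hf : ∀ s, f (P s) = Q (f s)) (hs : ∀ (a : A) (s : M), f (a • s) = φ a • f s)
    (hp : ∀ s, q (f s) = φ (p s)) (x : SymAlg σ P) :
    h'.contract (SymAlg.map φ f hφ hf hs x) = SymAlg.map φ f hφ hf hs (h.contract x) := by
  induction x using SymAlg.induction with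
  | hcoeff a => rw [SymAlg.map_coeff, contract_coeff, contract_coeff, map_zero]
  | hgen s => rw [SymAlg.map_gen, contract_gen, contract_gen, SymAlg.map_coeff, hp]
  | hadd x y hx hy => simp only [map_add, hx, hy]
  | hmul x y hx hy =>
    have hinv : ∀ y, h'.inv (SymAlg.map φ f hφ hf hs y) = SymAlg.map φ f hφ hf hs (h.inv y) := by
      intro y
      induction y using SymAlg.induction with
      | hcoeff a => rw [inv_coeff, SymAlg.map_coeff, SymAlg.map_coeff, inv_coeff, hφ]
      | hgen s => rw [inv_gen, SymAlg.map_gen, SymAlg.map_gen, inv_gen, hf]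
      | hadd x y hx hy => simp only [map_add, hx, hy]
      | hmul x y hx hy => simp only [map_mul, hx, hy]
    rw [map_mul, contract_mul, contract_mul, hx, hy, map_add, map_mul, map_mul, hinv]

/-! ### Splitting the Koszul sequence with an odd element. -/

section koszul

variable {K : Type} [AddCommGroup K] [Module ℂ K] [Module A K] {Q : K →ₗ[ℂ] K}
  {i : K →ₗ[ℂ] M} {r : M →ₗ[ℂ] K} {e : M}
  (hid : ∀ a, AlgHom.id ℂ A (σ a) = σ (AlgHom.id ℂ A a))
  (hi : ∀ s, i (Q s) = P (i s)) (hi' : ∀ (a : A) s, i (a • s) = AlgHom.id ℂ A a • i s)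
  (hr : ∀ s, r (P s) = Q (r s)) (hr' : ∀ (a : A) s, r (a • s) = AlgHom.id ℂ A a • r s)

theorem contract_map_eq_zero (hpi : ∀ s, p (i s) = 0) (x : SymAlg σ Q) :
    h.contract (SymAlg.map (σ := σ) (τ := σ) (AlgHom.id ℂ A) i hid hi hi' x) = 0 := by
  induction x using SymAlg.induction with
  | hcoeff a => rw [SymAlg.map_coeff, contract_coeff]
  | hgen s => rw [SymAlg.map_gen, contract_gen, hpi, map_zero]
  | hadd x y hx hy => rw [map_add, map_add, hx, hy, add_zero]
  | hmul x y hx hy => rw [map_mul, contract_mul, hx, hy, mul_zero, zero_mul, add_zero]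

/-- When `p e = 1`, the module `M` is the sum of `K` and the span of `e`, and `e² = 0`; so an
element of the supersymmetric algebra is at most linear in `e`, with coefficient its contraction.
The identity holds on generators by the choice of `r` and is multiplicative. -/
theorem eq_map_add_contract (he : P e = -e) (hir : ∀ s, i (r s) = s - p s • e)
    (x : SymAlg σ P) :
    x = SymAlg.map (σ := σ) (τ := σ) (AlgHom.id ℂ A) i hid hi hi'
      (SymAlg.map (σ := σ) (τ := σ) (AlgHom.id ℂ A) r hid hr hr' x) +
      h.contract x * SymAlg.gen σ P e := by
  induction x using SymAlg.induction with
  | hcoeff a =>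
    rw [SymAlg.map_coeff, SymAlg.map_coeff, contract_coeff, zero_mul, add_zero]; rfl
  | hgen s =>
    rw [SymAlg.map_gen, SymAlg.map_gen, contract_gen, hir, map_sub, SymAlg.gen_smul,
      SymAlg.smul_def, sub_add_cancel]
  | hadd x y hx hy =>
    simp only [map_add, add_mul]
    rw [add_add_add_comm, ← hx, ← hy]
  | hmul x y hx hy =>
    rw [map_mul, map_mul, contract_mul, add_mul, mul_assoc, mul_assoc, ← h.gen_odd_comm he]
    have hxe := eq_sub_of_add_eq' hx.symm
    have hye := eq_sub_of_add_eq' hy.symm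
    -- With `x'`, `y'` for the components without `e`, one has `d(x) e = x - x'` and `d(y) e = y -
    -- y'`. The two sides of the claim then differ, up to sign, by `(x - x')(y - y')`, which is a
    -- product of two multiples of `e`.
    have h0 : (h.contract x * SymAlg.gen σ P e) * (h.contract y * SymAlg.gen σ P e) = 0 := by
      rw [mul_assoc, ← mul_assoc (SymAlg.gen σ P e), h.gen_odd_comm he, mul_assoc,
        h.gen_odd_sq he, mul_zero, mul_zero]
    rw [hxe, hye] at h0
    rw [← mul_assoc (h.contract x), hxe, hye]
    generalize SymAlg.map (σ := σ) (τ := σ) (AlgHom.id ℂ A) i hid hi hi'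
      (SymAlg.map (σ := σ) (τ := σ) (AlgHom.id ℂ A) r hid hr hr' x) = x' at *
    generalize SymAlg.map (σ := σ) (τ := σ) (AlgHom.id ℂ A) i hid hi hi'
      (SymAlg.map (σ := σ) (τ := σ) (AlgHom.id ℂ A) r hid hr hr' y) = y' at *
    rw [← sub_eq_zero, ← neg_eq_zero, ← h0]
    noncomm_ring

omit h in
theorem symPowMap_leftInverse (hri : ∀ s, r (i s) = s) (k : ℕ) : Function.LeftInverse
    (SymPow.map (σ := σ) (τ := σ) k (AlgHom.id ℂ A) r hid hr hr')
    (SymPow.map (σ := σ) (τ := σ) k (AlgHom.id ℂ A) i hid hi hi') := fun x => by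
  have h1 := SymPow.map_map_eq (AlgHom.id ℂ A) i hid hi hi' (AlgHom.id ℂ A) r
    hid hr hr' (σ := σ) (τ := σ) (υ := σ) (AlgHom.id ℂ A) LinearMap.id hid
    (fun _ => rfl) (fun _ _ => rfl) (fun _ => rfl) hri x
  exact h1.trans (SymPow.map_eq_self _ _ _ _ _ (fun _ => rfl) (fun _ => rfl) x)

-- If the contraction of `x` vanishes, the decomposition `eq_map_add_contract` has no term with `e`
-- and exhibits `x` as an image. The converse holds because the contraction kills everything that
-- comes from `K`.
include hr hr' in
theorem contractPow_eq_zero_iff (he : P e = -e) (hir : ∀ s, i (r s) = s - p s • e)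
    (hpi : ∀ s, p (i s) = 0) {k : ℕ} (x : SymPow σ P (k + 1)) :
    h.contractPow k x = 0 ↔ ∃ y : SymPow σ Q (k + 1),
      SymPow.map (σ := σ) (τ := σ) (k + 1) (AlgHom.id ℂ A) i hid hi hi' y = x := by
  constructor
  · intro hx
    refine ⟨SymPow.map (σ := σ) (τ := σ) (k + 1) (AlgHom.id ℂ A) r hid hr hr' x, Subtype.ext ?_⟩
    have h0 : h.contract x.1 = 0 := congrArg Subtype.val hx
    have := h.eq_map_add_contract hid hi hi' hr hr' he hir x.1
    rw [h0, zero_mul, add_zero] at this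
    exact this.symm
  · rintro ⟨y, rfl⟩
    exact Subtype.ext (h.contract_map_eq_zero hid hi hi' hpi y.1)

-- The contraction squares to zero, so the decomposition of a contracted element has no term with
-- `e`.
include hr hr' in
theorem exists_map_eq_contractPow (he : P e = -e) (hir : ∀ s, i (r s) = s - p s • e) {k : ℕ}
    (x : SymPow σ P (k + 1)) :
    ∃ y : SymPow σ Q k, SymPow.map (σ := σ) (τ := σ) k (AlgHom.id ℂ A) i hid hi hi' y =
      h.contractPow k x := by
  refine ⟨SymPow.map (σ := σ) (τ := σ) k (AlgHom.id ℂ A) r hid hr hr' (h.contractPow k x),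
    Subtype.ext ?_⟩
  have := h.eq_map_add_contract hid hi hi' hr hr' he hir (h.contract x.1)
  rw [h.contract_contract, zero_mul, add_zero] at this
  exact this.symm

theorem exists_contractPow_eq_map (he : P e = -e) (hpe : p e = 1) (hpi : ∀ s, p (i s) = 0)
    {k : ℕ} (y : SymPow σ Q k) :
    ∃ x : SymPow σ P (k + 1), h.contractPow k x =
      SymPow.map (σ := σ) (τ := σ) k (AlgHom.id ℂ A) i hid hi hi' y := by
  let z : SymPow σ P k := SymPow.map (σ := σ) (τ := σ) k (AlgHom.id ℂ A) i hid hi hi' y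
  -- The preimage is `z e`. Membership in degree `k + 1` is known for products with a generator on
  -- the left, so `e` is moved there, at the cost of conjugating `z` by the parity.
  have hz : z.1 * SymAlg.gen σ P e ∈ SymAlg.pow σ P (k + 1) := by
    have := h.gen_odd_comm he (h.inv z.1)
    rw [h.inv_inv] at this
    rw [← this]
    exact h.gen_mul_mem (h.inv_mem z.2) e
  refine ⟨⟨_, hz⟩, Subtype.ext ?_⟩
  have h0 : h.contract z.1 = 0 := h.contract_map_eq_zero hid hi hi' hpi y.1
  change h.contract (z.1 * SymAlg.gen σ P e) = z.1
  rw [contract_mul, contract_gen, hpe, map_one, mul_one, h0, zero_mul, add_zero]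

end koszul

/-- The contraction acts as a right derivation, so only the term in which the last factor is
contracted survives, and `p f` appears on the right. -/
theorem contractPow_snoc {k : ℕ} (v : Fin k → M) (f : M)
    (hv : h.contract (SymAlg.mon σ P v) = 0) :
    h.contract (SymAlg.mon σ P (Fin.snoc (α := fun _ => M) v f)) =
      SymAlg.mon σ P v * SymAlg.coeff σ P (p f) := by
  have : SymAlg.mon σ P (Fin.snoc (α := fun _ => M) v f) =
      SymAlg.mon σ P v * SymAlg.gen σ P f := by
    rw [SymAlg.mon, List.ofFn_succ', List.concat_eq_append, List.prod_append]
    simp [SymAlg.mon]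
  rw [this, contract_mul, contract_gen, hv, zero_mul, add_zero]

include h in
theorem mul_coeff_even {a : A} (ha : σ a = a) (x : SymAlg σ P) :
    x * SymAlg.coeff σ P a = a • x := by
  have ha0 : σ a = (-1 : ℂ) ^ 0 • a := by rw [ha, pow_zero, one_smul]
  induction x using SymAlg.induction with
  | hcoeff b =>
    rw [SymAlg.smul_def, ← map_mul, ← map_mul]
    congr 1
    have h0 := h.comm 0 0 a (b + σ b) ha0 (by
      rw [map_add, h.par_coeff, pow_zero, one_smul, add_comm])
    have h1 := h.comm 0 1 a (b - σ b) ha0 (by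
      rw [map_sub, h.par_coeff, pow_one, neg_one_smul, neg_sub])
    rw [zero_mul, pow_zero, one_smul] at h0 h1
    refine smul_right_injective _ (two_ne_zero : (2 : ℂ) ≠ 0) ?_
    have key := congrArg₂ (· + ·) h0 h1
    simp only [two_smul]
    calc _ = _ := ?_
      _ = _ := key.symm
      _ = _ := ?_
    · noncomm_ring
    · noncomm_ring
  | hgen s =>
    rw [h.gen_mul_coeff, ha, sub_self, zero_smul, add_zero, ← two_smul ℂ a, smul_assoc, smul_smul,
      inv_mul_cancel₀ two_ne_zero, one_smul]
  | hadd x y hx hy => rw [add_mul, hx, hy, smul_add]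
  | hmul x y hx hy =>
    rw [mul_assoc, hy, SymAlg.smul_def, ← mul_assoc, hx, SymAlg.smul_def, SymAlg.smul_def,
      mul_assoc]

end IsContractible

end contraction

end SuperProj
end

noncomputable section
namespace SuperProj

/-! ### Tensor products with a free module of rank one, and even scalars in monomials. -/

section tensor

variable {A M M' : Type} [Ring A] [Algebra ℂ A] [AddCommGroup M] [Module ℂ M] [Module A M]
  [AddCommGroup M'] [Module ℂ M'] [Module A M'] [IsScalarTower ℂ A M] [IsScalarTower ℂ A M']
  {σ : A →ₐ[ℂ] A} {P : M →ₗ[ℂ] M}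

theorem algebraMap_smul' (c : ℂ) (s : M) : (algebraMap ℂ A c) • s = c • s := by
  rw [Algebra.algebraMap_eq_smul_one, smul_assoc, one_smul]

theorem smul_comm_complex (a : A) (c : ℂ) (s : M) : a • c • s = c • a • s := by
  rw [← algebraMap_smul' (A := A) c s, ← mul_smul, ← Algebra.commutes, mul_smul,
    algebraMap_smul']

theorem add_involution {V : Type} [AddCommGroup V] [Module ℂ V] {P : V →ₗ[ℂ] V}
    (hP : ∀ s, P (P s) = s) (s : V) : P (s + P s) = (-1 : ℂ) ^ 0 • (s + P s) := by
  rw [map_add, hP, pow_zero, one_smul, add_comm]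

theorem sub_involution {V : Type} [AddCommGroup V] [Module ℂ V] {P : V →ₗ[ℂ] V}
    (hP : ∀ s, P (P s) = s) (s : V) : P (s - P s) = (-1 : ℂ) ^ 1 • (s - P s) := by
  rw [map_sub, hP, pow_one, neg_one_smul, neg_sub]

theorem eq_half_add {V : Type} [AddCommGroup V] [Module ℂ V] (s t : V) :
    s = (2⁻¹ : ℂ) • (s + t) + (2⁻¹ : ℂ) • (s - t) := by
  rw [← smul_add, add_add_sub_cancel, ← two_smul ℂ, smul_smul, inv_mul_cancel₀ two_ne_zero,
    one_smul]

/-- A linear property of the elements of a super vector space holds if it holds for the homogeneous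
ones. -/
theorem homogeneous_induction {V : Type} [AddCommGroup V] [Module ℂ V] {P : V →ₗ[ℂ] V}
    (hP : ∀ s, P (P s) = s) {C : V → Prop}
    (hom : ∀ (q : ℕ) (s : V), P s = (-1 : ℂ) ^ q • s → C s)
    (add : ∀ s t, C s → C t → C (s + t)) (s : V) : C s := by
  rw [eq_half_add s (P s)]
  refine add _ _ (hom 0 _ ?_) (hom 1 _ ?_)
  · rw [map_smul, add_involution hP, smul_comm]
  · rw [map_smul, sub_involution hP, smul_comm]

variable (M σ P) in
/-- The right action of `A` on a left supermodule `M`: `s a = (-1)^{|s||a|} a s`. -/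
def rightMul : M →ₗ[ℂ] A →ₗ[ℂ] M :=
  LinearMap.mk₂ ℂ (fun s a => (2⁻¹ : ℂ) • ((a + σ a) • s + (a - σ a) • P s))
    (fun s t a => by simp only [map_add, smul_add]; abel)
    (fun c s a => by
      rw [map_smul, smul_comm_complex, smul_comm_complex, ← smul_add, smul_comm])
    (fun s a b => by
      rw [← smul_add, map_add]; congr 1
      simp only [add_smul, sub_smul]; abel)
    (fun c s a => by
      rw [map_smul, ← smul_add, ← smul_sub, smul_assoc, smul_assoc, ← smul_add, smul_comm])

theorem rightMul_apply (s : M) (a : A) :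
    rightMul M σ P s a = (2⁻¹ : ℂ) • ((a + σ a) • s + (a - σ a) • P s) := rfl

theorem rightMul_of_homogeneous {p q : ℕ} {s : M} {a : A} (ha : σ a = (-1 : ℂ) ^ p • a)
    (hs : P s = (-1 : ℂ) ^ q • s) : rightMul M σ P s a = (-1 : ℂ) ^ (p * q) • a • s := by
  rw [rightMul_apply, hs, mul_comm p q, pow_mul]
  rcases neg_one_pow_eq_or ℂ q with h | h
  · rw [h, one_smul, one_pow, one_smul, ← add_smul, add_add_sub_cancel, ← two_smul ℂ a, smul_assoc,
      smul_smul, inv_mul_cancel₀ two_ne_zero, one_smul]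
  · rw [h, neg_one_smul, smul_neg, ← sub_eq_add_neg, ← sub_smul, add_sub_sub_cancel,
      ← two_smul ℂ (σ a), smul_assoc, smul_smul, inv_mul_cancel₀ two_ne_zero, one_smul, ha,
      smul_assoc]

namespace IsSuperModule

variable (h : IsSuperModule σ P)

-- The left and the right action commute, as in a bimodule: moving `b` past `a` twice contributes no
-- sign. Hence `preContract` is `A`-linear.
include h in
theorem rightMul_smul (a : A) (s : M) (b : A) :
    rightMul M σ P (a • s) b = a • rightMul M σ P s b := by
  induction b using homogeneous_induction (P := σ.toLinearMap) h.par_coeff with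
  | hom r b hb =>
    induction a using homogeneous_induction (P := σ.toLinearMap) h.par_coeff with
    | hom p a ha =>
      induction s using homogeneous_induction h.par_par with
      | hom q s hs =>
        have hb : σ b = (-1 : ℂ) ^ r • b := hb
        have ha : σ a = (-1 : ℂ) ^ p • a := ha
        have has : P (a • s) = (-1 : ℂ) ^ (p + q) • a • s := by
          rw [h.par_smul, ha, hs, smul_assoc, smul_comm_complex, smul_smul, pow_add]
        rw [rightMul_of_homogeneous hb hs, rightMul_of_homogeneous hb has, ← mul_smul b a,
          h.comm r p b a hb ha, smul_assoc, smul_smul ((-1 : ℂ) ^ _), smul_comm_complex a,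
          ← mul_smul a b]
        congr 1
        rw [← pow_add, show r * (p + q) + r * p = r * q + 2 * (r * p) by ring, pow_add _ (r * q),
          pow_mul _ 2, neg_one_sq, one_pow, mul_one]
      | add s t hs ht => rw [smul_add, map_add, map_add, LinearMap.add_apply, LinearMap.add_apply,
          hs, ht, smul_add]
    | add a a' ha ha' => rw [add_smul, map_add, LinearMap.add_apply, ha, ha', add_smul]
  | add b b' hb hb' => rw [map_add, map_add, hb, hb', smul_add]

-- The right action is associative. In this form it says that `preContract` kills the relations of
-- the tensor product.
include h in
theorem rightMul_rel {p q : ℕ} {a : A} {s : M} (ha : σ a = (-1 : ℂ) ^ p • a)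
    (hs : P s = (-1 : ℂ) ^ q • s) (b : A) :
    rightMul M σ P ((-1 : ℂ) ^ (p * q) • a • s) b = rightMul M σ P s (a * b) := by
  induction b using homogeneous_induction (P := σ.toLinearMap) h.par_coeff with
  | hom r b hb =>
    have hb : σ b = (-1 : ℂ) ^ r • b := hb
    have hab : σ (a * b) = (-1 : ℂ) ^ (p + r) • (a * b) := by
      rw [map_mul, ha, hb, smul_mul_smul_comm, pow_add]
    rw [map_smul, LinearMap.smul_apply, h.rightMul_smul, rightMul_of_homogeneous hb hs,
      rightMul_of_homogeneous hab hs, smul_comm_complex, smul_smul, mul_smul a b, add_mul, pow_add, smul_smul]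
  | add b b' hb hb' => rw [map_add, mul_add, map_add, hb, hb']

variable {t : M'} (τ : M' →ₗ[ℂ] A)

/-- The map `M ⊗ M' → M`, `s ⊗ h ↦ s τ(h)`, before passing to the quotient. -/
def preContract (h : IsSuperModule σ P) (τ : M' →ₗ[ℂ] A) : M ⊗[ℂ] M' →ₗ[A] M where
  toFun := TensorProduct.lift ((rightMul M σ P).compl₂ τ)
  map_add' := map_add _
  map_smul' a x := by
    induction x using TensorProduct.induction_on with
    | zero => simp
    | tmul s t =>
      rw [TensorProduct.smul_tmul', TensorProduct.lift.tmul, TensorProduct.lift.tmul]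
      exact h.rightMul_smul a s (τ t)
    | add x y hx hy => rw [smul_add, map_add, hx, hy, map_add, smul_add]

omit [IsScalarTower ℂ A M'] in
/-- If `t` is a generator of the free module `M'` of rank one, then `M → M ⊗ M'`, `s ↦ s ⊗ t`, is
bijective. -/
theorem tmul_bijective (h : IsSuperModule σ P) (hτ : ∀ (a : A) (y : M'), τ (a • y) = a * τ y)
    (ht : τ t = 1) (ht' : ∀ y, τ y • t = y) :
    Function.Bijective (fun s : M => SuperTensor.mk σ P (s ⊗ₜ[ℂ] t)) := by
  -- The map `s ⊗ y ↦ s τ(y)` descends to the tensor product; as `τ t = 1`, it is a left inverse of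
  -- `s ↦ s ⊗ t`.
  have hle : tensorRel M' σ P ≤ LinearMap.ker (h.preContract τ) := by
    rw [tensorRel, Submodule.span_le]
    rintro _ ⟨p, q, a, s, y, ha, hs, rfl⟩
    change (TensorProduct.lift ((rightMul M σ P).compl₂ τ)) _ = 0
    rw [map_sub, TensorProduct.lift.tmul, TensorProduct.lift.tmul]
    change rightMul M σ P _ (τ y) - rightMul M σ P s (τ (a • y)) = 0
    rw [h.rightMul_rel ha hs, hτ, sub_self]
  constructor
  · intro s s' hss
    have h1 : ∀ s : M, (tensorRel M' σ P).liftQ (h.preContract τ) hle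
        (SuperTensor.mk σ P (s ⊗ₜ[ℂ] t)) = s := by
      intro s
      change rightMul M σ P s (τ t) = s
      rw [ht, rightMul_apply, map_one, sub_self, zero_smul, add_zero, ← two_smul ℂ (1 : A),
        smul_assoc, one_smul, smul_smul, inv_mul_cancel₀ two_ne_zero, one_smul]
    rw [← h1 s, ← h1 s']
    exact congrArg _ hss
  · have hadd : ∀ x y : M ⊗[ℂ] M', SuperTensor.mk σ P (x + y) =
        SuperTensor.mk σ P x + SuperTensor.mk σ P y := fun x y => map_add _ x y
    intro x
    obtain ⟨x, rfl⟩ := SuperTensor.mk_surjective x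
    induction x using TensorProduct.induction_on with
    | zero => exact ⟨0, by simp only [TensorProduct.zero_tmul]⟩
    | tmul s y =>
      -- Since `y` is a multiple `a • t`, the scalar can be moved to the left factor with its sign,
      -- once `a` and `s` are homogeneous.
      obtain ⟨a, rfl⟩ : ∃ a : A, a • t = y := ⟨τ y, ht' y⟩
      induction a using homogeneous_induction (P := σ.toLinearMap) h.par_coeff with
      | hom p a ha =>
        induction s using homogeneous_induction h.par_par with
        | hom q s hs =>
          refine ⟨(-1 : ℂ) ^ (p * q) • a • s, ?_⟩
          rw [← sub_eq_zero]
          exact (Submodule.Quotient.mk_eq_zero _).2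
            (Submodule.subset_span ⟨p, q, a, s, t, ha, hs, rfl⟩)
        | add s s' hs hs' =>
          obtain ⟨u, hu⟩ := hs
          obtain ⟨u', hu'⟩ := hs'
          refine ⟨u + u', ?_⟩
          simp only at hu hu' ⊢
          rw [TensorProduct.add_tmul, TensorProduct.add_tmul, hadd, hadd, hu, hu']
      | add a a' ha ha' =>
        obtain ⟨u, hu⟩ := ha
        obtain ⟨u', hu'⟩ := ha'
        refine ⟨u + u', ?_⟩
        simp only at hu hu' ⊢
        rw [TensorProduct.add_tmul, add_smul, TensorProduct.tmul_add, hadd, hadd, hu, hu']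
    | add x y hx hy =>
      obtain ⟨u, hu⟩ := hx
      obtain ⟨v, hv⟩ := hy
      refine ⟨u + v, ?_⟩
      simp only at hu hv ⊢
      rw [TensorProduct.add_tmul, hadd, hadd, hu, hv]

-- For even `a` the relation carries no sign, so it extends from homogeneous `s` to all `s`.
omit [IsScalarTower ℂ A M'] in
theorem smul_tmul (h : IsSuperModule σ P) {a : A} (ha : σ a = a) (s : M) (y : M') :
    SuperTensor.mk σ P ((a • s) ⊗ₜ[ℂ] y) = SuperTensor.mk σ P (s ⊗ₜ[ℂ] (a • y)) := by
  have hadd : ∀ x y : M ⊗[ℂ] M', SuperTensor.mk σ P (x + y) =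
        SuperTensor.mk σ P x + SuperTensor.mk σ P y := fun x y => map_add _ x y
  induction s using homogeneous_induction h.par_par with
  | hom q s hs =>
    rw [← sub_eq_zero]
    refine (Submodule.Quotient.mk_eq_zero _).2
      (Submodule.subset_span ⟨0, q, a, s, y, ?_, hs, ?_⟩)
    · rw [ha, pow_zero, one_smul]
    · rw [zero_mul, pow_zero, one_smul]
  | add s s' hs hs' => rw [smul_add, TensorProduct.add_tmul, TensorProduct.add_tmul, hadd, hadd,
      hs, hs']

end IsSuperModule

omit [IsScalarTower ℂ A M] in
/-- Even scalars can be taken out of monomials. -/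
theorem SymAlg.mon_smul (h : IsSuperModule σ P) {k : ℕ} (a : Fin k → A) (ha : ∀ j, σ (a j) = a j)
    (v : Fin k → M) :
    SymAlg.mon σ P (fun j => a j • v j) = (List.ofFn a).prod • SymAlg.mon σ P v := by
  induction k with
  | zero => simp [SymAlg.mon]
  | succ k ih =>
    have h1 : ∀ w : Fin (k + 1) → M, SymAlg.mon σ P w =
        SymAlg.gen σ P (w 0) * SymAlg.mon σ P (fun j => w j.succ) := fun w => by
      simp [SymAlg.mon, List.ofFn_succ]
    have h2 : ∀ b : A, σ b = b → ∀ x y : SymAlg σ P, x * (b • y) = b • (x * y) := by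
      intro b hb x y
      rw [SymAlg.smul_def, ← mul_assoc, h.contractible_zero.mul_coeff_even hb, SymAlg.smul_def,
        SymAlg.smul_def, mul_assoc]
    have h3 : ∀ (k : ℕ) (a : Fin k → A), (∀ j, σ (a j) = a j) →
        σ (List.ofFn a).prod = (List.ofFn a).prod := by
      intro k a ha
      rw [map_list_prod, List.map_ofFn]
      congr 2
      exact funext ha
    have h4 : (List.ofFn fun j => a j.succ).prod * a 0 =
        a 0 * (List.ofFn fun j => a j.succ).prod := by
      have := h.comm 0 0 (List.ofFn fun j => a j.succ).prod (a 0)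
        (by rw [h3 _ _ fun j => ha _, pow_zero, one_smul]) (by rw [ha, pow_zero, one_smul])
      rwa [zero_mul, pow_zero, one_smul] at this
    rw [h1, h1 v, ih (fun j => a j.succ) (fun j => ha _) (fun j => v j.succ),
      h2 _ (h3 _ _ fun j => ha _), SymAlg.gen_smul, List.ofFn_succ, List.prod_cons, ← h4, mul_smul]
    congr 1
    exact mul_assoc _ _ _

end tensor

/-! ### The canonical isomorphism on a chart and its independence of the chart. -/

namespace SuperPresheaf

variable {n m : ℕ} {U V : Opens (projSpace n)}

theorem O.comm (i j : ℕ) (a b : O m U) (ha : O.par a = (-1 : ℂ) ^ i • a)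
    (hb : O.par b = (-1 : ℂ) ^ j • b) : a * b = (-1 : ℂ) ^ (i * j) • (b * a) := by
  rw [pow_mul]
  rcases neg_one_pow_eq_or ℂ i with hi | hi
  · rw [hi, one_smul] at ha
    rw [hi, one_pow, one_smul, O.even_comm ha]
  · rw [hi, neg_one_smul] at ha
    rw [hi, O.odd_comm ha, hb, mul_smul_comm, smul_smul, ← mul_pow, neg_one_mul, neg_neg, one_pow,
      one_smul]

/-- The sections of a presheaf of supermodules form a supermodule. -/
theorem isSuperModule (M : SuperPresheaf n m) (U : Opens (projSpace n)) :
    IsSuperModule (A := O m U) (M := M.obj U) O.par M.par where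
  comm := O.comm
  par_coeff := O.par_par
  par_par := M.par_par
  par_smul := M.par_smul

/-- Multiplication with the coordinate `z_l`, as a map `𝒪(-1)^{⊕ m|n+1} → 𝒪^{⊕ m|n+1}`. -/
def mulCoord (n m : ℕ) (l : Fin (n + 1)) : (eulerMiddle n m).Hom (trivialMiddle n m) where
  app {U} :=
    { toFun := fun (s : Fin m ⊕ Fin (n + 1) → twistSec m (-1) U) =>
        (fun j => ⟨fun v => v.1 l • (s j).1 v, (s j).2.1.coord_smul l, fun c hc v => by
          change (c * v.1 l) • (s j).1 (v.smul c hc) = c ^ (0 : ℤ) • scale c⁻¹ (v.1 l • (s j).1 v)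
          rw [(s j).2.2 c hc v, zpow_neg_one, zpow_zero, one_smul, map_smul, smul_smul, mul_right_comm, mul_inv_cancel₀ hc, one_mul]⟩ :
            Fin m ⊕ Fin (n + 1) → O m U)
      map_add' := fun s t => funext fun j => Subtype.ext (funext fun v => smul_add _ _ _)
      map_smul' := fun a s => funext fun j => Subtype.ext (funext fun v => mul_smul_comm _ _ _ |>.symm) }
  app_par {U} s := by
    let s' : Fin m ⊕ Fin (n + 1) → twistSec m (-1) U := s
    funext j
    rcases j with j | j
    · exact Subtype.ext (funext fun v => (map_smul inv (v.1 l) ((s' (Sum.inl j)).1 v)).symm)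
    · refine Subtype.ext (funext fun v => ?_)
      change v.1 l • (-inv ((s' (Sum.inr j)).1 v)) = -inv (v.1 l • (s' (Sum.inr j)).1 v)
      rw [map_smul, smul_neg]
  app_res _ _ := rfl

theorem isHol_coord_zpow {l : Fin (n + 1)} (hl : ∀ v ∈ coneSet U, v l ≠ 0) (d : ℤ)
    {f : Cone U → Lam m} (hf : IsHol f) : IsHol (fun v => (v.1 l) ^ d • f v) := by
  rw [isHol_iff_exists] at *
  intro I
  obtain ⟨a, ha, ha'⟩ := hf I
  exact ⟨fun v => (v l) ^ d * a v,
    ((differentiableOn_apply l _).zpow (Or.inl fun v hv => hl v hv)).mul ha, fun v => by simp [ha']⟩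

/-- The section `z_l^d` of `𝒪(d)`. -/
def coordPow (m : ℕ) {l : Fin (n + 1)} (hl : ∀ v ∈ coneSet U, v l ≠ 0) (d : ℤ) :
    (twist n m d).obj U :=
  show twistSec m d U from ⟨fun v => (v.1 l) ^ d • 1, isHol_coord_zpow hl d (IsHol.const 1), fun c hc v => by
    change (c * v.1 l) ^ d • (1 : Lam m) = c ^ d • scale c⁻¹ ((v.1 l) ^ d • 1)
    rw [map_smul, map_one, smul_smul, mul_zpow]⟩

/-- Multiplication with `z_l^d`, as a map `𝒪(-d) → 𝒪`. -/
def divCoord {l : Fin (n + 1)} (hl : ∀ v ∈ coneSet U, v l ≠ 0) (d : ℤ) :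
    twistSec m (-d) U →ₗ[O m U] O m U where
  toFun s := ⟨fun v => (v.1 l) ^ d • s.1 v, isHol_coord_zpow hl d s.2.1, fun c hc v => by
    change (c * v.1 l) ^ d • s.1 (v.smul c hc) = c ^ (0 : ℤ) • scale c⁻¹ ((v.1 l) ^ d • s.1 v)
    rw [s.2.2 c hc v, zpow_zero, one_smul, map_smul, smul_smul, mul_zpow, mul_right_comm, zpow_neg, mul_inv_cancel₀ (zpow_ne_zero d hc),
      one_mul]⟩
  map_add' s t := Subtype.ext (funext fun v => smul_add _ _ _)
  map_smul' a s := Subtype.ext (funext fun v => (mul_smul_comm _ _ _).symm)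

theorem tmul_add {M N : SuperPresheaf n m} (s s' : M.obj U) (t : N.obj U) :
    tmul (s + s') t = tmul s t + tmul s' t := by
  unfold tmul
  rw [TensorProduct.add_tmul]
  exact map_add ((tensorRel _ _ _).mkQ) _ _

theorem tmul_smul {M N : SuperPresheaf n m} (a : O m U) (s : M.obj U) (t : N.obj U) :
    tmul (a • s) t = a • tmul s t := by
  unfold tmul
  rw [← TensorProduct.smul_tmul']
  exact map_smul ((tensorRel _ _ _).mkQ) _ _

theorem smul_tmul {M N : SuperPresheaf n m} {a : O m U} (ha : O.par a = a) (s : M.obj U)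
    (t : N.obj U) : tmul (a • s) t = tmul s (a • t) :=
  (isSuperModule M U).smul_tmul ha s t

theorem Hom.symPow_bijective {M N : SuperPresheaf n m} (f : M.Hom N)
    (hf : Function.Bijective (f.app (U := U))) (k : ℕ) :
    Function.Bijective ((f.symPow k).app (U := U)) := by
  let e := LinearEquiv.ofBijective (f.app (U := U)) hf
  let g : N.obj U →ₗ[ℂ] M.obj U :=
    { toFun := e.symm
      map_add' := map_add _
      map_smul' := fun c s => by
        rw [← algebraMap_smul' (A := O m U) c s, map_smul, algebraMap_smul']; rfl }
  have hid : ∀ a, AlgHom.id ℂ (O m U) (O.par a) = O.par (AlgHom.id ℂ (O m U) a) := fun _ => rfl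
  have hg : ∀ s, g (N.par s) = M.par (g s) := fun s => by
    apply e.injective
    change e (e.symm _) = f.app (M.par (e.symm s))
    rw [e.apply_symm_apply, f.app_par]
    exact congrArg N.par (e.apply_symm_apply s).symm
  have hg' : ∀ (a : O m U) s, g (a • s) = AlgHom.id ℂ (O m U) a • g s := fun a s =>
    map_smul e.symm a s
  have hf' : ∀ (a : O m U) s, f.appC U (a • s) = AlgHom.id ℂ (O m U) a • f.appC U s := fun a s =>
    map_smul f.app a s
  have h1 := IsContractible.symPowMap_leftInverse (σ := O.par) (i := f.appC U) (r := g) hid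
    f.app_par hf' hg hg' (fun s => e.symm_apply_apply s) k
  have h2 := IsContractible.symPowMap_leftInverse (σ := O.par) (i := g) (r := f.appC U) hid
    hg hg' f.app_par hf' (fun s => e.apply_symm_apply s) k
  exact ⟨h1.injective, h2.surjective⟩

theorem mulCoord_bijective {l : Fin (n + 1)} (hl : ∀ v ∈ coneSet U, v l ≠ 0) :
    Function.Bijective ((mulCoord n m l).app (U := U)) := by
  constructor
  · intro (s : Fin m ⊕ Fin (n + 1) → twistSec m (-1) U) (t : Fin m ⊕ Fin (n + 1) → twistSec m (-1) U)
      hst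
    refine funext fun j => Subtype.ext (funext fun v => ?_)
    have h1 : v.1 l • (s j).1 v = v.1 l • (t j).1 v :=
      congrFun (congrArg Subtype.val (congrFun hst j)) v
    exact smul_right_injective _ (hl _ v.2) h1
  · intro (s : Fin m ⊕ Fin (n + 1) → O m U)
    refine ⟨(fun j => ⟨fun v => (v.1 l) ^ (-1 : ℤ) • (s j).1 v,
      isHol_coord_zpow hl _ (s j).2.1, fun c hc v => ?_⟩ :
      Fin m ⊕ Fin (n + 1) → twistSec m (-1) U), funext fun j => Subtype.ext (funext fun v => ?_)⟩
    · change (c * v.1 l) ^ (-1 : ℤ) • (s j).1 (v.smul c hc) =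
        c ^ (-1 : ℤ) • scale c⁻¹ ((v.1 l) ^ (-1 : ℤ) • (s j).1 v)
      rw [(s j).2.2 c hc v, map_smul, mul_zpow, zpow_zero, one_smul, smul_smul]
    · change v.1 l • (v.1 l) ^ (-1 : ℤ) • (s j).1 v = (s j).1 v
      rw [zpow_neg_one, smul_smul, mul_inv_cancel₀ (hl _ v.2), one_smul]

/-- The restriction to a chart of the canonical map
`Sym^k (𝒪(-1)^{⊕ m|n+1}) → (Sym^k 𝒪^{⊕ m|n+1})(-k)`. -/
def canonicalOn (k : ℕ) {l : Fin (n + 1)} (hl : ∀ v ∈ coneSet U, v l ≠ 0) :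
    ((eulerMiddle n m).symPow k).obj U →ₗ[O m U] (symMiddle n m k).obj U where
  toFun x := tmul (((mulCoord n m l).symPow k).app x) (coordPow m hl (-(k : ℤ)))
  map_add' x y := by rw [map_add]; exact tmul_add _ _ _
  map_smul' a x := by rw [map_smul]; exact tmul_smul _ _ _

/-- Where `z_l` does not vanish, multiplication by it identifies `𝒪(-1)` with `𝒪`, and `𝒪(-k)` is
free on `z_l^{-k}`, the coefficient being read off by multiplying with `z_l^k`. -/
theorem canonicalOn_bijective (k : ℕ) {l : Fin (n + 1)} (hl : ∀ v ∈ coneSet U, v l ≠ 0) :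
    Function.Bijective (canonicalOn (m := m) k hl) := by
  let τ : (twist n m (-(k : ℤ))).obj U →ₗ[ℂ] O m U := (divCoord hl (k : ℤ)).restrictScalars ℂ
  have h1 := IsSuperModule.tmul_bijective (A := O m U) (t := coordPow m hl (-(k : ℤ))) τ
    (isSuperModule ((trivialMiddle n m).symPow k) U)
    (fun a y => map_smul (divCoord hl k) a y)
    (Subtype.ext (funext fun v => by
      change (v.1 l) ^ (k : ℤ) • (v.1 l) ^ (-(k : ℤ)) • (1 : Lam m) = 1
      rw [smul_smul, ← zpow_add₀ (hl _ v.2), add_neg_cancel, zpow_zero, one_smul]))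
    (fun (y : twistSec m (-(k : ℤ)) U) => Subtype.ext (funext fun v => by
      change ((v.1 l) ^ (k : ℤ) • y.1 v) * ((v.1 l) ^ (-(k : ℤ)) • (1 : Lam m)) = y.1 v
      rw [smul_mul_smul_comm, ← zpow_add₀ (hl _ v.2), add_neg_cancel, zpow_zero, one_smul,
        mul_one]))
  exact h1.comp (Hom.symPow_bijective _ (mulCoord_bijective hl) k)

/-- The formula that characterizes the canonical map. -/
theorem canonicalOn_mon {k : ℕ} {l : Fin (n + 1)} (hl : ∀ v ∈ coneSet U, v l ≠ 0)
    (j : Fin k → Fin m ⊕ Fin (n + 1)) (g : Fin k → twistSec m (-1) U)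
    (h : twistSec m (-(k : ℤ)) U) (hg : ∀ i, (twist n m (-1)).IsHomogeneous 0 (g i))
    (hh : h.1 = (List.ofFn fun i => (g i).1).prod) :
    canonicalOn k hl ((eulerMiddle n m).mon fun i => single (j i) (g i)) =
      (tmul ((trivialMiddle n m).mon fun i => basisVec U (j i)) h : (symMiddle n m k).obj U) := by
  let a : Fin k → O m U := fun i => divCoord hl 1 (g i)
  have ha : ∀ i, O.par (a i) = a i := fun i => Subtype.ext (funext fun v => by
    have h1 : inv ((g i).1 v) = (g i).1 v := by
      have h0 : (twist n m (-1)).par (g i) = (-1 : ℂ) ^ 0 • (g i : (twist n m (-1)).obj U) := hg i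
      rw [pow_zero, one_smul] at h0
      exact congrFun (congrArg Subtype.val h0) v
    change inv ((v.1 l) ^ (1 : ℤ) • (g i).1 v) = (v.1 l) ^ (1 : ℤ) • (g i).1 v
    rw [map_smul, h1])
  -- Each `g_i e_j` becomes `(z_l g_i) e_j`, and the even scalars `z_l g_i` come out of the
  -- monomial.
  have e1 : ((mulCoord n m l).symPow k).app ((eulerMiddle n m).mon fun i => single (j i) (g i)) =
      (List.ofFn a).prod • (trivialMiddle n m).mon fun i => basisVec U (j i) := by
    refine (SymPow.map_mon _ _ _ _ _ _).trans (Subtype.ext ?_)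
    refine Eq.trans ?_ (SymAlg.mon_smul (isSuperModule (trivialMiddle n m) U) a ha
      fun i => basisVec U (j i))
    change SymAlg.mon _ _ _ = _
    congr 1
    funext i
    refine funext fun j' => Subtype.ext (funext fun v => ?_)
    change v.1 l • ((Pi.single (M := fun _ : Fin m ⊕ Fin (n + 1) => twistSec m (-1) U)
      (j i) (g i) j').1 v) = ((v.1 l) ^ (1 : ℤ) • (g i).1 v) *
        (Pi.single (M := fun _ : Fin m ⊕ Fin (n + 1) => O m U) (j i) 1 j').1 v
    by_cases hj : j' = j i
    · subst hj
      rw [Pi.single_eq_same, Pi.single_eq_same, zpow_one]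
      exact (mul_one _).symm
    · rw [Pi.single_eq_of_ne hj, Pi.single_eq_of_ne hj]
      change v.1 l • (0 : Lam m) = _ * (0 : Lam m)
      rw [smul_zero, mul_zero]
  have e2 : O.par (List.ofFn a).prod = (List.ofFn a).prod := by
    rw [map_list_prod, List.map_ofFn]
    congr 2
    exact funext ha
  change tmul (((mulCoord n m l).symPow k).app _) _ = _
  rw [e1, smul_tmul e2]
  congr 1
  refine Subtype.ext (funext fun v => ?_)
  -- The `k` factors `z_l` collected here cancel the generator `z_l^{-k}` of the twist.
  have e3 : (List.ofFn a).prod.1 v = (v.1 l) ^ k • (List.ofFn fun i => (g i).1 v).prod := by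
    change ((Pi.evalRingHom (fun _ : Cone U => Lam m) v).comp (O m U).val.toRingHom)
      (List.ofFn a).prod = _
    rw [map_list_prod, List.map_ofFn]
    change (List.ofFn fun i => (v.1 l) ^ (1 : ℤ) • (g i).1 v).prod = _
    clear_value a
    clear hh h e1 e2 ha hg
    induction k with
    | zero => simp
    | succ k ih =>
      rw [List.ofFn_succ, List.ofFn_succ, List.prod_cons, List.prod_cons,
        ih (fun i => j i.succ) (fun i => g i.succ) (fun i => a i.succ), smul_mul_smul_comm, zpow_one,
        pow_succ']
  have e4 : h.1 v = (List.ofFn fun i => (g i).1 v).prod := by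
    have h5 : Pi.evalRingHom (fun _ : Cone U => Lam m) v (List.ofFn fun i => (g i).1).prod =
        (List.ofFn fun i => (g i).1 v).prod := by
      rw [map_list_prod, List.map_ofFn]
      rfl
    exact (congrFun hh v).trans h5
  change (List.ofFn a).prod.1 v * ((v.1 l) ^ (-(k : ℤ)) • (1 : Lam m)) = h.1 v
  rw [e3, e4, smul_mul_smul_comm, mul_one, zpow_neg, zpow_natCast,
    mul_inv_cancel₀ (pow_ne_zero k (hl _ v.2)), one_smul]

@[elab_as_elim]
theorem symPow_induction {M : SuperPresheaf n m} {k : ℕ} {C : (M.symPow k).obj U → Prop}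
    (mon : ∀ v : Fin k → M.obj U, C (M.mon v)) (zero : C 0) (add : ∀ x y, C x → C y → C (x + y))
    (smul : ∀ (a : O m U) x, C x → C (a • x)) (x : (M.symPow k).obj U) : C x := by
  obtain ⟨x, hx⟩ := x
  induction hx using Submodule.span_induction with
  | mem x h =>
    obtain ⟨v, rfl⟩ := h
    exact mon v
  | zero => exact zero
  | add x y hx' hy' hx hy => exact add ⟨x, hx'⟩ ⟨y, hy'⟩ hx hy
  | smul a x hx' hx => exact smul a ⟨x, hx'⟩ hx

/-- The canonical maps in two charts agree. -/
theorem canonicalOn_eq (k : ℕ) {l l' : Fin (n + 1)} (hl : ∀ v ∈ coneSet U, v l ≠ 0)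
    (hl' : ∀ v ∈ coneSet U, v l' ≠ 0) :
    canonicalOn (m := m) k hl = canonicalOn k hl' := by
  -- `u` is the even function `z_l / z_{l'}`. Passing from `l'` to `l` multiplies the symmetric
  -- power by `u^k`, and `u^k z_l^{-k} = z_{l'}^{-k}`.
  let u : O m U := divCoord hl' (-1) (⟨fun v => v.1 l • 1, (IsHol.const 1).coord_smul l, fun c hc v => by
    change (c * v.1 l) • (1 : Lam m) = c ^ (1 : ℤ) • scale c⁻¹ (v.1 l • 1)
    rw [map_smul, map_one, smul_smul, zpow_one]⟩ : twistSec m (- -1) U)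
  have hu : ∀ v, u.1 v = (v.1 l' ^ (-1 : ℤ) * v.1 l) • 1 := fun v => smul_smul _ _ _
  have hu' : O.par u = u := Subtype.ext (funext fun v => by
    change inv (u.1 v) = u.1 v
    rw [hu, map_smul, map_one])
  have hu2 : O.par (u ^ k) = u ^ k := by rw [map_pow, hu']
  have e1 : ∀ x, ((mulCoord n m l).symPow k).app (U := U) x =
      u ^ k • ((mulCoord n m l').symPow k).app x := by
    intro x
    induction x using symPow_induction with
    | mon v =>
      refine (SymPow.map_mon _ _ _ _ _ _).trans ?_
      refine Eq.trans ?_ (congrArg (u ^ k • ·) (SymPow.map_mon _ _ _ _ _ _).symm)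
      refine Subtype.ext ?_
      have h1 := SymAlg.mon_smul (isSuperModule (trivialMiddle n m) U) (fun _ : Fin k => u)
        (fun _ => hu') fun i => (mulCoord n m l').app (v i)
      rw [List.ofFn_const, List.prod_replicate] at h1
      refine Eq.trans ?_ h1
      change SymAlg.mon _ _ _ = _
      congr 1
      funext i
      refine funext fun j => Subtype.ext (funext fun w => ?_)
      let s : Fin m ⊕ Fin (n + 1) → twistSec m (-1) U := v i
      change w.1 l • (s j).1 w = u.1 w * (w.1 l' • (s j).1 w)
      rw [hu, smul_mul_smul_comm, one_mul, mul_right_comm, zpow_neg_one, inv_mul_cancel₀ (hl' _ w.2),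
        one_mul]
    | zero => rw [map_zero, map_zero, smul_zero]
    | add x y hx hy => rw [map_add, map_add, smul_add, hx, hy]
    | smul a x hx => rw [map_smul, map_smul, hx, ← mul_smul, ← mul_smul, O.even_comm hu2]
  refine LinearMap.ext fun x => ?_
  change tmul (((mulCoord n m l).symPow k).app x) _ = tmul (((mulCoord n m l').symPow k).app x) _
  rw [e1, smul_tmul hu2]
  congr 1
  refine Subtype.ext (funext fun v => ?_)
  have e2 : (u ^ k).1 v = (v.1 l' ^ (-1 : ℤ) * v.1 l) ^ k • 1 := by
    change (u.1 v) ^ k = _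
    rw [hu, smul_pow, one_pow]
  change (u ^ k).1 v * (v.1 l ^ (-(k : ℤ)) • 1) = v.1 l' ^ (-(k : ℤ)) • 1
  rw [e2, smul_mul_smul_comm, one_mul, mul_pow, mul_assoc, zpow_neg _ (k : ℤ), zpow_natCast,
    mul_inv_cancel₀ (pow_ne_zero k (hl _ v.2)), mul_one, zpow_neg_one, zpow_neg, zpow_natCast,
    inv_pow]

theorem tmul_par {M N : SuperPresheaf n m} (s : M.obj U) (t : N.obj U) :
    (M.tensor N).par (tmul s t) = tmul (M.par s) (N.par t) := rfl

theorem tmul_res {M N : SuperPresheaf n m} (h : V ≤ U) (s : M.obj U) (t : N.obj U) :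
    (M.tensor N).res h (tmul s t) = tmul (M.res h s) (N.res h t) := rfl

/-- The canonical map `Sym^k (𝒪(-1)^{⊕ m|n+1}) → (Sym^k 𝒪^{⊕ m|n+1})(-k)` on small open sets. -/
def canonicalLocal (n m k : ℕ) : ((eulerMiddle n m).symPow k).LocalHom (symMiddle n m k) where
  app hU := canonicalOn k hU.choose_spec
  app_par {U} hU s := by
    refine Eq.trans ?_ (tmul_par _ _).symm
    change tmul (((mulCoord n m _).symPow k).app _) _ = _
    rw [((mulCoord n m _).symPow k).app_par]
    congr 1
    refine Subtype.ext (funext fun v => ?_)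
    exact (by rw [map_smul, map_one] : (v.1 hU.choose ^ (-(k : ℤ)) • (1 : Lam m)) = inv _)
  app_res {V U} h hU s := by
    -- The chart chosen for `V` need not be the one chosen for `U`.
    rw [canonicalOn_eq k (hU.mono h).choose_spec fun v hv => hU.choose_spec v (coneSet_mono h hv)]
    refine Eq.trans ?_ (tmul_res h _ _).symm
    change tmul (((mulCoord n m _).symPow k).app _) _ = _
    rw [((mulCoord n m _).symPow k).app_res]
    rfl

instance (n m k : ℕ) : IsIso (canonicalLocal n m k).sheafMap :=
  (canonicalLocal n m k).isIso_sheafMap fun hU => canonicalOn_bijective k hU.choose_spec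

theorem mon_res (M : SuperPresheaf n m) {k : ℕ} (h : V ≤ U) (s : Fin k → M.obj U) :
    (M.symPow k).res h (M.mon s) = M.mon fun j => M.res h (s j) :=
  SymPow.map_mon _ _ _ _ _ _

/-- Both sides commute with restriction, so the formula has to hold only on small open sets, where
it is `canonicalOn_mon`. -/
theorem isCanonical_canonicalLocal (n m k : ℕ) : IsCanonical (canonicalLocal n m k).sheafMap := by
  intro U j g h hg hh
  refine eq_of_small fun V hV hs => ?_
  rw [sheafRes_onSections, sheafRes_sec, mon_res, (canonicalLocal n m k).onSections_sec hs]
  refine Eq.trans ?_ (sheafRes_sec (symMiddle n m k) hV _).symm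
  congr 1
  refine Eq.trans ?_ (tmul_res hV _ _).symm
  have e1 : ∀ i, (eulerMiddle n m).res hV (single (j i) (g i)) =
      single (j i) ((twist n m (-1)).res hV (g i)) := fun i => by
    refine funext fun l => ?_
    by_cases hl : l = j i
    · subst hl
      exact (congrArg ((twist n m (-1)).res hV) (Pi.single_eq_same
        (M := fun _ : Fin m ⊕ Fin (n + 1) => twistSec m (-1) U) _ _)).trans (Pi.single_eq_same
        (M := fun _ : Fin m ⊕ Fin (n + 1) => twistSec m (-1) V) _ _).symm
    · exact (congrArg ((twist n m (-1)).res hV) (Pi.single_eq_of_ne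
        (M := fun _ : Fin m ⊕ Fin (n + 1) => twistSec m (-1) U) hl _)).trans
        ((map_zero _).trans (Pi.single_eq_of_ne
        (M := fun _ : Fin m ⊕ Fin (n + 1) => twistSec m (-1) V) hl _).symm)
  have e2 : ∀ i, (trivialMiddle n m).res hV (basisVec U (j i)) = basisVec V (j i) := fun i => by
    refine funext fun l => ?_
    by_cases hl : l = j i
    · subst hl
      exact (congrArg (O.res hV) (Pi.single_eq_same
        (M := fun _ : Fin m ⊕ Fin (n + 1) => O m U) _ _)).trans ((map_one _).trans
        (Pi.single_eq_same (M := fun _ : Fin m ⊕ Fin (n + 1) => O m V) _ _).symm)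
    · exact (congrArg (O.res hV) (Pi.single_eq_of_ne
        (M := fun _ : Fin m ⊕ Fin (n + 1) => O m U) hl _)).trans
        ((map_zero _).trans (Pi.single_eq_of_ne
        (M := fun _ : Fin m ⊕ Fin (n + 1) => O m V) hl _).symm)
  rw [mon_res]
  simp only [e1, e2]
  refine canonicalOn_mon hs.choose_spec j _ _ (fun i => ?_) (funext fun v => ?_)
  · have h0 : (twist n m (-1)).par (g i) = (-1 : ℂ) ^ 0 • (g i : (twist n m (-1)).obj U) := hg i
    rw [pow_zero, one_smul] at h0
    change (twist n m (-1)).par ((twist n m (-1)).res hV (g i)) = _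
    refine ((twist n m (-1)).res_par hV (g i)).symm.trans ((congrArg _ h0).trans ?_)
    rw [pow_zero, one_smul]
  · have h5 : ∀ (W : Opens (projSpace n)) (g : Fin k → twistSec m (-1) W) (w : Cone W),
        (List.ofFn fun i => (g i).1).prod w = (List.ofFn fun i => (g i).1 w).prod := by
      intro W g w
      change Pi.evalRingHom (fun _ : Cone W => Lam m) w (List.ofFn fun i => (g i).1).prod = _
      rw [map_list_prod, List.map_ofFn]
      rfl
    refine ((congrFun hh (v.incl hV)).trans (h5 U g (v.incl hV))).trans ?_
    exact (h5 V (fun i => (twist n m (-1)).res hV (g i)) v).symm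

end SuperPresheaf
end SuperProj
end

noncomputable section
namespace SuperProj

/-! ### Parametric integrals, partial derivatives and Hadamard's lemma in several complex variables.
-/

section analysis
open MeasureTheory Metric Set
open scoped Topology Interval

variable {N : ℕ} {F : Type} [NormedAddCommGroup F] [NormedSpace ℂ F] [FiniteDimensional ℂ F]
  {g : (Fin N → ℂ) → F} {S : Set (Fin N → ℂ)}

/-- Holomorphic functions may be integrated along families of paths that depend holomorphically
on a parameter. -/
theorem differentiableAt_integral_comp (hS : IsOpen S) (hg : DifferentiableOn ℂ g S) {p q : ℝ}
    {k a : ℝ → ℂ} {c : ℝ → Fin N → ℂ} (hk : Continuous k) (ha : Continuous a) (hc : Continuous c)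
    {v₀ : Fin N → ℂ} (hv : ∀ t ∈ [[p, q]], c t + a t • v₀ ∈ S) :
    DifferentiableAt ℂ (fun v => ∫ t in p..q, k t • g (c t + a t • v)) v₀ := by
  have : CompleteSpace F := FiniteDimensional.complete ℂ F
  have : ProperSpace ((Fin N → ℂ) →L[ℂ] F) := FiniteDimensional.proper ℂ _
  have hK : IsCompact ((fun t => c t + a t • v₀) '' [[p, q]]) :=
    isCompact_uIcc.image (by fun_prop)
  -- The path through `v₀` is compact, so a whole thickening of it lies in `S`, and `g` is bounded
  -- there.
  obtain ⟨δ, hδ, hδS⟩ := hK.exists_cthickening_subset_open hS (by rintro _ ⟨t, ht, rfl⟩; exact hv t ht)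
  obtain ⟨M, hM⟩ := hK.cthickening (r := δ).exists_bound_of_continuousOn (hg.continuousOn.mono hδS)
  obtain ⟨A, hA⟩ := (isCompact_uIcc (a := p) (b := q)).exists_bound_of_continuousOn ha.continuousOn
  obtain ⟨B, hB⟩ := (isCompact_uIcc (a := p) (b := q)).exists_bound_of_continuousOn hk.continuousOn
  have hA0 : 0 ≤ A := (norm_nonneg _).trans (hA p left_mem_uIcc)
  have hB0 : 0 ≤ B := (norm_nonneg _).trans (hB p left_mem_uIcc)
  -- For `v` in this ball each point of the path moves by at most `δ / 2`, since `|a t| ≤ A`; the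
  -- remaining `δ / 2` is left for Cauchy's estimate. The summand `1` keeps the denominator
  -- positive.
  have hε : 0 < δ / 2 / (A + 1) := by positivity
  have hnear : ∀ v ∈ ball v₀ (δ / 2 / (A + 1)), ∀ t ∈ [[p, q]],
      closedBall (c t + a t • v) (δ / 2) ⊆ cthickening δ ((fun t => c t + a t • v₀) '' [[p, q]]) := by
    intro v hv t ht
    refine Subset.trans (closedBall_subset_closedBall' ?_)
      (closedBall_subset_cthickening (mem_image_of_mem _ ht) δ)
    have h1 : dist (c t + a t • v) (c t + a t • v₀) ≤ A * (δ / 2 / (A + 1)) := by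
      rw [dist_add_left, dist_eq_norm, ← smul_sub, norm_smul]
      exact mul_le_mul (hA t ht) (by rw [← dist_eq_norm]; exact (mem_ball.1 hv).le) (norm_nonneg _) hA0
    have h2 : A * (δ / 2 / (A + 1)) ≤ δ / 2 := by
      rw [mul_div_assoc', div_le_iff₀ (by positivity)]
      nlinarith
    change δ / 2 + dist (c t + a t • v) (c t + a t • v₀) ≤ δ
    linarith
  have hmem : ∀ v ∈ ball v₀ (δ / 2 / (A + 1)), ∀ t ∈ [[p, q]], c t + a t • v ∈ S := fun v hv t ht =>
    hδS (hnear v hv t ht (mem_closedBall_self (by positivity)))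
  -- Cauchy's estimate on a ball of radius `δ / 2`, on which `g` differs from its value at the
  -- centre by at most `2 * M`. This is the uniform bound needed to differentiate under the
  -- integral.
  have hbound : ∀ v ∈ ball v₀ (δ / 2 / (A + 1)), ∀ t ∈ [[p, q]],
      ‖fderiv ℂ g (c t + a t • v)‖ ≤ 2 * M / (δ / 2) := by
    intro v hv t ht
    have hs := (ball_subset_closedBall.trans (hnear v hv t ht))
    refine Complex.norm_fderiv_le_div_of_mapsTo_ball (hg.mono (hs.trans hδS)) ?_ (by positivity)
    intro y hy
    rw [mem_closedBall, dist_eq_norm]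
    refine (norm_sub_le _ _).trans ?_
    have h1 := hM y (hs hy)
    have h2 := hM _ (hs (mem_ball_self (by positivity : (0 : ℝ) < δ / 2)))
    linarith
  have hM0 : 0 ≤ 2 * M / (δ / 2) :=
    (norm_nonneg _).trans (hbound v₀ (mem_ball_self hε) p left_mem_uIcc)
  have hcont : ∀ v ∈ ball v₀ (δ / 2 / (A + 1)),
      ContinuousOn (fun t => k t • g (c t + a t • v)) [[p, q]] := fun v hv =>
    hk.continuousOn.smul (hg.continuousOn.comp (by fun_prop) (hmem v hv))
  have hfd : ∀ v ∈ ball v₀ (δ / 2 / (A + 1)), ∀ t ∈ [[p, q]],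
      HasFDerivAt (fun v => k t • g (c t + a t • v))
        (k t • a t • fderiv ℂ g (c t + a t • v)) v := by
    intro v hv t ht
    have h1 := ((hg _ (hmem v hv t ht)).differentiableAt (hS.mem_nhds (hmem v hv t ht))).hasFDerivAt
    have h2 : HasFDerivAt (fun v : Fin N → ℂ => c t + a t • v)
        (a t • ContinuousLinearMap.id ℂ (Fin N → ℂ)) v :=
      ((hasFDerivAt_id v).const_smul (a t)).const_add (c t)
    have h3 := (h1.comp v h2).const_smul (k t)
    rw [ContinuousLinearMap.comp_smul, ContinuousLinearMap.comp_id] at h3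
    exact h3
  refine (intervalIntegral.hasFDerivAt_integral_of_dominated_of_fderiv_le
    (F' := fun v t => k t • a t • fderiv ℂ g (c t + a t • v))
    (bound := fun _ => B * (A * (2 * M / (δ / 2)))) (ball_mem_nhds v₀ hε) ?_ ?_ ?_ ?_ ?_ ?_
    ).differentiableAt
  · filter_upwards [ball_mem_nhds v₀ hε] with v hv
    exact ((hcont v hv).mono uIoc_subset_uIcc).aestronglyMeasurable measurableSet_uIoc
  · exact (hcont v₀ (mem_ball_self hε)).intervalIntegrable
  · have h1 : Measurable fun t => fderiv ℂ g (c t + a t • v₀) :=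
      (measurable_fderiv ℂ g).comp (by fun_prop : Continuous fun t => c t + a t • v₀).measurable
    exact (hk.aestronglyMeasurable).smul (ha.aestronglyMeasurable.smul h1.aestronglyMeasurable)
  · refine Filter.Eventually.of_forall fun t ht v hv => ?_
    have ht := uIoc_subset_uIcc ht
    rw [norm_smul, norm_smul]
    exact mul_le_mul (hB t ht) (mul_le_mul (hA t ht) (hbound v hv t ht) (norm_nonneg _) hA0)
      (by positivity) hB0
  · exact intervalIntegrable_const
  · exact Filter.Eventually.of_forall fun t ht v hv => hfd v hv t (uIoc_subset_uIcc ht)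

/-- The partial derivatives of a holomorphic function are holomorphic. -/
theorem differentiableOn_fderiv_apply (hS : IsOpen S) (hg : DifferentiableOn ℂ g S)
    (w : Fin N → ℂ) : DifferentiableOn ℂ (fun v => fderiv ℂ g v w) S := by
  have : CompleteSpace F := FiniteDimensional.complete ℂ F
  intro v₀ hv₀
  obtain ⟨δ, hδ, hδS⟩ := Metric.isOpen_iff.1 hS v₀ hv₀
  -- With this radius the discs `v + z w`, `|z| ≤ r`, stay inside the ball of radius `δ` for all `v`
  -- within `δ / 2` of `v₀`.
  have hr : 0 < δ / 2 / (‖w‖ + 1) := by positivity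
  set r := δ / 2 / (‖w‖ + 1)
  have hrw : r * ‖w‖ < δ / 2 := by
    rw [div_mul_eq_mul_div, div_lt_iff₀ (by positivity)]
    nlinarith
  have hmem : ∀ v ∈ ball v₀ (δ / 2), ∀ z ∈ closedBall (0 : ℂ) r, v + z • w ∈ S := by
    intro v hv z hz
    refine hδS ?_
    rw [mem_ball, dist_eq_norm, add_sub_right_comm]
    refine (norm_add_le _ _).trans_lt ?_
    rw [norm_smul]
    rw [mem_ball, dist_eq_norm] at hv
    rw [mem_closedBall, dist_zero_right] at hz
    have := mul_le_mul_of_nonneg_right hz (norm_nonneg w)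
    linarith
  -- Cauchy's formula for the derivative of `z ↦ g (v + z w)` at `0` turns the directional
  -- derivative into a circle integral that depends on `v` as a parameter.
  have key : ∀ v ∈ ball v₀ (δ / 2), fderiv ℂ g v w = ∫ t in (0 : ℝ)..2 * Real.pi,
      ((2 * ↑Real.pi * Complex.I)⁻¹ * deriv (circleMap 0 r) t * ((circleMap 0 r t) ^ 2)⁻¹) •
        g (circleMap 0 r t • w + (1 : ℂ) • v) := by
    intro v hv
    have hline : Continuous fun z : ℂ => v + z • w := by fun_prop
    have hd : ∀ z : ℂ, v + z • w ∈ S → HasDerivAt (fun z : ℂ => g (v + z • w))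
        (fderiv ℂ g (v + z • w) w) z := by
      intro z hz
      have h1 := ((hg _ hz).differentiableAt (hS.mem_nhds hz)).hasFDerivAt
      have h2 : HasDerivAt (fun z : ℂ => v + z • w) w z := by
        simpa using ((hasDerivAt_id z).smul_const w).const_add v
      exact h1.comp_hasDerivAt z h2
    have h0 := (hd 0 (hmem v hv 0 (mem_closedBall_self hr.le))).deriv
    have h1 := Complex.two_pi_I_inv_smul_circleIntegral_sub_sq_inv_smul_of_differentiable
      (hS.preimage hline) (hmem v hv) (f := fun z => g (v + z • w))
      (fun z hz => (hd z hz).differentiableAt.differentiableWithinAt) (mem_ball_self hr)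
    rw [zero_smul, add_zero] at h0
    rw [← h0, ← h1, circleIntegral, ← intervalIntegral.integral_smul]
    refine intervalIntegral.integral_congr fun t _ => ?_
    simp only [smul_smul, sub_zero, one_smul, mul_assoc, add_comm v]
  have hd := differentiableAt_integral_comp hS hg (p := 0) (q := 2 * Real.pi)
    (k := fun t => (2 * ↑Real.pi * Complex.I)⁻¹ * deriv (circleMap 0 r) t * ((circleMap 0 r t) ^ 2)⁻¹)
    (a := fun _ => 1) (c := fun t => circleMap 0 r t • w) (v₀ := v₀) (by
      refine Continuous.mul ?_ ?_
      · simp only [deriv_circleMap]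
        fun_prop
      · refine Continuous.inv₀ (by fun_prop) fun t => ?_
        exact pow_ne_zero _ (circleMap_ne_center hr.ne'))
    continuous_const (by fun_prop) (fun t _ => by
      rw [one_smul, add_comm]
      exact hmem v₀ (mem_ball_self (by positivity)) _ (circleMap_mem_closedBall 0 hr.le t))
  refine DifferentiableAt.differentiableWithinAt (hd.congr_of_eventuallyEq ?_)
  filter_upwards [ball_mem_nhds v₀ (by positivity : 0 < δ / 2)] with v hv using key v hv

/-- Hadamard's lemma for holomorphic functions on a ball. -/
theorem exists_hadamard {x₀ : Fin N → ℂ} {ε : ℝ} (hg : DifferentiableOn ℂ g (ball x₀ ε)) :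
    ∃ H : Fin N → (Fin N → ℂ) → F, (∀ j, DifferentiableOn ℂ (H j) (ball x₀ ε)) ∧
      ∀ x ∈ ball x₀ ε, g x = g x₀ + ∑ j, (x j - x₀ j) • H j x := by
  have : CompleteSpace F := FiniteDimensional.complete ℂ F
  have hmem : ∀ x ∈ ball x₀ ε, ∀ t ∈ [[(0 : ℝ), 1]],
      (1 - t : ℂ) • x₀ + (t : ℂ) • x ∈ ball x₀ ε := by
    intro x hx t ht
    rw [uIcc_of_le zero_le_one] at ht
    have h1 : (1 - t : ℂ) • x₀ + (t : ℂ) • x = x₀ + (t : ℂ) • (x - x₀) := by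
      rw [sub_smul, one_smul, smul_sub]; abel
    rw [h1, mem_ball, dist_eq_norm, add_sub_cancel_left, norm_smul, Complex.norm_real,
      Real.norm_of_nonneg ht.1]
    rw [mem_ball, dist_eq_norm] at hx
    exact (mul_le_of_le_one_left (norm_nonneg _) ht.2).trans_lt hx
  have hpd := fun j : Fin N => differentiableOn_fderiv_apply isOpen_ball hg (Pi.single j 1)
  -- `H j` is the mean of the `j`-th partial derivative over the segment from `x₀` to `x`; the
  -- identity is the fundamental theorem of calculus on that segment. The factor `1` only fits the
  -- integrand to `differentiableAt_integral_comp`.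
  refine ⟨fun j x => ∫ t in (0 : ℝ)..1, (1 : ℂ) •
    (fun v => fderiv ℂ g v (Pi.single j 1)) ((1 - t : ℂ) • x₀ + (t : ℂ) • x),
    fun j x hx => (differentiableAt_integral_comp isOpen_ball (hpd j) continuous_const
      (by fun_prop) (by fun_prop) (hmem x hx)).differentiableWithinAt, fun x hx => ?_⟩
  have hcont : ∀ j, ContinuousOn (fun t : ℝ => (1 : ℂ) •
      (fun v => fderiv ℂ g v (Pi.single j 1)) ((1 - t : ℂ) • x₀ + (t : ℂ) • x)) [[0, 1]] :=
    fun j => continuousOn_const.smul ((hpd j).continuousOn.comp (by fun_prop) (hmem x hx))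
  have hd : ∀ t ∈ [[(0 : ℝ), 1]], HasDerivAt
      (fun t : ℝ => g ((1 - t : ℂ) • x₀ + (t : ℂ) • x)) (∑ j, (x j - x₀ j) • (1 : ℂ) •
        (fun v => fderiv ℂ g v (Pi.single j 1)) ((1 - t : ℂ) • x₀ + (t : ℂ) • x)) t := by
    intro t ht
    have h1 := ((hg _ (hmem x hx t ht)).differentiableAt
      (isOpen_ball.mem_nhds (hmem x hx t ht))).hasFDerivAt.restrictScalars ℝ
    have h2 : HasDerivAt (fun t : ℝ => (1 - t : ℂ) • x₀ + (t : ℂ) • x) (x - x₀) t := by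
      have h3 := (((Complex.ofRealCLM.hasDerivAt (x := t)).const_sub 1).smul_const x₀).add
        ((Complex.ofRealCLM.hasDerivAt (x := t)).smul_const x)
      have h4 : -Complex.ofRealCLM 1 • x₀ + Complex.ofRealCLM 1 • x = x - x₀ := by
        simp [sub_eq_neg_add]
      rw [h4] at h3
      exact h3
    refine (h1.comp_hasDerivAt t h2).congr_deriv ?_
    change fderiv ℂ g _ (x - x₀) = _
    conv_lhs => rw [pi_eq_sum_univ' (x - x₀), map_sum]
    refine Finset.sum_congr rfl fun j _ => ?_
    rw [map_smul, one_smul]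
    rfl
  have h := intervalIntegral.integral_eq_sub_of_hasDerivAt hd
    (continuousOn_finsetSum _ fun j _ => (hcont j).const_smul _).intervalIntegrable
  have hi : ∀ j ∈ Finset.univ, IntervalIntegrable (fun t : ℝ => (x j - x₀ j) • (1 : ℂ) •
      (fun v => fderiv ℂ g v (Pi.single j 1)) ((1 - t : ℂ) • x₀ + (t : ℂ) • x)) volume 0 1 :=
    fun j _ => ((hcont j).const_smul _).intervalIntegrable
  rw [intervalIntegral.integral_finsetSum hi] at h
  simp only [intervalIntegral.integral_smul] at h ⊢
  rw [h]
  simp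

end analysis
end SuperProj
end

noncomputable section
namespace SuperProj

/-! ### Derivatives of `Λ`-valued functions in the even and odd coordinates. -/

section norm
open Metric

/-- A norm on the Grassmann algebra. -/
@[reducible] def lamNorm (m : ℕ) : NormedAddCommGroup (Lam m) :=
  NormedAddCommGroup.induced (Lam m) (Finset (Fin m) → ℂ) (thetaBasis m).equivFun
    (thetaBasis m).equivFun.injective

attribute [local instance] lamNorm

/-- The Grassmann algebra as a normed space. -/
@[reducible] def lamNormedSpace (m : ℕ) : NormedSpace ℂ (Lam m) :=
  NormedSpace.induced ℂ (Lam m) (Finset (Fin m) → ℂ) (thetaBasis m).equivFun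

attribute [local instance] lamNormedSpace

instance (m : ℕ) : FiniteDimensional ℂ (Lam m) := (thetaBasis m).finiteDimensional_of_finite

variable {n m : ℕ} {U V : Opens (projSpace n)}

theorem differentiableOn_linear {E : Type} [NormedAddCommGroup E] [NormedSpace ℂ E] {S : Set E}
    {G : E → Lam m} (hG : DifferentiableOn ℂ G S) {F : Type} [NormedAddCommGroup F]
    [NormedSpace ℂ F] (L : Lam m →ₗ[ℂ] F) : DifferentiableOn ℂ (fun v => L (G v)) S :=
  L.toContinuousLinearMap.differentiable.comp_differentiableOn hG

theorem differentiableOn_of_repr {E : Type} [NormedAddCommGroup E] [NormedSpace ℂ E] {S : Set E}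
    {G : E → Lam m}
    (hG : ∀ I, DifferentiableOn ℂ (fun v => (thetaBasis m).repr (G v) I) S) :
    DifferentiableOn ℂ G S := by
  have h : G = fun v => ∑ I, (thetaBasis m).repr (G v) I • thetaBasis m I :=
    funext fun v => ((thetaBasis m).sum_repr (G v)).symm
  rw [h]
  exact DifferentiableOn.fun_sum fun I _ => (hG I).smul_const _

theorem isHol_of_differentiableOn {f : Cone U → Lam m} {G : (Fin (n + 1) → ℂ) → Lam m}
    (hG : DifferentiableOn ℂ G (coneSet U)) (h : ∀ v : Cone U, f v = G v.1) : IsHol f := by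
  rw [isHol_iff_exists]
  exact fun I => ⟨fun v => (thetaBasis m).repr (G v) I,
    differentiableOn_linear hG ((thetaBasis m).coord I), fun v => by rw [h]⟩

/-- The extension by zero of a function on a cone. -/
def ext (f : Cone U → Lam m) : (Fin (n + 1) → ℂ) → Lam m := Function.extend Subtype.val f 0

theorem ext_apply (f : Cone U → Lam m) (v : Cone U) : ext f v.1 = f v :=
  Subtype.val_injective.extend_apply f 0 v

theorem IsHol.differentiableOn {f : Cone U → Lam m} (hf : IsHol f) :
    DifferentiableOn ℂ (ext f) (coneSet U) := by
  refine differentiableOn_of_repr fun I => (hf I).congr fun v hv => ?_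
  rw [ext_apply f ⟨v, hv⟩]
  exact (Subtype.val_injective.extend_apply
    (fun v : Cone U => (thetaBasis m).repr (f v) I) 0 ⟨v, hv⟩).symm

theorem IsHol.differentiableAt {f : Cone U → Lam m} (hf : IsHol f) (v : Cone U) :
    DifferentiableAt ℂ (ext f) v.1 :=
  (hf.differentiableOn v.1 v.2).differentiableAt ((isOpen_coneSet U).mem_nhds v.2)

/-- The cone is open, so the extension by zero does not affect derivatives at its points. -/
theorem eventuallyEq_ext {f : Cone U → Lam m} {G : (Fin (n + 1) → ℂ) → Lam m}
    (h : ∀ v : Cone U, f v = G v.1) (v : Cone U) : ext f =ᶠ[nhds v.1] G := by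
  filter_upwards [(isOpen_coneSet U).mem_nhds v.2] with w hw
  rw [ext_apply f ⟨w, hw⟩, h]

/-- Holomorphy is a local property. -/
theorem isHol_of_local {f : Cone U → Lam m} (h : ∀ v : Cone U, ∃ G : (Fin (n + 1) → ℂ) → Lam m,
    DifferentiableAt ℂ G v.1 ∧ ext f =ᶠ[nhds v.1] G) : IsHol f := by
  refine isHol_of_differentiableOn (G := ext f) (fun v hv => ?_) fun v => (ext_apply f v).symm
  obtain ⟨G, hG, he⟩ := h ⟨v, hv⟩
  exact (hG.congr_of_eventuallyEq he).differentiableWithinAt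

/-- The left derivative `∂/∂θₐ` of the Grassmann algebra. -/
def dTheta (a : Fin m) : Lam m →ₗ[ℂ] Lam m :=
  CliffordAlgebra.contractLeft (LinearMap.proj a : Module.Dual ℂ (Fin m → ℂ))

theorem dTheta_algebraMap (a : Fin m) (r : ℂ) : dTheta a (algebraMap ℂ (Lam m) r) = 0 :=
  CliffordAlgebra.contractLeft_algebraMap _ _ r

theorem dTheta_ι_mul (a : Fin m) (w : Fin m → ℂ) (x : Lam m) :
    dTheta a (ExteriorAlgebra.ι ℂ w * x) = w a • x - ExteriorAlgebra.ι ℂ w * dTheta a x :=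
  CliffordAlgebra.contractLeft_ι_mul _ w x

theorem dTheta_one (a : Fin m) : dTheta a (1 : Lam m) = 0 := CliffordAlgebra.contractLeft_one _ _

theorem dTheta_theta (a b : Fin m) : dTheta a (theta b) = if a = b then 1 else 0 := by
  have h := dTheta_ι_mul a (Pi.single b 1) 1
  rw [mul_one, dTheta_one, mul_zero, sub_zero, Pi.single_apply, ite_smul, one_smul, zero_smul] at h
  exact h

@[elab_as_elim]
theorem lam_induction {C : Lam m → Prop} (scalar : ∀ r, C (algebraMap ℂ (Lam m) r))
    (add : ∀ x y, C x → C y → C (x + y))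
    (ι_mul : ∀ x w, C x → C (ExteriorAlgebra.ι ℂ w * x)) (x : Lam m) : C x :=
  CliffordAlgebra.left_induction _ scalar add ι_mul x

theorem inv_algebraMap (r : ℂ) : inv (algebraMap ℂ (Lam m) r) = algebraMap ℂ (Lam m) r :=
  AlgHom.commutes _ r

theorem dTheta_inv (a : Fin m) (x : Lam m) : dTheta a (inv x) = -inv (dTheta a x) := by
  induction x using lam_induction with
  | scalar r => rw [inv_algebraMap, dTheta_algebraMap, map_zero, neg_zero]
  | add x y hx hy => rw [map_add, map_add, map_add, map_add, hx, hy, neg_add]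
  | ι_mul y w hy =>
    rw [map_mul, inv_ι, neg_mul, map_neg, dTheta_ι_mul, dTheta_ι_mul, hy, map_sub, map_smul, map_mul,
      inv_ι, neg_mul, mul_neg]

theorem dTheta_mul (a : Fin m) (x y : Lam m) :
    dTheta a (x * y) = dTheta a x * y + inv x * dTheta a y := by
  induction x using lam_induction with
  | scalar r => rw [inv_algebraMap, dTheta_algebraMap, zero_mul, zero_add, ← Algebra.smul_def,
      map_smul, Algebra.smul_def]
  | add x x' hx hx' => rw [add_mul, map_add, map_add, map_add, hx, hx', add_mul, add_mul]; abel
  | ι_mul x w hx =>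
    rw [mul_assoc, dTheta_ι_mul, dTheta_ι_mul, hx, map_mul, inv_ι, sub_mul, smul_mul_assoc, mul_add,
      neg_mul, neg_mul, mul_assoc, mul_assoc]
    abel

/-- Differentiation lowers the degree in the odd variables by one, which leaves one factor `c` over.
-/
theorem dTheta_scale (a : Fin m) (c : ℂ) (x : Lam m) :
    dTheta a (scale c x) = c • scale c (dTheta a x) := by
  induction x using lam_induction with
  | scalar r => rw [AlgHom.commutes, dTheta_algebraMap, map_zero, smul_zero]
  | add x y hx hy => simp only [map_add, hx, hy, smul_add]
  | ι_mul x w hx =>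
    rw [map_mul, scale_ι, smul_mul_assoc, map_smul, dTheta_ι_mul, dTheta_ι_mul, hx, map_sub, map_smul,
      map_mul, scale_ι, smul_mul_assoc, mul_smul_comm]

theorem differentiable_scale (x : Lam m) : Differentiable ℂ (fun c : ℂ => scale c x) := by
  induction x using lam_induction with
  | scalar r =>
    have : (fun c : ℂ => scale c (algebraMap ℂ (Lam m) r)) = fun _ => algebraMap ℂ (Lam m) r :=
      funext fun c => AlgHom.commutes _ r
    exact this ▸ differentiable_const _
  | add x y hx hy =>
    simp only [map_add]
    exact hx.add hy
  | ι_mul y w hy =>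
    have : (fun c : ℂ => scale c (ExteriorAlgebra.ι ℂ w * y)) =
        fun c => c • LinearMap.mulLeft ℂ (ExteriorAlgebra.ι ℂ w) (scale c y) := funext fun c => by
      rw [map_mul, scale_ι, smul_mul_assoc]; rfl
    refine this ▸ differentiable_id.fun_smul ?_
    exact (LinearMap.mulLeft ℂ (ExteriorAlgebra.ι ℂ w)).toContinuousLinearMap.differentiable.comp hy

theorem differentiableOn_scale {E : Type} [NormedAddCommGroup E] [NormedSpace ℂ E] {S : Set E}
    {c : E → ℂ} (hc : DifferentiableOn ℂ c S) {G : E → Lam m} (hG : DifferentiableOn ℂ G S) :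
    DifferentiableOn ℂ (fun v => scale (c v) (G v)) S := by
  have h : (fun v => scale (c v) (G v)) =
      fun v => ∑ I, (thetaBasis m).repr (G v) I • scale (c v) (thetaBasis m I) :=
    funext fun v => by
      conv_lhs => rw [← (thetaBasis m).sum_repr (G v)]
      rw [map_sum]
      exact Finset.sum_congr rfl fun I _ => map_smul _ _ _
  rw [h]
  exact DifferentiableOn.fun_sum fun I _ => (differentiableOn_linear hG ((thetaBasis m).coord I)).smul
    ((differentiable_scale _).comp_differentiableOn hc)

/-- The multiplication of the Grassmann algebra as a continuous bilinear map. -/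
def mulCLM (m : ℕ) : Lam m →L[ℂ] Lam m →L[ℂ] Lam m :=
  (LinearMap.toContinuousLinearMap.toLinearMap.comp (LinearMap.mul ℂ (Lam m))).toContinuousLinearMap

/-- The partial derivatives `∂/∂θₐ` and `∂/∂zⱼ`. -/
def pd (J : Fin m ⊕ Fin (n + 1)) (f : Cone U → Lam m) (v : Cone U) : Lam m :=
  Sum.elim (fun a => dTheta a (f v))
    (fun j => fderiv ℂ (ext f) v.1 (Pi.single j 1)) J

/-- The sign `(-1)^{|J|}` of a coordinate. -/
def sgn (J : Fin m ⊕ Fin (n + 1)) : ℂ := Sum.elim (fun _ => -1) (fun _ => 1) J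

theorem sgn_mul_sgn (J : Fin m ⊕ Fin (n + 1)) : sgn J * sgn J = 1 := by
  rcases J with a | j <;> simp [sgn]

/-- The automorphism `x ↦ (-1)^{|J||x|} x` of the Grassmann algebra. -/
def invPow (J : Fin m ⊕ Fin (n + 1)) : Lam m →ₐ[ℂ] Lam m :=
  Sum.elim (fun _ => inv) (fun _ => AlgHom.id ℂ (Lam m)) J

theorem fderiv_linear {f : Cone U → Lam m} (hf : IsHol f) (L : Lam m →ₗ[ℂ] Lam m) (v : Cone U)
    (w : Fin (n + 1) → ℂ) :
    fderiv ℂ (ext fun v => L (f v)) v.1 w = L (fderiv ℂ (ext f) v.1 w) := by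
  have h1 : ext (fun v => L (f v)) =ᶠ[nhds v.1] fun v => L (ext f v) :=
    eventuallyEq_ext (fun v => by rw [ext_apply]) v
  rw [h1.fderiv_eq]
  exact congrArg (fun φ => φ w) (L.toContinuousLinearMap.hasFDerivAt.comp v.1
    (hf.differentiableAt v).hasFDerivAt).fderiv

variable (J : Fin m ⊕ Fin (n + 1)) {f g : Cone U → Lam m}

theorem pd_add (hf : IsHol f) (hg : IsHol g) (v : Cone U) :
    pd J (fun v => f v + g v) v = pd J f v + pd J g v := by
  rcases J with a | j
  · exact (dTheta a).map_add (f v) (g v)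
  · have h1 : ext (fun v => f v + g v) =ᶠ[nhds v.1] ext f + ext g :=
      eventuallyEq_ext (fun v => by rw [Pi.add_apply, ext_apply, ext_apply]) v
    change fderiv ℂ (ext fun v => f v + g v) v.1 _ = _
    rw [h1.fderiv_eq, fderiv_add (hf.differentiableAt v) (hg.differentiableAt v)]
    rfl

theorem pd_smul (hf : IsHol f) (c : ℂ) (v : Cone U) :
    pd J (fun v => c • f v) v = c • pd J f v := by
  rcases J with a | j
  · exact (dTheta a).map_smul c (f v)
  · exact fderiv_linear hf (c • LinearMap.id) v _

theorem pd_inv (hf : IsHol f) (v : Cone U) :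
    pd J (fun v => inv (f v)) v = sgn J • inv (pd J f v) := by
  rcases J with a | j
  · refine (dTheta_inv a (f v)).trans ?_
    exact (neg_one_smul ℂ _).symm
  · refine (fderiv_linear hf inv.toLinearMap v _).trans ?_
    exact (one_smul ℂ _).symm

theorem pd_mul (hf : IsHol f) (hg : IsHol g) (v : Cone U) :
    pd J (fun v => f v * g v) v = pd J f v * g v + invPow J (f v) * pd J g v := by
  rcases J with a | j
  · exact dTheta_mul a (f v) (g v)
  · have h1 : ext (fun v => f v * g v) =ᶠ[nhds v.1] fun v => mulCLM m (ext f v) (ext g v) :=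
      eventuallyEq_ext (fun v => by rw [ext_apply, ext_apply]; rfl) v
    change fderiv ℂ (ext fun v => f v * g v) v.1 _ = _
    rw [h1.fderiv_eq, ((mulCLM m).hasFDerivAt_of_bilinear (hf.differentiableAt v).hasFDerivAt
      (hg.differentiableAt v).hasFDerivAt).fderiv]
    change ext f v.1 * fderiv ℂ (ext g) v.1 _ + fderiv ℂ (ext f) v.1 _ * ext g v.1 = _
    rw [ext_apply, ext_apply, add_comm]
    rfl

theorem pd_res (h : V ≤ U) (v : Cone V) :
    pd J (fun v : Cone V => f (v.incl h)) v = pd J f (v.incl h) := by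
  rcases J with a | j
  · rfl
  · have h1 : ext (fun v : Cone V => f (v.incl h)) =ᶠ[nhds v.1] ext f :=
      eventuallyEq_ext (fun v => (ext_apply f (v.incl h)).symm) v
    change fderiv ℂ (ext fun v : Cone V => f (v.incl h)) v.1 _ = _
    rw [h1.fderiv_eq]
    rfl

theorem isHol_pd (hf : IsHol f) : IsHol (pd J f) := by
  rcases J with a | j
  · exact hf.linear (dTheta a)
  · exact isHol_of_differentiableOn
      (differentiableOn_fderiv_apply (isOpen_coneSet U) hf.differentiableOn (Pi.single j 1))
      fun v => rfl

/-- Both kinds of derivatives lower the total degree by one: for `∂/∂θₐ` this is `dTheta_scale`, for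
`∂/∂zⱼ` the homogeneity equation is differentiated in `v`. -/
theorem isHomog_pd {d : ℤ} (hf : IsHol f) (hd : IsHomog d f) : IsHomog (d - 1) (pd J f) := by
  intro c hc v
  rcases J with a | j
  · change dTheta a (f (v.smul c hc)) = _
    rw [hd, map_smul, dTheta_scale, smul_smul, zpow_sub_one₀ hc]
    rfl
  · have h1 : (fun w => ext f (c • w)) =ᶠ[nhds v.1] fun w => c ^ d • scale c⁻¹ (ext f w) := by
      filter_upwards [(isOpen_coneSet U).mem_nhds v.2] with w hw
      rw [ext_apply f ⟨w, hw⟩, ← hd c hc ⟨w, hw⟩, ← ext_apply f]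
      rfl
    have h2 : HasFDerivAt (fun w => ext f (c • w))
        (c • fderiv ℂ (ext f) (v.smul c hc).1) v.1 := by
      have h3 := (hf.differentiableAt (v.smul c hc)).hasFDerivAt.comp v.1
        ((hasFDerivAt_id (𝕜 := ℂ) v.1).const_smul c)
      rw [ContinuousLinearMap.comp_smul, ContinuousLinearMap.comp_id] at h3
      exact h3
    have h4 : HasFDerivAt (fun w => c ^ d • scale c⁻¹ (ext f w)) _ v.1 :=
      ((LinearMap.toContinuousLinearMap (scale (m := m) c⁻¹).toLinearMap).hasFDerivAt.comp v.1
        (hf.differentiableAt v).hasFDerivAt).const_smul (c ^ d)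
    have h5 := congrArg (fun φ => φ (Pi.single j 1))
      ((h2.congr_of_eventuallyEq h1.symm).unique h4)
    have h6 : c • fderiv ℂ (ext f) (v.smul c hc).1 (Pi.single j 1) =
      c ^ d • scale c⁻¹ (fderiv ℂ (ext f) v.1 (Pi.single j 1)) := h5
    change fderiv ℂ (ext f) (v.smul c hc).1 (Pi.single j 1) =
      c ^ (d - 1) • scale c⁻¹ (fderiv ℂ (ext f) v.1 (Pi.single j 1))
    rw [zpow_sub_one₀ hc, mul_comm, mul_smul, ← h6, smul_smul, inv_mul_cancel₀ hc, one_smul]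

/-- `z_j • 1` and `θ_a` as functions on the cone. -/
def coordFun (J : Fin m ⊕ Fin (n + 1)) (v : Cone U) : Lam m :=
  Sum.elim (fun a => theta a) (fun j => v.1 j • 1) J

theorem isHol_coordFun : IsHol (coordFun (U := U) J) := by
  rcases J with a | j
  · exact IsHol.const _
  · exact (IsHol.const 1).coord_smul j

theorem isHomog_coordFun : IsHomog 1 (coordFun (U := U) J) := by
  intro c hc v
  rcases J with a | j
  · change theta a = c ^ (1 : ℤ) • scale c⁻¹ (theta a)
    rw [theta, scale_ι, smul_smul, zpow_one, mul_inv_cancel₀ hc, one_smul]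
  · change (c * v.1 j) • 1 = c ^ (1 : ℤ) • scale c⁻¹ (v.1 j • (1 : Lam m))
    rw [map_smul, map_one, smul_smul, zpow_one]

theorem inv_coordFun (v : Cone U) : inv (coordFun J v) = sgn J • coordFun J v := by
  rcases J with a | j
  · exact (inv_theta a).trans (neg_one_smul ℂ _).symm
  · refine Eq.trans ?_ (one_smul ℂ _).symm
    change inv (v.1 j • (1 : Lam m)) = v.1 j • 1
    rw [map_smul, map_one]

theorem fderiv_scalar {v : Cone U} {φ : (Fin (n + 1) → ℂ) → ℂ} {φ' : (Fin (n + 1) → ℂ) →L[ℂ] ℂ}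
    (hφ : HasFDerivAt φ φ' v.1) (x : Lam m) (w : Fin (n + 1) → ℂ) :
    fderiv ℂ (ext fun v : Cone U => φ v.1 • x) v.1 w = φ' w • x := by
  rw [(eventuallyEq_ext (G := fun v => φ v • x) (fun _ => rfl) v).fderiv_eq,
    (hφ.smul_const x).fderiv]
  rfl

theorem pd_coordFun (K : Fin m ⊕ Fin (n + 1)) (v : Cone U) :
    pd J (coordFun K) v = if J = K then 1 else 0 := by
  rcases J with a | j <;> rcases K with b | k
  · refine (dTheta_theta a b).trans ?_
    simp
  · refine ((dTheta a).map_smul (v.1 k) 1).trans ?_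
    rw [dTheta_one, smul_zero]
    simp
  · have := fderiv_scalar (v := v) (hasFDerivAt_const (1 : ℂ) v.1) (theta (m := m) b) (Pi.single j 1)
    simp only [one_smul] at this
    refine this.trans ?_
    simp
  · have := fderiv_scalar (v := v) (hasFDerivAt_apply (𝕜 := ℂ) k v.1) (1 : Lam m) (Pi.single j 1)
    refine this.trans ?_
    simp [Pi.single_apply, eq_comm]

theorem pd_inv_coord {l : Fin (n + 1)} (hl : ∀ v ∈ coneSet U, v l ≠ 0) (v : Cone U) :
    pd J (fun v : Cone U => (v.1 l)⁻¹ • (1 : Lam m)) v =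
      if J = Sum.inr l then -((v.1 l ^ 2)⁻¹ • 1) else 0 := by
  rcases J with a | j
  · refine ((dTheta a).map_smul (v.1 l)⁻¹ 1).trans ?_
    rw [dTheta_one, smul_zero]
    simp
  · have h1 := (hasDerivAt_inv (hl _ v.2)).comp_hasFDerivAt v.1 (hasFDerivAt_apply (𝕜 := ℂ) l v.1)
    refine (fderiv_scalar (v := v) h1 (1 : Lam m) (Pi.single j 1)).trans ?_
    by_cases h : j = l
    · subst h; simp
    · simp [h]

end norm
end SuperProj
end

noncomputable section
namespace SuperProj

attribute [local instance] lamNorm lamNormedSpace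

theorem scale_one {m : ℕ} (x : Lam m) : scale 1 x = x := by
  have : scale (m := m) 1 = AlgHom.id ℂ (Lam m) := by
    rw [scale, one_smul]; exact ExteriorAlgebra.map_id
  rw [this]; rfl

theorem scale_scale {m : ℕ} (a b : ℂ) (x : Lam m) : scale a (scale b x) = scale (a * b) x := by
  have : (scale a).comp (scale b) = scale (m := m) (a * b) := by
    apply ExteriorAlgebra.hom_ext
    ext w
    simpa [scale_ι, mul_smul] using smul_comm _ _ _
  exact DFunLike.congr_fun this x

namespace SuperPresheaf

variable {n m : ℕ} {U V W : Opens (projSpace n)}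

/-! ### Vector fields -/

/-- The action of a vector field on functions, as a function of the vector field. -/
def act (h : W ≤ U) (f : O m W) : (tangent n m).obj U →ₗ[ℂ] O m W where
  toFun D := D.1.1 ⟨W, h⟩ f
  map_add' _ _ := rfl
  map_smul' _ _ := rfl

theorem act_add (h : W ≤ U) (f g : O m W) (D : (tangent n m).obj U) :
    act h (f + g) D = act h f D + act h g D := map_add (D.1.1 ⟨W, h⟩) f g

theorem act_smul (h : W ≤ U) (c : ℂ) (f : O m W) (D : (tangent n m).obj U) :
    act h (c • f) D = c • act h f D := map_smul (D.1.1 ⟨W, h⟩) c f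

theorem act_neg (h : W ≤ U) (f : O m W) (D : (tangent n m).obj U) :
    act h (-f) D = -act h f D := map_neg (D.1.1 ⟨W, h⟩) f

theorem act_sum (h : W ≤ U) {ι : Type} (s : Finset ι) (f : ι → O m W) (D : (tangent n m).obj U) :
    act h (∑ i ∈ s, f i) D = ∑ i ∈ s, act h (f i) D := map_sum (D.1.1 ⟨W, h⟩) f s

theorem act_res (h : W ≤ U) (h' : V ≤ W) (f : O m W) (D : (tangent n m).obj U) :
    act (h'.trans h) (O.res h' f) D = O.res h' (act h f D) :=
  D.1.2 ⟨V, h'.trans h⟩ ⟨W, h⟩ h' f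

theorem act_osmul (h : W ≤ U) (a : O m U) (f : O m W) (D : (tangent n m).obj U) :
    act h f (a • D) = O.res h a * act h f D := rfl

theorem act_par (h : W ≤ U) (f : O m W) (D : (tangent n m).obj U) :
    act h f ((tangent n m).par D) = O.par (act h (O.par f) D) := rfl

theorem act_tangent_res (h : W ≤ U) (h' : V ≤ W) (f : O m V) (D : (tangent n m).obj U) :
    act h' f ((tangent n m).res h D) = act (h'.trans h) f D := rfl

theorem act_mul_even (h : W ≤ U) {f : O m W} (hf : O.par f = f) (g : O m W)
    (D : (tangent n m).obj U) : act h (f * g) D = act h f D * g + f * act h g D :=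
  (D.2 ⟨W, h⟩ f g).1 hf

theorem act_mul_odd (h : W ≤ U) {f : O m W} (hf : O.par f = -f) (g : O m W)
    (D : (tangent n m).obj U) :
    act h (f * g) D = act h f D * g + f * O.par (act h (O.par g) D) :=
  (D.2 ⟨W, h⟩ f g).2 hf

theorem act_one (h : W ≤ U) (D : (tangent n m).obj U) : act h 1 D = 0 := by
  have h1 := act_mul_even h (f := 1) (map_one _) 1 D
  rw [mul_one, mul_one, one_mul] at h1
  exact left_eq_add.1 h1

theorem tangent_ext {D E : (tangent n m).obj U}
    (h : ∀ W (hW : W ≤ U) (f : O m W), act hW f D = act hW f E) : D = E :=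
  Subtype.ext (Subtype.ext (funext fun W => LinearMap.ext fun f => h W.1 W.2 f))

/-- The vector fields `z_l ∂/∂z_j` and `z_l ∂/∂θ_a`, as endomorphisms of `𝒪(U)`. -/
def fieldApp (l : Fin (n + 1)) (J : Fin m ⊕ Fin (n + 1)) : O m U →ₗ[ℂ] O m U where
  -- The derivative has degree `-1`; the factor `z_l` restores degree zero.
  toFun f := ⟨fun v => v.1 l • pd J f.1 v, (isHol_pd J f.2.1).coord_smul l, fun c hc v => by
    change (c * v.1 l) • pd J f.1 (v.smul c hc) = c ^ (0 : ℤ) • scale c⁻¹ (v.1 l • pd J f.1 v)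
    rw [isHomog_pd J f.2.1 f.2.2 c hc v, zero_sub, zpow_neg_one, zpow_zero, one_smul, map_smul,
      smul_smul, mul_right_comm, mul_inv_cancel₀ hc, one_mul]⟩
  map_add' f g := Subtype.ext (funext fun v => by
    change v.1 l • pd J (fun v => f.1 v + g.1 v) v = v.1 l • pd J f.1 v + v.1 l • pd J g.1 v
    rw [pd_add J f.2.1 g.2.1, smul_add])
  map_smul' c f := Subtype.ext (funext fun v => by
    change v.1 l • pd J (fun v => c • f.1 v) v = c • v.1 l • pd J f.1 v
    rw [pd_smul J f.2.1, smul_comm])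

theorem invPow_apply_even (J : Fin m ⊕ Fin (n + 1)) {x : Lam m} (hx : inv x = x) :
    invPow J x = x := by
  rcases J with a | j
  · exact hx
  · rfl

theorem invPow_apply_odd (J : Fin m ⊕ Fin (n + 1)) {x : Lam m} (hx : inv x = -x) :
    invPow J x = sgn J • x := by
  rcases J with a | j
  · exact hx.trans (neg_one_smul ℂ x).symm
  · exact (one_smul ℂ x).symm

/-- The vector fields `z_l ∂/∂z_j` and `z_l ∂/∂θ_a`. -/
def field (U : Opens (projSpace n)) (l : Fin (n + 1)) (J : Fin m ⊕ Fin (n + 1)) :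
    (tangent n m).obj U :=
  ⟨⟨fun W => fieldApp (U := W.1) l J, fun V W h (f : O m W.1) => Subtype.ext (funext fun v =>
    congrArg (v.1 l • ·) (pd_res J h v))⟩, fun W (f : O m W.1) (g : O m W.1) => by
    constructor
    · intro hf
      refine Subtype.ext (funext fun v => ?_)
      have h1 : inv (f.1 v) = f.1 v := congrFun (congrArg Subtype.val hf) v
      change v.1 l • pd J (fun v => f.1 v * g.1 v) v =
        (v.1 l • pd J f.1 v) * g.1 v + f.1 v * (v.1 l • pd J g.1 v)
      rw [pd_mul J f.2.1 g.2.1, invPow_apply_even J h1, smul_add, smul_mul_assoc, mul_smul_comm]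
    · intro hf
      refine Subtype.ext (funext fun v => ?_)
      have h1 : inv (f.1 v) = -f.1 v := congrFun (congrArg Subtype.val hf) v
      change v.1 l • pd J (fun v => f.1 v * g.1 v) v =
        (v.1 l • pd J f.1 v) * g.1 v + f.1 v * inv (v.1 l • pd J (fun v => inv (g.1 v)) v)
      rw [pd_mul J f.2.1 g.2.1, pd_inv J g.2.1, invPow_apply_odd J h1, smul_add, smul_mul_assoc,
        map_smul, map_smul, inv_inv, mul_smul_comm, mul_smul_comm, smul_mul_assoc]⟩

theorem act_field (h : W ≤ U) (l : Fin (n + 1)) (J : Fin m ⊕ Fin (n + 1)) (f : O m W)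
    (v : Cone W) : (act h f (field U l J)).1 v = v.1 l • pd J f.1 v := rfl

theorem field_par (l : Fin (n + 1)) (J : Fin m ⊕ Fin (n + 1)) :
    (tangent n m).par (field U l J) = sgn J • field U l J :=
  tangent_ext fun W h f => by
    rw [act_par, map_smul]
    refine Subtype.ext (funext fun v => ?_)
    change inv (v.1 l • pd J (fun v => inv (f.1 v)) v) = sgn J • v.1 l • pd J f.1 v
    rw [pd_inv J f.2.1, map_smul, map_smul, inv_inv, smul_comm]

/-! ### Affine coordinates -/

/-- The affine coordinates `z_j / z_l` and `θ_a / z_l`. -/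
def coord {l : Fin (n + 1)} (hl : ∀ v ∈ coneSet U, v l ≠ 0) (J : Fin m ⊕ Fin (n + 1)) : O m U :=
  ⟨fun v => (v.1 l)⁻¹ • coordFun J v, by
    have := isHol_coord_zpow hl (-1) (isHol_coordFun (m := m) J)
    simpa only [zpow_neg_one] using this, fun c hc v => by
    change (c * v.1 l)⁻¹ • coordFun J (v.smul c hc) =
      c ^ (0 : ℤ) • scale c⁻¹ ((v.1 l)⁻¹ • coordFun J v)
    rw [isHomog_coordFun J c hc v, zpow_zero, zpow_one, one_smul, map_smul, smul_smul, mul_inv_rev,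
      inv_mul_cancel_right₀ hc]⟩

theorem coord_res {l : Fin (n + 1)} (hl : ∀ v ∈ coneSet U, v l ≠ 0) (h : V ≤ U)
    (J : Fin m ⊕ Fin (n + 1)) :
    O.res h (coord hl J) = coord (fun v hv => hl v (coneSet_mono h hv)) J :=
  Subtype.ext (funext fun v => by rcases J with a | j <;> rfl)

theorem coord_par {l : Fin (n + 1)} (hl : ∀ v ∈ coneSet U, v l ≠ 0) (J : Fin m ⊕ Fin (n + 1)) :
    O.par (coord hl J) = sgn J • coord hl J := Subtype.ext (funext fun v => by
  change inv ((v.1 l)⁻¹ • coordFun J v) = sgn J • (v.1 l)⁻¹ • coordFun J v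
  rw [map_smul, inv_coordFun, smul_comm])

theorem coord_self {l : Fin (n + 1)} (hl : ∀ v ∈ coneSet U, v l ≠ 0) :
    coord (m := m) hl (Sum.inr l) = 1 := Subtype.ext (funext fun v => by
  change (v.1 l)⁻¹ • v.1 l • (1 : Lam m) = 1
  rw [smul_smul, inv_mul_cancel₀ (hl _ v.2), one_smul])

/-- The subtracted term comes from differentiating the denominator `z_l`. -/
theorem act_coord_field {l : Fin (n + 1)} (hl : ∀ v ∈ coneSet U, v l ≠ 0)
    (J K : Fin m ⊕ Fin (n + 1)) : act le_rfl (coord hl K) (field U l J) =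
      (if J = K then 1 else 0) - (if J = Sum.inr l then coord hl K else 0) := by
  refine Subtype.ext (funext fun v => ?_)
  have hv := hl _ v.2
  have h1 : (coord hl K).1 = fun v : Cone U => ((v.1 l)⁻¹ • (1 : Lam m)) * coordFun K v :=
    funext fun v => (smul_one_mul _ _).symm
  have h2 : IsHol fun v : Cone U => (v.1 l)⁻¹ • (1 : Lam m) := by
    have := isHol_coord_zpow hl (-1) (IsHol.const (1 : Lam m))
    simpa only [zpow_neg_one] using this
  rw [act_field, h1, pd_mul J h2 (isHol_coordFun K), pd_inv_coord J hl, pd_coordFun, map_smul,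
    map_one]
  have h3 : ((if J = K then (1 : O m U) else 0) - if J = Sum.inr l then coord hl K else 0).1 v =
      (if J = K then (1 : Lam m) else 0) - if J = Sum.inr l then (v.1 l)⁻¹ • coordFun K v else 0 := by
    split_ifs <;> rfl
  rw [h3, smul_one_mul, smul_add, smul_smul (v.1 l), mul_inv_cancel₀ hv, one_smul, add_comm,
    sub_eq_add_neg]
  congr 1
  split_ifs with h
  · rw [neg_mul, smul_one_mul, smul_neg, smul_smul]
    congr 2
    field_simp
  · rw [zero_mul, smul_zero, neg_zero]

/-- The function on the cone that is given by `ψ` in affine coordinates. -/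
def ofAffine {l : Fin (n + 1)} (hl : ∀ v ∈ coneSet U, v l ≠ 0) (ψ : (Fin (n + 1) → ℂ) → Lam m)
    (hψ : DifferentiableOn ℂ (fun v : Fin (n + 1) → ℂ => ψ ((v l)⁻¹ • v)) (coneSet U)) : O m U :=
  -- Scaling by `z_l⁻¹` replaces each `θ_a` by `θ_a / z_l`, which makes the total degree zero.
  ⟨fun v => scale (v.1 l)⁻¹ (ψ ((v.1 l)⁻¹ • v.1)),
    isHol_of_differentiableOn (differentiableOn_scale
      ((differentiableOn_apply l _).inv hl) hψ) fun _ => rfl, fun c hc v => by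
    change scale (c * v.1 l)⁻¹ (ψ ((c * v.1 l)⁻¹ • c • v.1)) =
      c ^ (0 : ℤ) • scale c⁻¹ (scale (v.1 l)⁻¹ (ψ ((v.1 l)⁻¹ • v.1)))
    rw [zpow_zero, one_smul, scale_scale, smul_smul, mul_inv_rev, inv_mul_cancel_right₀ hc,
      mul_comm]⟩

/-- The function on the cone that is constant in affine coordinates. -/
def constSec {l : Fin (n + 1)} (hl : ∀ v ∈ coneSet U, v l ≠ 0) (x : Lam m) : O m U :=
  ofAffine hl (fun _ => x) (differentiableOn_const _)

/-- Such a function is a polynomial in the `θ_a / z_l`, and `D` kills these. The odd Leibniz rule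
involves `D` of the parity conjugate, so the induction carries `inv x` along. -/
theorem act_constSec {l : Fin (n + 1)} (hl : ∀ v ∈ coneSet W, v l ≠ 0) (h : W ≤ U)
    {D : (tangent n m).obj U} (hD : ∀ a, act h (coord hl (Sum.inl a)) D = 0) (x : Lam m) :
    act h (constSec hl x) D = 0 ∧ act h (constSec hl (inv x)) D = 0 := by
  have hadd : ∀ x y : Lam m, constSec hl (x + y) = constSec hl x + constSec hl y := fun x y =>
    Subtype.ext (funext fun v => map_add (scale (v.1 l)⁻¹) x y)
  have hmul : ∀ x y : Lam m, constSec hl (x * y) = constSec hl x * constSec hl y := fun x y =>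
    Subtype.ext (funext fun v => map_mul (scale (v.1 l)⁻¹) x y)
  have hpar : ∀ x : Lam m, O.par (constSec hl x) = constSec hl (inv x) := fun x =>
    Subtype.ext (funext fun v => (scale_inv (v.1 l)⁻¹ x).symm)
  have hneg : ∀ x : Lam m, constSec hl (-x) = -constSec hl x := fun x =>
    Subtype.ext (funext fun v => map_neg (scale (v.1 l)⁻¹) x)
  have hgen : ∀ w : Fin m → ℂ, act h (constSec hl (ExteriorAlgebra.ι ℂ w)) D = 0 := by
    intro w
    have h1 : constSec hl (ExteriorAlgebra.ι ℂ w) = ∑ a, w a • coord hl (Sum.inl a) := by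
      refine Subtype.ext (funext fun v => ?_)
      have h2 : (∑ a, w a • coord hl (Sum.inl a)).1 v = ∑ a, w a • (v.1 l)⁻¹ • theta a := by
        change ((Pi.evalAddMonoidHom (fun _ : Cone W => Lam m) v).comp
          (O m W).subtype.toAddMonoidHom) (∑ a, w a • coord hl (Sum.inl a)) = _
        rw [map_sum]; rfl
      rw [h2]
      change scale (v.1 l)⁻¹ (ExteriorAlgebra.ι ℂ w) = _
      rw [scale_ι]
      conv_lhs => rw [pi_eq_sum_univ' w, map_sum, Finset.smul_sum]
      refine Finset.sum_congr rfl fun a _ => ?_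
      rw [map_smul, smul_comm]
      rfl
    rw [h1, act_sum]
    exact Finset.sum_eq_zero fun a _ => by rw [act_smul, hD, smul_zero]
  have hodd : ∀ w : Fin m → ℂ, O.par (constSec hl (ExteriorAlgebra.ι ℂ w)) =
      -constSec hl (ExteriorAlgebra.ι ℂ w) := fun w => by rw [hpar, inv_ι, hneg]
  induction x using lam_induction with
  | scalar r =>
    rw [inv_algebraMap, and_self]
    have : constSec hl (algebraMap ℂ (Lam m) r) = r • 1 := Subtype.ext (funext fun v => by
      refine (AlgHom.commutes (scale (v.1 l)⁻¹) r).trans ?_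
      exact Algebra.algebraMap_eq_smul_one r)
    rw [this, act_smul, act_one, smul_zero]
  | add x y hx hy =>
    rw [map_add, hadd, hadd, act_add, act_add, hx.1, hx.2, hy.1, hy.2, add_zero, and_self]
  | ι_mul x w hx =>
    rw [map_mul, inv_ι, neg_mul, hneg, act_neg, neg_eq_zero, hmul, hmul, act_mul_odd h (hodd w),
      act_mul_odd h (hodd w), hpar, hpar, inv_inv, hx.1, hx.2, hgen, zero_mul, zero_mul,
      map_zero, mul_zero, add_zero, and_self]

/-- A vector field is determined by its values on the affine coordinates. -/
theorem tangent_eq_zero {l : Fin (n + 1)} (hl : ∀ v ∈ coneSet U, v l ≠ 0)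
    {D : (tangent n m).obj U} (hD : ∀ J, act le_rfl (coord hl J) D = 0) : D = 0 := by
  refine tangent_ext fun W hW f => Subtype.ext (funext fun v₀ => ?_)
  rw [map_zero]
  have hlW : ∀ v ∈ coneSet W, v l ≠ 0 := fun v hv => hl v (coneSet_mono hW hv)
  have h0 := hlW _ v₀.2
  -- `x₀` is the representative of the point with `l`-th coordinate `1`.
  set x₀ : Fin (n + 1) → ℂ := (v₀.1 l)⁻¹ • v₀.1 with hx₀
  have hx₀W : x₀ ∈ coneSet W := smul_mem_coneSet v₀.2 (inv_ne_zero h0)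
  obtain ⟨ε, hε, hball⟩ := Metric.isOpen_iff.1 (isOpen_coneSet W) x₀ hx₀W
  -- The cone over those points whose normalized representative lies in a ball around `x₀`; on this
  -- ball Hadamard's lemma applies.
  let S : Set (Fin (n + 1) → ℂ) := {v | v l ≠ 0} ∩ (fun v => (v l)⁻¹ • v) ⁻¹' Metric.ball x₀ ε
  have hcont : ContinuousOn (fun v : Fin (n + 1) → ℂ => (v l)⁻¹ • v) {v | v l ≠ 0} :=
    ((continuous_apply l).continuousOn.inv₀ fun v hv => hv).smul continuousOn_id
  have hS : IsOpen S := hcont.isOpen_inter_preimage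
    (isOpen_ne_fun (continuous_apply l) continuous_const) Metric.isOpen_ball
  let W' : Opens (projSpace n) := ofCone S hS fun v hv c hc => ⟨mul_ne_zero hc hv.1, by
    change (c * v l)⁻¹ • c • v ∈ Metric.ball x₀ ε
    rw [smul_smul, mul_inv_rev, inv_mul_cancel_right₀ hc]
    exact hv.2⟩
  have hW'S : ∀ v ∈ coneSet W', v l ≠ 0 ∧ (v l)⁻¹ • v ∈ Metric.ball x₀ ε := fun v hv =>
    (mem_coneSet_ofCone.1 hv).2
  have hle : W' ≤ W := by
    rintro _ ⟨v, hv, hvS, rfl⟩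
    have h1 := smul_mem_coneSet (hball hvS.2) hvS.1
    simp only [smul_smul] at h1
    rw [mul_inv_cancel₀ hvS.1, one_smul] at h1
    exact h1.2
  have hl' : ∀ v ∈ coneSet W', v l ≠ 0 := fun v hv => (hW'S v hv).1
  have hv₀ : v₀.1 ∈ coneSet W' :=
    mem_coneSet_ofCone.2 ⟨v₀.2.1, h0, Metric.mem_ball_self hε⟩
  let v₀' : Cone W' := ⟨v₀.1, hv₀⟩
  have hcoord : ∀ J, act (hle.trans hW) (coord hl' J) D = 0 := fun J => by
    rw [← coord_res hl (hle.trans hW), act_res le_rfl, hD, map_zero]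
  have hF := f.2.1.differentiableOn.mono hball
  obtain ⟨H, hH, hfH⟩ := exists_hadamard hF
  have hdiff : DifferentiableOn ℂ (fun v : Fin (n + 1) → ℂ => (v l)⁻¹ • v) (coneSet W') :=
    ((differentiableOn_apply l _).inv hl').smul differentiableOn_id
  let h : Fin (n + 1) → O m W' := fun j => ofAffine hl' (H j)
    ((hH j).comp hdiff fun v hv => (hW'S v hv).2)
  -- Hadamard's lemma at `x₀` for the values of `f` on normalized vectors; homogeneity of degree
  -- zero recovers `f` from these by rescaling.
  have hsum : O.res hle f = constSec hl' (ext f.1 x₀) +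
      ∑ j, (coord hl' (Sum.inr j) - x₀ j • 1) * h j := by
    refine Subtype.ext (funext fun v => ?_)
    have h2 : (∑ j, (coord hl' (Sum.inr j) - x₀ j • 1) * h j).1 v =
        ∑ j, ((v.1 l)⁻¹ • v.1 j • (1 : Lam m) - x₀ j • 1) *
          scale (v.1 l)⁻¹ (H j ((v.1 l)⁻¹ • v.1)) := by
      change ((Pi.evalAddMonoidHom (fun _ : Cone W' => Lam m) v).comp
        (O m W').subtype.toAddMonoidHom) (∑ j, (coord hl' (Sum.inr j) - x₀ j • 1) * h j) = _
      rw [map_sum]; rfl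
    change f.1 (v.incl hle) = scale (v.1 l)⁻¹ (ext f.1 x₀) + (∑ j, (coord hl' (Sum.inr j) -
      x₀ j • 1) * h j).1 v
    have hv := hW'S _ v.2
    have h3 : f.1 (v.incl hle) = scale (v.1 l)⁻¹ (ext f.1 ((v.1 l)⁻¹ • v.1)) := by
      have h4 := f.2.2 (v.1 l)⁻¹ (inv_ne_zero hv.1) (v.incl hle)
      rw [zpow_zero, one_smul] at h4
      have h5 := ext_apply f.1 ((v.incl hle).smul (v.1 l)⁻¹ (inv_ne_zero hv.1))
      change ext f.1 ((v.1 l)⁻¹ • v.1) = _ at h5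
      rw [h5, h4, scale_scale, mul_inv_cancel₀ (inv_ne_zero hv.1), scale_one]
    rw [h2, h3, hfH _ hv.2, map_add, map_sum]
    congr 1
    refine Finset.sum_congr rfl fun j _ => ?_
    rw [map_smul, smul_smul, ← sub_smul, smul_one_mul]
    rfl
  have hfin : act (hle.trans hW) (O.res hle f) D =
      ∑ j, (coord hl' (Sum.inr j) - x₀ j • 1) * act (hle.trans hW) (h j) D := by
    rw [hsum, act_add, (act_constSec hl' (hle.trans hW) (fun a => hcoord _) _).1, zero_add, act_sum]
    refine Finset.sum_congr rfl fun j _ => ?_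
    have h1 : O.par (coord (m := m) hl' (Sum.inr j) - x₀ j • 1) =
        coord hl' (Sum.inr j) - x₀ j • 1 := by
      rw [map_sub, coord_par, map_smul, map_one]
      congr 1
      exact one_smul ℂ _
    have h2 : act (hle.trans hW) (coord (m := m) hl' (Sum.inr j) - x₀ j • 1) D = 0 := by
      rw [sub_eq_add_neg, act_add, act_neg, act_smul, act_one, hcoord, smul_zero, neg_zero, add_zero]
    rw [act_mul_even _ h1, h2, zero_mul, zero_add]
  rw [act_res hW hle] at hfin
  have h6 : (act hW f D).1 v₀ = (∑ j, (coord hl' (Sum.inr j) - x₀ j • 1) *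
      act (hle.trans hW) (h j) D).1 v₀' := congrFun (congrArg Subtype.val hfin) v₀'
  rw [h6]
  change ((Pi.evalAddMonoidHom (fun _ : Cone W' => Lam m) v₀').comp
    (O m W').subtype.toAddMonoidHom) (∑ j, (coord hl' (Sum.inr j) - x₀ j • 1) *
      act (hle.trans hW) (h j) D) = 0
  rw [map_sum]
  refine Finset.sum_eq_zero fun j _ => ?_
  -- At `v₀` the factor `z_j / z_l - x₀ j` is zero, because `x₀` was defined by these quotients.
  change ((v₀.1 l)⁻¹ • v₀.1 j • (1 : Lam m) - ((v₀.1 l)⁻¹ * v₀.1 j) • 1) * _ = 0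
  rw [smul_smul, sub_self, zero_mul]

/-- Both sides agree on the affine coordinates. The correction term of `act_coord_field` contributes
the value of `D` on `z_l / z_l = 1`, which is zero. -/
theorem eq_sum_field {l : Fin (n + 1)} (hl : ∀ v ∈ coneSet U, v l ≠ 0)
    (D : (tangent n m).obj U) : D = ∑ J, act le_rfl (coord hl J) D • field U l J := by
  rw [← sub_eq_zero]
  refine tangent_eq_zero hl fun K => ?_
  rw [map_sub, map_sum, sub_eq_zero]
  have h1 : ∀ J, act le_rfl (coord hl K) (act le_rfl (coord hl J) D • field U l J) =
      (if J = K then act le_rfl (coord hl J) D else 0) -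
        (if J = Sum.inr l then act le_rfl (coord hl J) D * coord hl K else 0) := fun J => by
    rw [act_osmul, act_coord_field]
    change act le_rfl (coord hl J) D * _ = _
    rw [mul_sub, mul_ite, mul_ite, mul_one, mul_zero]
  simp only [h1, Finset.sum_sub_distrib, Finset.sum_ite_eq', Finset.mem_univ, if_true]
  rw [coord_self, act_one, zero_mul, sub_zero]

/-- The Euler vector field kills functions of degree zero. On the affine coordinates the two terms
of `act_coord_field` cancel because `z_l / z_l = 1`. -/
theorem euler_field {l : Fin (n + 1)} (hl : ∀ v ∈ coneSet U, v l ≠ 0) :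
    ∑ J, coord hl J • field (m := m) U l J = 0 := by
  refine tangent_eq_zero hl fun K => ?_
  rw [map_sum]
  have h1 : ∀ J, act le_rfl (coord hl K) (coord hl J • field U l J) =
      (if J = K then coord hl J else 0) -
        (if J = Sum.inr l then coord hl J * coord hl K else 0) := fun J => by
    rw [act_osmul, act_coord_field]
    change coord hl J * _ = _
    rw [mul_sub, mul_ite, mul_ite, mul_one, mul_zero]
  simp only [h1, Finset.sum_sub_distrib, Finset.sum_ite_eq', Finset.mem_univ, if_true]
  rw [coord_self, one_mul, sub_self]

theorem coord_smul_field {l : Fin (n + 1)} (hl : ∀ v ∈ coneSet U, v l ≠ 0) (l' : Fin (n + 1))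
    (J : Fin m ⊕ Fin (n + 1)) : coord (m := m) hl (Sum.inr l') • field U l J = field U l' J :=
  tangent_ext fun W h f => by
    rw [act_osmul]
    refine Subtype.ext (funext fun v => ?_)
    change ((v.1 l)⁻¹ • v.1 l' • (1 : Lam m)) * (v.1 l • pd J f.1 v) = v.1 l' • pd J f.1 v
    rw [smul_smul, smul_one_mul, smul_smul, mul_right_comm,
      inv_mul_cancel₀ (hl _ (coneSet_mono h v.2)), one_mul]

end SuperPresheaf
end SuperProj
end

noncomputable section
namespace SuperProj
namespace SuperPresheaf

variable {n m : ℕ} {U V W : Opens (projSpace n)}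

/-! ### One-forms -/

/-- The pairing of a one-form with a vector field. -/
def pair (ω : (piCotangent n m).obj U) (h : W ≤ U) : (tangent n m).obj W →ₗ[ℂ] O m W :=
  ω.1.1 ⟨W, h⟩

theorem pair_add (ω η : (piCotangent n m).obj U) (h : W ≤ U) (D : (tangent n m).obj W) :
    pair (ω + η) h D = pair ω h D + pair η h D := rfl

theorem pair_osmul (a : O m U) (ω : (piCotangent n m).obj U) (h : W ≤ U)
    (D : (tangent n m).obj W) : pair (a • ω) h D = O.res h a * pair ω h D := rfl

theorem pair_par (ω : (piCotangent n m).obj U) (h : W ≤ U) (D : (tangent n m).obj W) :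
    pair ((piCotangent n m).par ω) h D = -O.par (pair ω h ((tangent n m).par D)) := rfl

theorem pair_form_res (ω : (piCotangent n m).obj U) (h : W ≤ U) (h' : V ≤ W)
    (D : (tangent n m).obj V) : pair ((piCotangent n m).res h ω) h' D = pair ω (h'.trans h) D := rfl

theorem pair_res (ω : (piCotangent n m).obj U) (h : W ≤ U) (h' : V ≤ W)
    (D : (tangent n m).obj W) :
    pair ω (h'.trans h) ((tangent n m).res h' D) = O.res h' (pair ω h D) :=
  ω.1.2 ⟨V, h'.trans h⟩ ⟨W, h⟩ h' D

theorem pair_smul_even (ω : (piCotangent n m).obj U) (h : W ≤ U) {a : O m W} (ha : O.par a = a)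
    (D : (tangent n m).obj W) : pair ω h (a • D) = a * pair ω h D :=
  (ω.2 ⟨W, h⟩ a D).1 ha

theorem pair_smul_odd (ω : (piCotangent n m).obj U) (h : W ≤ U) {a : O m W} (ha : O.par a = -a)
    (D : (tangent n m).obj W) : pair ω h (a • D) = a * O.par (pair ω h ((tangent n m).par D)) :=
  (ω.2 ⟨W, h⟩ a D).2 ha

theorem form_ext {ω η : (piCotangent n m).obj U}
    (h : ∀ W (hW : W ≤ U) D, pair ω hW D = pair η hW D) : ω = η :=
  Subtype.ext (Subtype.ext (funext fun W => LinearMap.ext fun D => h W.1 W.2 D))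

theorem parity_induction {C : O m U → Prop} (even : ∀ a, O.par a = a → C a)
    (odd : ∀ a, O.par a = -a → C a) (add : ∀ a b, C a → C b → C (a + b)) (a : O m U) : C a := by
  rw [eq_half_add a (O.par a)]
  refine add _ _ (even _ ?_) (odd _ ?_)
  · rw [map_smul, map_add, O.par_par, add_comm]
  · rw [map_smul, map_sub, O.par_par, ← smul_neg, neg_sub]

/-- The automorphism `a ↦ (-1)^{|J||a|} a` of `𝒪`. -/
def parPow (J : Fin m ⊕ Fin (n + 1)) : O m U →ₐ[ℂ] O m U :=
  Sum.elim (fun _ => O.par) (fun _ => AlgHom.id ℂ (O m U)) J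

theorem parPow_even (J : Fin m ⊕ Fin (n + 1)) {a : O m U} (ha : O.par a = a) : parPow J a = a := by
  rcases J with j | j
  · exact ha
  · rfl

theorem parPow_odd (J : Fin m ⊕ Fin (n + 1)) {a : O m U} (ha : O.par a = -a) :
    parPow J a = sgn J • a := by
  rcases J with j | j
  · exact ha.trans (neg_one_smul ℂ a).symm
  · exact (one_smul ℂ a).symm

theorem par_parPow (J : Fin m ⊕ Fin (n + 1)) (a : O m U) :
    O.par (parPow J a) = parPow J (O.par a) := by
  rcases J with j | j <;> rfl

theorem parPow_res (J : Fin m ⊕ Fin (n + 1)) (h : V ≤ U) (a : O m U) :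
    O.res h (parPow J a) = parPow J (O.res h a) := by
  rcases J with j | j <;> rfl

theorem parPow_coord {l : Fin (n + 1)} (hl : ∀ v ∈ coneSet U, v l ≠ 0)
    (J : Fin m ⊕ Fin (n + 1)) : parPow J (coord hl J) = sgn J • coord hl J := by
  rcases J with j | j
  · exact coord_par hl _
  · exact (one_smul ℂ _).symm

/-- With the scalar written on the right, the parity of `ω` drops out of the sign: it enters once
through superlinearity and once through commuting `a` with the value. -/
theorem pair_smul_field (ω : (piCotangent n m).obj U) (h : W ≤ U) (a : O m W) (l : Fin (n + 1))
    (J : Fin m ⊕ Fin (n + 1)) :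
    pair ω h (a • field W l J) = pair ω h (field W l J) * parPow J a := by
  induction a using parity_induction with
  | even a ha => rw [pair_smul_even ω h ha, parPow_even J ha, O.even_comm ha]
  | odd a ha =>
    rw [pair_smul_odd ω h ha, field_par, map_smul, map_smul, parPow_odd J ha, mul_smul_comm,
      mul_smul_comm, O.odd_comm ha]
  | add a b ha hb => rw [add_smul, map_add, map_add, ha, hb, mul_add]

theorem pair_field_res (ω : (piCotangent n m).obj U) (h : W ≤ U) (h' : V ≤ W) (l : Fin (n + 1))
    (J : Fin m ⊕ Fin (n + 1)) :
    pair ω (h'.trans h) (field V l J) = O.res h' (pair ω h (field W l J)) :=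
  pair_res ω h h' (field W l J)

/-- The fields `z_l ∂_J` generate the vector fields over every open subset of `U`. -/
theorem form_ext_field {l : Fin (n + 1)} (hl : ∀ v ∈ coneSet U, v l ≠ 0)
    {ω η : (piCotangent n m).obj U}
    (h : ∀ J, pair ω le_rfl (field U l J) = pair η le_rfl (field U l J)) : ω = η := by
  refine form_ext fun W hW D => ?_
  rw [eq_sum_field (fun v hv => hl v (coneSet_mono hW hv)) D, map_sum, map_sum]
  refine Finset.sum_congr rfl fun J _ => ?_
  rw [pair_smul_field, pair_smul_field, pair_field_res ω le_rfl hW, pair_field_res η le_rfl hW, h]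

/-- The form is evaluated on the relation `euler_field`; the signs arise because the `J`-th
coordinate has the same parity as `∂_J`. -/
theorem sum_pair_mul_coord {l : Fin (n + 1)} (hl : ∀ v ∈ coneSet U, v l ≠ 0)
    (ω : (piCotangent n m).obj U) :
    ∑ J, (sgn J • pair ω le_rfl (field U l J)) * coord hl J = 0 := by
  have h := congrArg (pair ω le_rfl) (euler_field (m := m) hl)
  rw [map_sum, map_zero] at h
  rw [← h]
  refine Finset.sum_congr rfl fun J _ => ?_
  rw [pair_smul_field, parPow_coord, smul_mul_assoc, mul_smul_comm]

/-- The pairing with the one-form that has the values `X` on the vector fields `z_l ∂/∂z_j` and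
`z_l ∂/∂θ_a`. -/
def formOfApp {l : Fin (n + 1)} (hl : ∀ v ∈ coneSet U, v l ≠ 0) (X : Fin m ⊕ Fin (n + 1) → O m U)
    (h : W ≤ U) : (tangent n m).obj W →ₗ[ℂ] O m W where
  toFun D := ∑ J, O.res h (X J) *
    parPow J (act le_rfl (coord (fun v hv => hl v (coneSet_mono h hv)) J) D)
  map_add' D E := by simp only [map_add, mul_add, Finset.sum_add_distrib]
  map_smul' c D := by simp only [map_smul, mul_smul_comm, Finset.smul_sum, RingHom.id_apply]

/-- The one-form with given values on the vector fields `z_l ∂/∂z_j` and `z_l ∂/∂θ_a`. -/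
def formOf {l : Fin (n + 1)} (hl : ∀ v ∈ coneSet U, v l ≠ 0) (X : Fin m ⊕ Fin (n + 1) → O m U) :
    (piCotangent n m).obj U :=
  ⟨⟨fun W => formOfApp hl X W.2,
    fun V W h (D : (tangent n m).obj W.1) => by
      change (∑ J, O.res V.2 (X J) *
        parPow J (act le_rfl (coord (fun v hv => hl v (coneSet_mono V.2 hv)) J)
          ((tangent n m).res h D))) = O.res h (∑ J, O.res W.2 (X J) *
        parPow J (act le_rfl (coord (fun v hv => hl v (coneSet_mono W.2 hv)) J) D))
      rw [map_sum]
      refine Finset.sum_congr rfl fun J _ => ?_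
      rw [map_mul, parPow_res, act_tangent_res, ← act_res le_rfl h, coord_res]
      rfl⟩,
  fun W a (D : (tangent n m).obj W.1) => by
    constructor
    · intro ha
      change (∑ J, O.res W.2 (X J) *
        parPow J (act le_rfl (coord (fun v hv => hl v (coneSet_mono W.2 hv)) J) (a • D))) =
        a * (∑ J, O.res W.2 (X J) *
          parPow J (act le_rfl (coord (fun v hv => hl v (coneSet_mono W.2 hv)) J) D))
      rw [Finset.mul_sum]
      refine Finset.sum_congr rfl fun J _ => ?_
      rw [act_osmul, map_mul, ← mul_assoc, ← mul_assoc, ← O.even_comm ha]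
      congr 2
      exact parPow_even J ha
    · intro ha
      change (∑ J, O.res W.2 (X J) *
        parPow J (act le_rfl (coord (fun v hv => hl v (coneSet_mono W.2 hv)) J) (a • D))) =
        a * O.par (∑ J, O.res W.2 (X J) *
          parPow J (act le_rfl (coord (fun v hv => hl v (coneSet_mono W.2 hv)) J)
            ((tangent n m).par D)))
      rw [map_sum, Finset.mul_sum]
      refine Finset.sum_congr rfl fun J _ => ?_
      -- On the left the sign `(-1)^{|J|}` comes from the odd scalar `a` under `parPow J`, on the
      -- right from the parity of the `J`-th coordinate.
      rw [act_osmul, act_par, map_mul, map_mul, par_parPow, O.par_par, coord_par, act_smul, map_smul,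
        mul_smul_comm, mul_smul_comm, ← mul_assoc, ← mul_assoc, ← O.odd_comm ha]
      refine Eq.trans ?_ (smul_mul_assoc _ _ _)
      congr 1
      exact (congrArg _ (parPow_odd J ha)).trans (mul_smul_comm _ _ _)⟩

/-- Prescribed values must satisfy the relation that the fields satisfy. The assumption `hX` cancels
the correction term of `act_coord_field`, which occurs for `∂/∂z_l` only. -/
theorem pair_formOf {l : Fin (n + 1)} (hl : ∀ v ∈ coneSet U, v l ≠ 0)
    (X : Fin m ⊕ Fin (n + 1) → O m U) (hX : ∑ J, (sgn J • X J) * coord hl J = 0)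
    (J : Fin m ⊕ Fin (n + 1)) : pair (formOf hl X) le_rfl (field U l J) = X J := by
  change (∑ K, O.res le_rfl (X K) * parPow K (act le_rfl (coord hl K) (field U l J))) = X J
  have h1 : ∀ K, O.res le_rfl (X K) * parPow K (act le_rfl (coord hl K) (field U l J)) =
      (if J = K then X K else 0) - (if J = Sum.inr l then (sgn K • X K) * coord hl K else 0) := by
    intro K
    change X K * _ = _
    rw [act_coord_field, map_sub, mul_sub]
    congr 1
    · split_ifs
      · rw [map_one, mul_one]
      · rw [map_zero, mul_zero]
    · split_ifs
      · rw [parPow_coord, mul_smul_comm, smul_mul_assoc]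
      · rw [map_zero, mul_zero]
  rw [Finset.sum_congr rfl fun K _ => h1 K, Finset.sum_sub_distrib, Finset.sum_ite_eq]
  split_ifs with h2 h3
  · rw [hX, sub_zero]
  · simp
  · simp_all
  · simp_all

/-! ### The dual Euler sequence -/

/-- A coordinate that does not vanish at `v`. -/
def pick (v : Cone U) : Fin (n + 1) := (Function.ne_iff.1 v.2.1).choose

theorem pick_ne (v : Cone U) : v.1 (pick v) ≠ 0 := (Function.ne_iff.1 v.2.1).choose_spec

/-- The components of a one-form with respect to `dθ_a` and `dz_j`. -/
def component (ω : (piCotangent n m).obj U) (J : Fin m ⊕ Fin (n + 1)) (v : Cone U) : Lam m :=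
  sgn J • (v.1 (pick v))⁻¹ • (pair ω le_rfl (field U (pick v) J)).1 v

/-- Where `z_l` is nonzero, the fields for `l` and for `pick v` differ by the even factor `z_{pick
v} / z_l`, and the form is linear over it. -/
theorem component_eq (ω : (piCotangent n m).obj U) (J : Fin m ⊕ Fin (n + 1)) (v : Cone U)
    {l : Fin (n + 1)} (hl : v.1 l ≠ 0) :
    component ω J v = sgn J • (v.1 l)⁻¹ • (pair ω le_rfl (field U l J)).1 v := by
  let v' : Cone (U ⊓ chart l) := ⟨v.1, v.2.1, v.2.2, v.1, v.2.1, hl, rfl⟩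
  have h : ∀ l', (pair ω le_rfl (field U l' J)).1 v =
      (pair ω inf_le_left (field (U ⊓ chart l) l' J)).1 v' := fun l' =>
    (congrFun (congrArg Subtype.val (pair_field_res ω le_rfl
      (inf_le_left : U ⊓ chart l ≤ U) l' J)) v').symm
  have h1 : O.par (coord (m := m) (chart_ne (inf_le_right : U ⊓ chart l ≤ chart l))
      (Sum.inr (pick v))) = coord (chart_ne inf_le_right) (Sum.inr (pick v)) :=
    (coord_par _ _).trans (one_smul ℂ _)
  have h2 : (pair ω inf_le_left (field (U ⊓ chart l) (pick v) J)).1 v' =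
      ((v.1 l)⁻¹ • v.1 (pick v) • (1 : Lam m)) *
        (pair ω inf_le_left (field (U ⊓ chart l) l J)).1 v' := by
    rw [← coord_smul_field (chart_ne (inf_le_right : U ⊓ chart l ≤ chart l)) (pick v),
      pair_smul_even ω _ h1]
    rfl
  rw [component, h, h l, h2, smul_smul _ _ (1 : Lam m), smul_one_mul]
  congr 1
  rw [smul_smul, mul_left_comm, inv_mul_cancel₀ (pick_ne v), mul_one]

/-- The index `pick` may jump from point to point, but near `v` it can be replaced by the fixed
index `pick v`. -/
theorem isHol_component (ω : (piCotangent n m).obj U) (J : Fin m ⊕ Fin (n + 1)) :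
    IsHol (component ω J) := by
  let _ := lamNorm m
  let _ := lamNormedSpace m
  refine isHol_of_local fun v => ?_
  let X := pair ω le_rfl (field U (pick v) J)
  have hd : DifferentiableAt ℂ (fun w : Fin (n + 1) → ℂ => w (pick v)) v.1 := by fun_prop
  refine ⟨fun w => sgn J • (w (pick v))⁻¹ • ext X.1 w,
    ((hd.fun_inv (pick_ne v)).fun_smul
      (X.2.1.differentiableAt v)).fun_const_smul (sgn J), ?_⟩
  filter_upwards [(isOpen_coneSet U).mem_nhds v.2,
    (isOpen_ne_fun (continuous_apply (pick v)) continuous_const).mem_nhds (pick_ne v)] with w hw hw'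
  rw [ext_apply (component ω J) ⟨w, hw⟩, component_eq ω J ⟨w, hw⟩ hw', ← ext_apply X.1 ⟨w, hw⟩]

theorem isHomog_component (ω : (piCotangent n m).obj U) (J : Fin m ⊕ Fin (n + 1)) :
    IsHomog (-1) (component ω J) := by
  intro c hc v
  rw [component_eq ω J (v.smul c hc) (l := pick v) (mul_ne_zero hc (pick_ne v)), component,
    (pair ω le_rfl (field U (pick v) J)).2.2 c hc v, map_smul, map_smul, zpow_zero, one_smul,
    smul_comm _ (sgn J), zpow_neg_one, smul_smul c⁻¹]
  change sgn J • (c * v.1 (pick v))⁻¹ • _ = _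
  rw [mul_inv]

/-- The inclusion `Π𝒯* → 𝒪(-1)^{⊕ m|n+1}`. -/
def cotangentIncl (n m : ℕ) : (piCotangent n m).Hom (eulerMiddle n m) where
  app {U} :=
    { toFun := fun ω => (fun J => ⟨component ω J, isHol_component ω J, isHomog_component ω J⟩ :
        Fin m ⊕ Fin (n + 1) → twistSec m (-1) U)
      map_add' := fun ω η => funext fun J => Subtype.ext (funext fun v => by
        change component (ω + η) J v = component ω J v + component η J v
        rw [component, component, component, pair_add, ← smul_add, ← smul_add]
        rfl)
      map_smul' := fun a ω => funext fun J => Subtype.ext (funext fun v => by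
        change component (a • ω) J v = a.1 v * component ω J v
        rw [component, component, pair_osmul, mul_smul_comm, mul_smul_comm]
        rfl) }
  app_par {U} ω := by
    -- The minus sign of the parity change and the sign of `∂_J` together give `+` in the places of
    -- `θ_a` and `-` in those of `z_j`, as in the grading of the middle term.
    have h : ∀ J (v : Cone U), component ((piCotangent n m).par ω) J v =
        -(sgn J • inv (component ω J v)) := by
      intro J v
      rw [component, component, pair_par, field_par, map_smul, map_smul]
      change sgn J • (v.1 (pick v))⁻¹ • (-(sgn J • inv ((pair ω le_rfl _).1 v))) = _
      rw [map_smul, map_smul, smul_neg, smul_neg, smul_comm _ (sgn J) (inv _)]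
    funext J
    refine Subtype.ext (funext fun v => (h J v).trans ?_)
    rcases J with a | j
    · change -((-1 : ℂ) • inv (component ω (Sum.inl a) v)) = inv (component ω (Sum.inl a) v)
      rw [neg_one_smul, neg_neg]
    · change -((1 : ℂ) • inv (component ω (Sum.inr j) v)) = -inv (component ω (Sum.inr j) v)
      rw [one_smul]
  app_res {V U} h ω := funext fun J => Subtype.ext (funext fun v => by
    change component ((piCotangent n m).res h ω) J v = component ω J (v.incl h)
    have hv : (v.incl h).1 (pick v) ≠ 0 := pick_ne v
    rw [component_eq ω J (v.incl h) hv, component, pair_form_res, pair_field_res ω le_rfl h]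
    rfl)

/-- The Euler map in the affine coordinates `z_j / z_l`. -/
theorem euler_eq_sum {l : Fin (n + 1)} (hl : ∀ v ∈ coneSet U, v l ≠ 0)
    (s : Fin m ⊕ Fin (n + 1) → twistSec m (-1) U) :
    contraction (s : (eulerMiddle n m).obj U) = ∑ J, divCoord hl 1 (s J) * coord hl J := by
  refine Subtype.ext (funext fun v => ?_)
  have h1 : (∑ J, divCoord hl 1 (s J) * coord hl J).1 v =
      ∑ J, (v.1 l ^ (1 : ℤ) • (s J).1 v) * ((v.1 l)⁻¹ • coordFun J v) := by
    change ((Pi.evalAddMonoidHom (fun _ : Cone U => Lam m) v).comp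
      (O m U).subtype.toAddMonoidHom) (∑ J, divCoord hl 1 (s J) * coord hl J) = _
    rw [map_sum]; rfl
  rw [h1]
  change ∑ a, (s (Sum.inl a)).1 v * theta a + ∑ j, v.1 j • (s (Sum.inr j)).1 v = _
  rw [Fintype.sum_sum_type]
  congr 1 <;> refine Finset.sum_congr rfl fun a _ => ?_
  · rw [smul_mul_smul_comm, zpow_one, mul_inv_cancel₀ (hl _ v.2), one_smul]
    rfl
  · rw [smul_mul_smul_comm, zpow_one, mul_inv_cancel₀ (hl _ v.2), one_smul]
    exact ((mul_smul_comm _ _ _).trans (congrArg _ (mul_one _))).symm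

theorem divCoord_cotangentIncl {l : Fin (n + 1)} (hl : ∀ v ∈ coneSet U, v l ≠ 0)
    (ω : (piCotangent n m).obj U) (J : Fin m ⊕ Fin (n + 1)) :
    divCoord hl 1 (((cotangentIncl n m).app ω : Fin m ⊕ Fin (n + 1) → twistSec m (-1) U) J) =
      sgn J • pair ω le_rfl (field U l J) := by
  refine Subtype.ext (funext fun v => ?_)
  change v.1 l ^ (1 : ℤ) • component ω J v = sgn J • (pair ω le_rfl (field U l J)).1 v
  rw [component_eq ω J v (hl _ v.2), smul_comm _ (sgn J), zpow_one, smul_smul (v.1 l),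
    mul_inv_cancel₀ (hl _ v.2), one_smul]

theorem divCoord_injective {l : Fin (n + 1)} (hl : ∀ v ∈ coneSet U, v l ≠ 0) (d : ℤ) :
    Function.Injective (divCoord (m := m) hl d) := by
  intro s t h
  refine Subtype.ext (funext fun v => ?_)
  have h1 : v.1 l ^ d • s.1 v = v.1 l ^ d • t.1 v := congrFun (congrArg Subtype.val h) v
  exact smul_right_injective _ (zpow_ne_zero d (hl _ v.2)) h1

theorem cotangentIncl_injective (hU : IsSmall U) :
    Function.Injective ((cotangentIncl n m).app (U := U)) := by
  obtain ⟨l, hl⟩ := hU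
  intro ω η h
  refine form_ext_field hl fun J => ?_
  have h1 := congrArg (fun s : Fin m ⊕ Fin (n + 1) → twistSec m (-1) U => divCoord hl 1 (s J)) h
  have h2 := (divCoord_cotangentIncl hl ω J).symm.trans (h1.trans (divCoord_cotangentIncl hl η J))
  have h3 : ∀ x : O m U, sgn J • sgn J • x = x := fun x => by
    rw [smul_smul, sgn_mul_sgn, one_smul]
  rw [← h3 (pair ω le_rfl (field U l J)), h2, h3]

theorem contraction_cotangentIncl (hU : IsSmall U) (ω : (piCotangent n m).obj U) :
    contraction ((cotangentIncl n m).app ω) = 0 := by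
  obtain ⟨l, hl⟩ := hU
  refine (euler_eq_sum hl _).trans (Eq.trans ?_ (sum_pair_mul_coord hl ω))
  exact Finset.sum_congr rfl fun J _ => congrArg (· * _) (divCoord_cotangentIncl hl ω J)

/-- The entries of `s`, multiplied by `z_l` and by the sign of their place, prescribe values on the
fields `z_l ∂_J`. That `p` kills `s` is precisely the relation which `pair_formOf` demands. -/
theorem exists_cotangentIncl (hU : IsSmall U) {s : (eulerMiddle n m).obj U}
    (hs : contraction s = 0) : ∃ ω, (cotangentIncl n m).app ω = s := by
  obtain ⟨l, hl⟩ := hU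
  let s' : Fin m ⊕ Fin (n + 1) → twistSec m (-1) U := s
  let X : Fin m ⊕ Fin (n + 1) → O m U := fun J => sgn J • divCoord hl 1 (s' J)
  have h3 : ∀ (J : Fin m ⊕ Fin (n + 1)) (x : O m U), sgn J • sgn J • x = x := fun J x => by
    rw [smul_smul, sgn_mul_sgn, one_smul]
  refine ⟨formOf hl X, funext fun J => divCoord_injective hl 1 ?_⟩
  refine (divCoord_cotangentIncl hl _ J).trans ?_
  rw [pair_formOf hl X, h3]
  rw [← hs]
  refine Eq.trans ?_ (euler_eq_sum hl s').symm
  exact Finset.sum_congr rfl fun J _ => congrArg (· * _) (h3 J _)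

/-- The section of `𝒪(-1)^{⊕ m|n+1}` with the single entry `z_l⁻¹` at the place of `z_l`. -/
def coordSection (m : ℕ) {l : Fin (n + 1)} (hl : ∀ v ∈ coneSet U, v l ≠ 0) :
    (eulerMiddle n m).obj U := single (Sum.inr l) (coordPow m hl (-1))

theorem contraction_coordSection {l : Fin (n + 1)} (hl : ∀ v ∈ coneSet U, v l ≠ 0) :
    contraction (coordSection m hl) = 1 := by
  refine (euler_eq_sum hl _).trans ?_
  rw [Finset.sum_eq_single (Sum.inr l)]
  · rw [coord_self, mul_one]
    refine (congrArg (divCoord hl 1) (Pi.single_eq_same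
      (M := fun _ : Fin m ⊕ Fin (n + 1) => twistSec m (-1) U) _ _)).trans ?_
    refine Subtype.ext (funext fun v => ?_)
    change v.1 l ^ (1 : ℤ) • v.1 l ^ (-1 : ℤ) • (1 : Lam m) = 1
    rw [smul_smul, ← zpow_add₀ (hl _ v.2), add_neg_cancel, zpow_zero, one_smul]
  · intro J _ hJ
    refine (congrArg (divCoord hl 1 · * coord hl J) (Pi.single_eq_of_ne
      (M := fun _ : Fin m ⊕ Fin (n + 1) => twistSec m (-1) U) hJ _)).trans ?_
    simp only [map_zero, zero_mul]
  · exact fun h => absurd (Finset.mem_univ _) h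

theorem coordSection_par {l : Fin (n + 1)} (hl : ∀ v ∈ coneSet U, v l ≠ 0) :
    (eulerMiddle n m).par (coordSection m hl) = -coordSection m hl := by
  have h0 : ∀ J, J ≠ Sum.inr l → (coordSection m hl : Fin m ⊕ Fin (n + 1) → twistSec m (-1) U) J =
      0 := fun J hJ => Pi.single_eq_of_ne hJ _
  have h1 : (coordSection m hl : Fin m ⊕ Fin (n + 1) → twistSec m (-1) U) (Sum.inr l) =
      coordPow m hl (-1) :=
    Pi.single_eq_same (M := fun _ : Fin m ⊕ Fin (n + 1) => twistSec m (-1) U) _ _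
  funext J
  rcases J with a | j
  · change (twist n m (-1)).par ((coordSection m hl : Fin m ⊕ Fin (n + 1) → twistSec m (-1) U)
      (Sum.inl a)) = -(coordSection m hl : Fin m ⊕ Fin (n + 1) → twistSec m (-1) U) (Sum.inl a)
    rw [h0 _ Sum.inl_ne_inr, neg_zero]
    exact map_zero _
  · change -(twist n m (-1)).par ((coordSection m hl : Fin m ⊕ Fin (n + 1) → twistSec m (-1) U)
      (Sum.inr j)) = -(coordSection m hl : Fin m ⊕ Fin (n + 1) → twistSec m (-1) U) (Sum.inr j)
    by_cases hj : j = l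
    · subst hj
      rw [h1]
      refine congrArg Neg.neg (Subtype.ext (funext fun v => ?_))
      exact (by rw [map_smul, map_one] : inv (v.1 j ^ (-1 : ℤ) • (1 : Lam m)) = _)
    · rw [h0 _ (fun h => hj (Sum.inr_injective h))]
      exact congrArg Neg.neg (map_zero _)

/-- The dual Euler sequence is exact on small open sets. -/
theorem cotangentIncl_shortExact (n m : ℕ) :
    (cotangentIncl n m).toLocal.ShortExact (euler n m).toLocal where
  injective hU := cotangentIncl_injective hU
  exact {U} hU s := ⟨fun h => exists_cotangentIncl hU h, fun ⟨ω, h⟩ => by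
    subst h; exact contraction_cotangentIncl hU ω⟩
  surjective {U} hU (a : O m U) := by
    obtain ⟨l, hl⟩ := hU
    -- The section `dz_l / z_l` is mapped to `1`, so its multiples reach every function.
    refine ⟨a • coordSection m hl, ?_⟩
    refine (map_smul (euler n m).app a _).trans ?_
    refine (congrArg (a • ·) (contraction_coordSection hl)).trans ?_
    exact mul_one a

end SuperPresheaf
end SuperProj
end

noncomputable section
namespace SuperProj
namespace SuperPresheaf

variable {n m : ℕ} {U V W : Opens (projSpace n)}

/-! ### The Koszul sequence -/

/-- The Euler map on sections, with values in functions. -/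
def eulerC (n m : ℕ) (U : Opens (projSpace n)) : (eulerMiddle n m).obj U →ₗ[ℂ] O m U :=
  (euler n m).appC U

theorem eulerC_smul (a : O m U) (s : (eulerMiddle n m).obj U) :
    eulerC n m U (a • s) = a * eulerC n m U s := map_smul (euler n m).app a s

theorem isContractible_euler (n m : ℕ) (U : Opens (projSpace n)) :
    IsContractible (A := O m U) (M := (eulerMiddle n m).obj U) O.par (eulerMiddle n m).par
      (eulerC n m U) where
  toIsSuperModule := isSuperModule (eulerMiddle n m) U
  map_smul := eulerC_smul
  map_par s := (euler n m).app_par s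

/-- With `e = dz_l / z_l`, the section `s - p(s) e` is killed by `p` and so comes from a unique
one-form `r s`. By injectivity of the inclusion every property of `r` becomes an identity in the
middle term. -/
theorem exists_retraction (hU : IsSmall U) :
    ∃ (r : (eulerMiddle n m).obj U →ₗ[ℂ] (piCotangent n m).obj U) (e : (eulerMiddle n m).obj U),
      (eulerMiddle n m).par e = -e ∧ eulerC n m U e = 1 ∧
      (∀ s, (cotangentIncl n m).app (r s) = s - eulerC n m U s • e) ∧
      (∀ s, r ((eulerMiddle n m).par s) = (piCotangent n m).par (r s)) ∧
      (∀ (a : O m U) s, r (a • s) = a • r s) ∧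
      ∀ ω, r ((cotangentIncl n m).app ω) = ω := by
  obtain ⟨l, hl⟩ := id hU
  have inj := cotangentIncl_injective (m := m) hU
  have h1 : eulerC n m U (coordSection m hl) = 1 := contraction_coordSection hl
  have hpar := coordSection_par (m := m) hl
  set e := coordSection m hl
  have hex : ∀ s, ∃ ω, (cotangentIncl n m).app ω = s - eulerC n m U s • e := fun s => by
    refine exists_cotangentIncl hU ?_
    change eulerC n m U (s - eulerC n m U s • e) = 0
    rw [map_sub, eulerC_smul, h1, mul_one, sub_self]
  choose r hr using hex
  refine ⟨⟨⟨r, fun s t => inj ?_⟩, fun c s => inj ?_⟩, e, hpar, h1, hr, fun s => inj ?_,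
    fun a s => inj ?_, fun ω => inj ?_⟩
  · rw [hr, map_add, map_add, hr, hr, add_smul]; abel
  · refine (hr _).trans (Eq.trans ?_ ((cotangentIncl n m).app_smulC c (r s)).symm)
    rw [hr, map_smul, smul_assoc, smul_sub]
  · refine (hr _).trans (Eq.trans ?_ ((cotangentIncl n m).app_par (r s)).symm)
    rw [hr, map_sub, (eulerMiddle n m).par_smul, hpar, (isContractible_euler n m U).map_par,
      neg_smul, smul_neg]
  · refine (hr _).trans (Eq.trans ?_ (map_smul (cotangentIncl n m).app a (r s)).symm)
    rw [hr, eulerC_smul, smul_sub, mul_smul]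
  · refine (hr _).trans ?_
    have : eulerC n m U ((cotangentIncl n m).app ω) = 0 := contraction_cotangentIncl hU ω
    rw [this, zero_smul, sub_zero]

/-- The contraction `Sym^{k+1} (𝒪(-1)^{⊕ m|n+1}) → Sym^k (𝒪(-1)^{⊕ m|n+1})` on sections. -/
def contr (n m k : ℕ) (U : Opens (projSpace n)) :
    ((eulerMiddle n m).symPow (k + 1)).obj U →ₗ[O m U] ((eulerMiddle n m).symPow k).obj U :=
  (isContractible_euler n m U).contractPow k

theorem contr_par (k : ℕ) (x : ((eulerMiddle n m).symPow (k + 1)).obj U) :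
    contr n m k U (((eulerMiddle n m).symPow (k + 1)).par x) =
      -((eulerMiddle n m).symPow k).par (contr n m k U x) :=
  Subtype.ext ((isContractible_euler n m U).contract_inv x.1)

theorem contr_res (k : ℕ) (h : V ≤ U) (x : ((eulerMiddle n m).symPow (k + 1)).obj U) :
    contr n m k V (((eulerMiddle n m).symPow (k + 1)).res h x) =
      ((eulerMiddle n m).symPow k).res h (contr n m k U x) :=
  Subtype.ext ((isContractible_euler n m U).contract_map (isContractible_euler n m V)
    (O.res h) ((eulerMiddle n m).res h) (O.res_par h) ((eulerMiddle n m).res_par h)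
    ((eulerMiddle n m).res_smul h) (fun _ => rfl) x.1)

section koszul

variable (hU : IsSmall U) (k : ℕ)

include hU

theorem symPow_cotangentIncl_injective :
    Function.Injective (((cotangentIncl n m).symPow k).app (U := U)) := by
  obtain ⟨r, e, -, -, -, hr, hr', hri⟩ := exists_retraction (m := m) hU
  exact (IsContractible.symPowMap_leftInverse (σ := O.par) (i := (cotangentIncl n m).appC U)
    (r := r) (fun _ => rfl) (cotangentIncl n m).app_par
    (fun a s => map_smul (cotangentIncl n m).app a s) hr hr' hri k).injective

theorem contr_eq_zero_iff (x : ((eulerMiddle n m).symPow (k + 1)).obj U) :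
    contr n m k U x = 0 ↔ ∃ y, ((cotangentIncl n m).symPow (k + 1)).app y = x := by
  obtain ⟨r, e, he, -, hir, hr, hr', -⟩ := exists_retraction (m := m) hU
  exact (isContractible_euler n m U).contractPow_eq_zero_iff (i := (cotangentIncl n m).appC U)
    (r := r) (fun _ => rfl) (cotangentIncl n m).app_par
    (fun a s => map_smul (cotangentIncl n m).app a s) hr hr' he hir
    (contraction_cotangentIncl hU) x

theorem exists_eq_contr (x : ((eulerMiddle n m).symPow (k + 1)).obj U) :
    ∃ y, ((cotangentIncl n m).symPow k).app y = contr n m k U x := by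
  obtain ⟨r, e, he, -, hir, hr, hr', -⟩ := exists_retraction (m := m) hU
  exact (isContractible_euler n m U).exists_map_eq_contractPow (i := (cotangentIncl n m).appC U)
    (r := r) (fun _ => rfl) (cotangentIncl n m).app_par
    (fun a s => map_smul (cotangentIncl n m).app a s) hr hr' he hir x

theorem exists_contr_eq (y : ((piCotangent n m).symPow k).obj U) :
    ∃ x, contr n m k U x = ((cotangentIncl n m).symPow k).app y := by
  obtain ⟨r, e, he, hpe, -, -, -, -⟩ := exists_retraction (m := m) hU
  exact (isContractible_euler n m U).exists_contractPow_eq_map (i := (cotangentIncl n m).appC U)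
    (fun _ => rfl) (cotangentIncl n m).app_par
    (fun a s => map_smul (cotangentIncl n m).app a s) he hpe (contraction_cotangentIncl hU) y

end koszul

/-- The contraction `Sym^{k+1} (𝒪(-1)^{⊕ m|n+1}) → Π Sym^k Π𝒯*` on small open sets. -/
def contractLocalApp (k : ℕ) (hU : IsSmall U) :
    ((eulerMiddle n m).symPow (k + 1)).obj U →ₗ[O m U] ((piCotangent n m).symPow k).obj U :=
  -- The contraction takes its values in the image of the injective map `Sym^k i`, so it can be
  -- followed by the inverse of that map.
  (LinearEquiv.ofInjective ((cotangentIncl n m).symPow k).app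
    (symPow_cotangentIncl_injective hU k)).symm.toLinearMap.comp
      ((contr n m k U).codRestrict _ (exists_eq_contr hU k))

theorem symPow_contractLocalApp (k : ℕ) (hU : IsSmall U)
    (x : ((eulerMiddle n m).symPow (k + 1)).obj U) :
    ((cotangentIncl n m).symPow k).app (contractLocalApp k hU x) = contr n m k U x :=
  congrArg Subtype.val ((LinearEquiv.ofInjective ((cotangentIncl n m).symPow k).app
    (symPow_cotangentIncl_injective hU k)).apply_symm_apply _)

/-- The contraction `Sym^{k+1} (𝒪(-1)^{⊕ m|n+1}) → Π Sym^k Π𝒯*` on small open sets. -/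
def contractLocal (n m k : ℕ) :
    ((eulerMiddle n m).symPow (k + 1)).LocalHom ((piCotangent n m).symPow k).parityChange where
  app hU := contractLocalApp k hU
  app_par hU x := symPow_cotangentIncl_injective hU k (by
    refine (symPow_contractLocalApp k hU _).trans ((contr_par k x).trans ?_)
    refine Eq.trans ?_ (map_neg ((cotangentIncl n m).symPow k).app
      (((piCotangent n m).symPow k).par (contractLocalApp k hU x))).symm
    rw [((cotangentIncl n m).symPow k).app_par, symPow_contractLocalApp])
  app_res h hU x := symPow_cotangentIncl_injective (hU.mono h) k (by
    refine (symPow_contractLocalApp k (hU.mono h) _).trans ((contr_res k h x).trans ?_)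
    rw [← symPow_contractLocalApp k hU]
    exact (((cotangentIncl n m).symPow k).app_res h _).symm)

theorem contractLocal_shortExact (n m k : ℕ) :
    ((cotangentIncl n m).symPow (k + 1)).toLocal.ShortExact (contractLocal n m k) where
  injective hU := symPow_cotangentIncl_injective hU (k + 1)
  exact hU x := by
    refine Iff.trans ?_ (contr_eq_zero_iff hU k x)
    rw [← symPow_contractLocalApp k hU]
    exact ((map_eq_zero_iff _ (symPow_cotangentIncl_injective hU k))).symm
  surjective hU y := by
    obtain ⟨x, hx⟩ := exists_contr_eq hU k y
    exact ⟨x, symPow_cotangentIncl_injective hU k ((symPow_contractLocalApp k hU x).trans hx)⟩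

/-- The forms `i(ω_l)` are killed by `p`, so only the last factor `f` is contracted, and `p(f)`
appears on the right of the monomial. As `f` is odd, `p(f)` is even and may be moved to the left. -/
theorem isContraction_contractLocal (n m k : ℕ) :
    IsContraction (cotangentIncl n m) (contractLocal n m k).sheafMap := by
  intro U ω f hf
  refine eq_of_small fun V hV hs => ?_
  rw [sheafRes_onSections, sheafRes_sec, mon_res, (contractLocal n m k).onSections_sec hs]
  refine Eq.trans ?_ (sheafRes_sec ((piCotangent n m).symPow k).parityChange hV _).symm
  congr 1
  refine symPow_cotangentIncl_injective hs k ((symPow_contractLocalApp k hs _).trans ?_)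
  let ω' : Fin k → (piCotangent n m).obj V := fun j => (piCotangent n m).res hV (ω j)
  let f' : (eulerMiddle n m).obj V := (eulerMiddle n m).res hV f
  have e1 : (fun j => (eulerMiddle n m).res hV (Fin.snoc (α := fun _ => (eulerMiddle n m).obj U)
      (fun l => (cotangentIncl n m).app (ω l)) f j)) =
      Fin.snoc (α := fun _ => (eulerMiddle n m).obj V)
        (fun l => (cotangentIncl n m).app (ω' l)) f' := by
    funext j
    refine Fin.lastCases ?_ (fun j => ?_) j
    · rw [Fin.snoc_last, Fin.snoc_last]
    · rw [Fin.snoc_castSucc, Fin.snoc_castSucc]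
      exact ((cotangentIncl n m).app_res hV (ω j)).symm
  have e2 : ((piCotangent n m).symPow k).res hV (contraction f • (piCotangent n m).mon ω) =
      contraction f' • (piCotangent n m).mon ω' :=
    (((piCotangent n m).symPow k).res_smul hV _ _).trans
      (congrArg (contraction f' • ·) (mon_res (piCotangent n m) hV ω))
  rw [e1]
  refine Eq.trans ?_ (congrArg ((cotangentIncl n m).symPow k).app e2).symm
  rw [map_smul]
  refine Eq.trans ?_ (congrArg (contraction f' • ·) (SymPow.map_mon _ _ _ _ _ _).symm)
  refine Subtype.ext ?_
  have hE := isContractible_euler n m V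
  have h0 : hE.contract (SymAlg.mon O.par (eulerMiddle n m).par
      fun l => (cotangentIncl n m).app (ω' l)) = 0 :=
    hE.contract_mon_eq_zero _ fun l => contraction_cotangentIncl hs (ω' l)
  have h1 : O.par (contraction f') = contraction f' := by
    have h2 : (eulerMiddle n m).par f' = -f' := by
      have h3 : (eulerMiddle n m).par f = (-1 : ℂ) ^ 1 • f := hf
      change (eulerMiddle n m).par ((eulerMiddle n m).res hV f) = -(eulerMiddle n m).res hV f
      rw [← (eulerMiddle n m).res_par, h3, pow_one, neg_one_smul, map_neg]
    have h4 := hE.map_par f'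
    rw [h2, map_neg, neg_inj] at h4
    exact h4.symm
  exact (hE.contractPow_snoc _ f' h0).trans (hE.mul_coeff_even h1 _)

end SuperPresheaf
end SuperProj
end

/-! ### Assembly of the two short exact sequences and the cohomology sequence. -/

theorem mainTheorem4 (n m : ℕ) :
    ∃ i : (piCotangent n m).Hom (eulerMiddle n m),
      IsSuperShortExact (M := piCotangent n m) (N := eulerMiddle n m)
        (P := (unit n m).parityChange) i.sheafMap (euler n m).sheafMap ∧
      ∀ k : ℕ,
        ∃ (c : ((eulerMiddle n m).symPow (k + 1)).sheaf ≅ (symMiddle n m (k + 1)).sheaf)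
          (α : ((piCotangent n m).symPow (k + 1)).sheaf ⟶ (symMiddle n m (k + 1)).sheaf)
          (β : (symMiddle n m (k + 1)).sheaf ⟶ ((piCotangent n m).symPow k).parityChange.sheaf)
          (δ : ∀ q : ℕ, H q ((piCotangent n m).symPow k).parityChange →+
            H (q + 1) ((piCotangent n m).symPow (k + 1))),
          IsEven c.hom ∧ IsCanonical c.hom ∧
          α = (i.symPow (k + 1)).sheafMap ≫ c.hom ∧
          IsContraction i (c.hom ≫ β) ∧
          IsSuperShortExact α β ∧
          IsLongExact α β δ := by
  refine ⟨cotangentIncl n m, ⟨Hom.isEven _, Hom.isEven _, ?_⟩, fun k => ?_⟩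
  · obtain ⟨w, h, -⟩ := (cotangentIncl_shortExact n m).shortExact_sheaf (Iso.refl _)
    have h' : ∃ w : _ = 0, (ShortComplex.mk _ _ w).ShortExact := ⟨w, h⟩
    rw [Iso.refl_hom, Iso.refl_inv, Category.comp_id, Category.id_comp,
      Hom.toLocal_sheafMap] at h'
    -- The Euler map in the goal is replaced by the sheaf map of its local form, as it occurs in
    -- `h'`.
    generalize hg : (euler n m).sheafMap = g
    obtain rfl : LocalHom.sheafMap _ = g := (Hom.toLocal_sheafMap _).trans hg
    exact h'
  -- Here `β` is the inverse of `c` followed by the contraction, for the power `k + 1`; the factor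
  -- `c` cancels in `c ≫ β`.
  · let c := asIso (canonicalLocal n m (k + 1)).sheafMap
    have hc : IsEven c.hom := (canonicalLocal n m (k + 1)).isEven
    obtain ⟨w, h, h'⟩ := (contractLocal_shortExact n m k).shortExact_sheaf c
    simp only [Hom.toLocal_sheafMap] at w h h'
    obtain ⟨δ, hδ⟩ := exists_isLongExact h'
    refine ⟨c, _, _, δ, hc, isCanonical_canonicalLocal n m (k + 1), rfl, ?_,
      ⟨IsEven.comp (Hom.isEven _) hc, ?_, w, h⟩, hδ⟩
    · rw [Iso.hom_inv_id_assoc]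
      exact isContraction_contractLocal n m k
    · exact IsEven.comp (IsEven.inv (f := c.hom) hc) (contractLocal n m k).isEven
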